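/- **Setting.** Let $\mathcal V$ be a finite set of nodes and $\mathcal L\subseteq\mathcal V\times\mathcal V$ a set of directional links without loops such that $(u,v)\in\mathcal L$ implies $(v,u)\in\mathcal L$. Let $\mathcal N(v)$ be the set of neighbors of $v$ and $\Sigma=\max_v|\mathcal N(v)|$. A *matching* is a set of links such that every node belongs to at most one of them; $\mathcal S$ is the set of all matchings. The rates $X_i(t)\in[0,1]$ ($i\in\mathcal L$, $t\ge1$) are independent, and $X_i(t)$ has law $\mathcal D_i$ with mean $\mu_i$. Let $q_i\ge0$ be the queue lengths at the beginning of a frame of length $T$, $q^*=\max_iq_i$, $\kappa_i=q_i/q^*$ (and $\kappa_i=1$ if $q^*=0$), and $w_i=\kappa_i\mu_i$. For a weight vector $u$ put $r_u(S)=\sum_{i\in S}u_i$ and $r_u^*=\max_{S\in\mathcal S}r_u(S)$. Fix an integer $k\ge1$ and $p\in(0,1)$, let $\alpha=\frac{k-1}{k+1}$, $\bar{\mathcal S}^\alpha=\{S\in\mathcal S: r_w(S)<\alpha r_w^*\}$, and assume that $\bar{\mathcal S}^\alpha\neq\emptyset$. Let $$\Delta^\alpha_{\max}=\alpha r_w^*-\min_{S\in\bar{\mathcal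 S}^\alpha}r_w(S),\qquad \Delta^\alpha_{\min}=\alpha r_w^*-\max_{S\in\bar{\mathcal S}^\alpha}r_w(S).$$ **Scheme (A$^k$-UCB).** In slots $t=1,\dots,|\mathcal L|$ an arbitrary matching $\mathbf S_t$ containing the $t$-th link is scheduled. In every later slot $t$, $\mathbf S_t$ is the output of the following augmentation algorithm with input $\mathbf S_{t-1}$ and weights $$\bar w_{i,t}=\frac{\kappa_i}{\hat\tau_i(t-1)}\sum_{n=1}^{t-1}X_i(n)\mathbb I\{i\in\mathbf S_n\}+\sqrt{\frac{(|\mathcal L|+1)\ln t}{\hat\tau_i(t-1)}},$$ where $\hat\tau_i(t-1)$ is the number of slots up to $t-1$ in which $i$ was scheduled. *Augmentation algorithm*, with previous schedule $S$ and weights $\bar w$; its random choices are independent of each other, of the past and of the rates. Each node is a seed with probability $p$. A seed chooses a maximum size uniformly in $\{1,\dots,k\}$ and starts a list of links (an augmentation): it adds its link in $S$ and sends a request over it if it has such a link; otherwise it sends a request over a uniformly random link connected to it (if any). There are $2k+1$ synchronous mini-slots, the first of which is the one just described. A request is accepted if the receiver is not a seed, has never accepted a request before, and receives no other request in this mini-slot;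 otherwise the sender is the terminus of its augmentation. A node that accepted a request in the preceding mini-slot acts as follows. If it was reached over a link of $S$, and the number of added links outside $S$ (the size) is less than the maximum size, it sends a request over a uniformly random link that is connected to it and is not in the list; if the size equals the maximum or there is no such link, it is the terminus. If it was reached over a link outside $S$, this link is added; then, if the node has a link in $S$, it adds that link and sends a request over it; otherwise it is the terminus. Nodes that have accepted a request but not yet acted when the mini-slots end are also termini. Finally, if an augmentation starts with a link of $S$, its terminus $v$ was reached over a link of $S$, its size is less than its maximum size, and $v$ is a neighbor of the seed $s$, then the link $(v,s)$ is added. The gain of an augmentation is the sum of $\bar w_i$ over its links added as new links (links outside $S$ and the closing link) minus the sum over its links added as links of $S$. The output is $(S\setminus A)\cup(A\setminus S)$, where $A$ is the union of all augmentations with positive gain. **Statement.** With $Reg^\alpha(t)=t\,\alpha\,r_w^*-\mathbb E\big[\sum_{\tau=1}^tr_w(\mathbf S_\tau)\big]$, $$Reg^\alpha(t)\le\Delta^\alpha_{\max}\Big[D_1\frac{\log t}{(\Delta^\alpha_{\min})^2}+D_2\Big]\qquad\text{for all }t\in\{1,\dots,T\},$$ where $$D_1=\Big(1+\frac1\delta\Big)\cdot4|\mathcal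 L|^2(|\mathcal L|+1)(|\mathcal S|-1),$$ $$D_2=\frac{|\mathcal S|-1}{\delta}\Big(1+\frac{|\mathcal L|\delta\pi^2}{3}+\frac{|\mathcal L|(|\mathcal S|-2)\pi^2}{6}\Big)+\frac{1-\delta}{\delta}+\frac{2|\mathcal L|\pi^2}{3\delta},$$ $$\delta=\min\Big\{1,\Big(\frac p{1-p}\Big)^{|\mathcal V|}\Big\}\Big(\frac{1-p}{k\Sigma}\Big)^{|\mathcal V|}.$$ -/

import Mathlib

open MeasureTheory ProbabilityTheory

noncomputable section

namespace AkUCB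

/-! ## Network, schedules, weights

The set of directional links with reciprocal connectivity is the set `G.Dart` of ordered pairs
`(u, v)` of adjacent nodes of a simple graph `G`. -/

section Network

variable {V : Type*} [Fintype V] [DecidableEq V] (G : SimpleGraph V) [DecidableRel G.Adj]

/-- The set of links connected to `v`, in either direction. -/
def linksAt (v : V) : Finset G.Dart :=
  Finset.univ.filter fun d => d.fst = v ∨ d.snd = v

/-- The end of the link `d` other than `v` (for `d` connected to `v`). -/
def otherEnd {G : SimpleGraph V} (d : G.Dart) (v : V) : V :=
  if d.fst = v then d.snd else d.fst

/-- A matching (feasible schedule): every node belongs to at most one link. -/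
def IsMatching (S : Finset G.Dart) : Prop :=
  ∀ v : V, (S ∩ linksAt G v).card ≤ 1

instance (S : Finset G.Dart) : Decidable (IsMatching G S) :=
  inferInstanceAs (Decidable (∀ v : V, (S ∩ linksAt G v).card ≤ 1))

/-- The set of all matchings. -/
def matchings : Finset (Finset G.Dart) :=
  Finset.univ.filter (IsMatching G)

theorem matchings_nonempty : (matchings G).Nonempty :=
  ⟨∅, by simp [matchings, IsMatching]⟩

variable {G}

/-- Weight sum `r_w(S)`. -/
def weightSum (w : G.Dart → ℝ) (S : Finset G.Dart) : ℝ := ∑ i ∈ S, w i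

/-- The largest weight sum `r*_w` over all matchings. -/
def optSum (w : G.Dart → ℝ) : ℝ :=
  (matchings G).sup' (matchings_nonempty G) (weightSum w)

/-- The complement, among the matchings, of the set of near-optimal matchings
`{S | r_w(S) ≥ α r*_w}`. -/
def nonNearOptimal (α : ℝ) (w : G.Dart → ℝ) : Finset (Finset G.Dart) :=
  (matchings G).filter fun S => ¬ (α * optSum w ≤ weightSum w S)

/-- Maximum near-optimal gap. -/
def gapMax (α : ℝ) (w : G.Dart → ℝ) (h : (nonNearOptimal α w).Nonempty) : ℝ :=
  α * optSum w - (nonNearOptimal α w).inf' h (weightSum w)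

/-- Minimum near-optimal gap. -/
def gapMin (α : ℝ) (w : G.Dart → ℝ) (h : (nonNearOptimal α w).Nonempty) : ℝ :=
  α * optSum w - (nonNearOptimal α w).sup' h (weightSum w)

/-- The factor `q_i / q*`, where `q* = max_j q_j`; it is `1` if `q* = 0`. -/
def queueFactor (q : G.Dart → ℝ) (i : G.Dart) : ℝ :=
  if (⨆ j, q j) = 0 then 1 else q i / ⨆ j, q j

/-- The mean weight `w_i = (q_i / q*) μ_i`, where `μ_i` is the mean of the rate law `D i`. -/
def meanWeight (q : G.Dart → ℝ) (D : G.Dart → Measure ℝ) (i : G.Dart) : ℝ :=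
  queueFactor q i * ∫ x, x ∂(D i)

end Network

/-! ## The randomized augmentation algorithm (one time slot) -/

section Augmentation

variable {V : Type*} [Fintype V] [DecidableEq V] (G : SimpleGraph V) [DecidableRel G.Adj]

/-- A choice of an element from every nonempty set of links. -/
def Choice : Type _ :=
  (B : {B : Finset G.Dart // B.Nonempty}) → {d : G.Dart // d ∈ B.1}

instance : MeasurableSpace (Choice G) := ⊤

/-- The random choices of one node during one time slot: whether it is a seed, the maximum size of
its augmentation if it is one, and the link that it picks when it has to pick one at random from a
given set. A node does the latter at most once per time slot. -/
abbrev NodeCoin : Type _ := Bool × ℕ × Choice G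

/-- The random choices of all nodes during one time slot. -/
abbrev Coins : Type _ := V → NodeCoin G

/-- Law of the choices of one node: it is a seed with probability `p`, the maximum size is uniform
on `{1, …, k}`, and a link is picked uniformly (the uniform law on the choice functions makes the
pick from each nonempty set uniform on that set). -/
def nodeCoinLaw (p : ℝ) (k : ℕ) : Measure (NodeCoin G) :=
  (ENNReal.ofReal p • Measure.dirac true + ENNReal.ofReal (1 - p) • Measure.dirac false).prod
    ((uniformOn (Set.Icc 1 k)).prod (uniformOn Set.univ))

/-- All nodes choose independently. -/
def coinLaw (p : ℝ) (k : ℕ) : Measure (Coins G) :=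
  Measure.pi fun _ => nodeCoinLaw G p k

/-- The variables that a node holds about the augmentation it takes part in: its seed (the first
node), its list of links, its gain, its size (the number of new links), its maximum size, and
whether the link over which the holder was reached is in the previous schedule. -/
structure Record where
  seed : V
  links : List G.Dart
  gain : ℝ
  size : ℕ
  maxSize : ℕ
  alt : Bool

/-- State of a node between two mini-slots. An active node holds a record and the link over which
it received it; a node in state `done` is the terminus of an augmentation. -/
inductive NodeState where
  | null
  | active (r : Record G) (via : G.Dart)
  | used
  | done (r : Record G)

/-- What a node does in a mini-slot: nothing, stop as a terminus, or send the request `msg` over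
the link `l` while keeping the record `own`. -/
inductive Intent where
  | idle
  | halt (own : Record G)
  | send (own msg : Record G) (l : G.Dart)

variable {G}

/-- The link of the schedule `S` at `v`, if there is one. -/
def scheduledLink (S : Finset G.Dart) (v : V) : Option G.Dart :=
  (S ∩ linksAt G v).toList.head?

/-- A seed starts with its scheduled link if it has one, and otherwise with a random link. A node
that is not a seed is idle. -/
def seedIntent (coins : Coins G) (S : Finset G.Dart) (w : G.Dart → ℝ) (v : V) : Intent G :=
  if (coins v).1 = true then
    let r : Record G := ⟨v, [], 0, 0, (coins v).2.1, false⟩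
    match scheduledLink S v with
    | some m =>
      let r' : Record G := { r with links := [m], gain := -w m }
      .send r' { r' with alt := true } m
    | none =>
      if h : (linksAt G v).Nonempty then
        .send r r ((coins v).2.2 ⟨linksAt G v, h⟩).1
      else .halt r
  else .idle

/-- Extension of an augmentation by an active node. If it was reached over a link of `S`, it picks a
random link outside the augmentation, unless there is none or the maximum size has been reached.
If it was reached over a link outside `S`, it adds this link, and continues with its scheduled
link if it has one. -/
def extendIntent (coins : Coins G) (S : Finset G.Dart) (w : G.Dart → ℝ) (v : V) :
    NodeState G → Intent G
  | .active r e =>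
    if r.alt = true then
      if h : (linksAt G v \ r.links.toFinset).Nonempty ∧ r.size < r.maxSize then
        .send r { r with alt := false } ((coins v).2.2 ⟨linksAt G v \ r.links.toFinset, h.1⟩).1
      else .halt r
    else
      let r' : Record G :=
        { r with links := r.links ++ [e], gain := r.gain + w e, size := r.size + 1 }
      match scheduledLink S v with
      | some m =>
        let r'' : Record G := { r' with links := r'.links ++ [m], gain := r'.gain - w m }
        .send r'' { r'' with alt := true } m
      | none => .halt r'
  | _ => .idle

/-- The node to which a node `u` with intent `a` sends a request, if any. -/
def Intent.target (u : V) (a : Intent G) : Option V :=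
  match a with
  | .send _ _ l => some (otherEnd l u)
  | _ => none

/-- The nodes that send a request to `n`. -/
def callers (I : V → Intent G) (n : V) : Finset V :=
  Finset.univ.filter fun u => (I u).target u = some n

/-- A request is successfully received (and acknowledged) by `n` if `n` is in state `null` and
there is no collision, that is, no other request to `n` in the same mini-slot. -/
def Accepts (st : V → NodeState G) (I : V → Intent G) (n : V) : Prop :=
  st n = .null ∧ (callers I n).card = 1

open Classical in
/-- The states after one mini-slot. A sender becomes `used` if its request is acknowledged and a
terminus otherwise; a node in state `null` that successfully receives a request becomes active. -/
def exchange (st : V → NodeState G) (I : V → Intent G) (v : V) : NodeState G :=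
  match I v with
  | .halt own => .done own
  | .send own _ l => if Accepts st I (otherEnd l v) then .used else .done own
  | .idle =>
    if Accepts st I v then
      match (callers I v).toList with
      | u :: _ =>
        match I u with
        | .send _ msg l => .active msg l
        | _ => st v
      | [] => st v
    else st v

/-- Initialization: the first mini-slot. The requests of the seeds reach the other nodes. -/
def afterInit (coins : Coins G) (S : Finset G.Dart) (w : G.Dart → ℝ) : V → NodeState G :=
  let I := seedIntent coins S w
  exchange (fun v => if (coins v).1 = true then .used else .null) I

/-- One mini-slot of the path augmenting stage. -/
def miniSlot (coins : Coins G) (S : Finset G.Dart) (w : G.Dart → ℝ) (st : V → NodeState G) :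
    V → NodeState G :=
  exchange st fun v => extendIntent coins S w v (st v)

/-- The states at the end of the path augmenting stage, which takes the mini-slots
`2, …, 2k + 1`. -/
def afterAugmenting (k : ℕ) (coins : Coins G) (S : Finset G.Dart) (w : G.Dart → ℝ) :
    V → NodeState G :=
  (miniSlot coins S w)^[2 * k] (afterInit coins S w)

open Classical in
/-- Check for a cycle at the terminus `v`: if the augmentation starts with a link of `S`, ends at
`v` with a link of `S`, has not reached its maximum size, and `v` is adjacent to its first node, then
the link from `v` to the first node is added. -/
def closeCycle (S : Finset G.Dart) (w : G.Dart → ℝ) (v : V) (r : Record G) : Record G :=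
  if h : G.Adj v r.seed then
    if r.alt = true ∧ (∃ m ∈ S, r.links.head? = some m) ∧ r.size < r.maxSize then
      { r with links := r.links ++ [⟨(v, r.seed), h⟩], gain := r.gain + w ⟨(v, r.seed), h⟩ }
    else r
  else r

/-- The final augmentation of which `v` is the terminus, if any. The nodes that are still active
become termini. -/
def finalRecord (k : ℕ) (coins : Coins G) (S : Finset G.Dart) (w : G.Dart → ℝ) (v : V) :
    Option (Record G) :=
  match afterAugmenting k coins S w v with
  | .active r _ => some (closeCycle S w v r)
  | .done r => some (closeCycle S w v r)
  | _ => none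

open Classical in
/-- The links of the augmentation with terminus `v` if its gain is positive. -/
def switchedLinks (k : ℕ) (coins : Coins G) (S : Finset G.Dart) (w : G.Dart → ℝ) (v : V) :
    Finset G.Dart :=
  match finalRecord k coins S w v with
  | some r => if 0 < r.gain then r.links.toFinset else ∅
  | none => ∅

/-- The new schedule: the previous schedule `S`, augmented with all the generated augmentations of
positive gain. -/
def augment (k : ℕ) (coins : Coins G) (S : Finset G.Dart) (w : G.Dart → ℝ) : Finset G.Dart :=
  let A := Finset.univ.biUnion (switchedLinks k coins S w)
  (S \ A) ∪ (A \ S)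

end Augmentation

/-! ## The joint scheme in a frame, its regret, and the constants -/

section Scheme

variable {V : Type*} [Fintype V] [DecidableEq V] {G : SimpleGraph V} [DecidableRel G.Adj]

variable (G) in
/-- What the scheme keeps after a time slot: the schedule of this slot and, for each link, how many
times it was played and the sum of the rates observed. -/
structure History where
  sched : Finset G.Dart
  plays : G.Dart → ℕ
  total : G.Dart → ℝ

/-- UCB index of link `i` in slot `t`, computed from the observations before `t`. -/
def ucbIndex (q : G.Dart → ℝ) (t : ℕ) (h : History G) (i : G.Dart) : ℝ :=
  queueFactor q i * (h.total i / h.plays i) +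
    Real.sqrt (((Fintype.card G.Dart : ℝ) + 1) * Real.log t / h.plays i)

/-- The run of the scheme given the rates `x t` and the random choices `c t` of the slots
`t = 1, 2, …`. In each of the first `|L|` slots the schedule is prescribed by `first`; afterwards it
is produced by the augmentation algorithm from the previous schedule and the UCB indices. Only the
rates of scheduled links are observed. -/
def run (k : ℕ) (q : G.Dart → ℝ) (first : Fin (Fintype.card G.Dart) → Finset G.Dart)
    (x : ℕ → G.Dart → ℝ) (c : ℕ → Coins G) : ℕ → History G
  | 0 => ⟨∅, fun _ => 0, fun _ => 0⟩
  | t + 1 =>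
    let h := run k q first x c t
    let S : Finset G.Dart :=
      if ht : t < Fintype.card G.Dart then first ⟨t, ht⟩
      else augment k (c (t + 1)) h.sched (ucbIndex q (t + 1) h)
    ⟨S, fun i => h.plays i + if i ∈ S then 1 else 0,
      fun i => h.total i + if i ∈ S then x (t + 1) i else 0⟩

/-- The `α`-regret `t α r*_w - E[∑_{τ=1}^t r_w(S_τ)]` of a sequence of random schedules. -/
def alphaRegret {Ω : Type*} [MeasurableSpace Ω] (P : Measure Ω) (α : ℝ) (w : G.Dart → ℝ)
    (S : ℕ → Ω → Finset G.Dart) (t : ℕ) : ℝ :=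
  t * α * optSum w - ∫ ω, ∑ τ ∈ Finset.Icc 1 t, weightSum w (S τ ω) ∂P

variable (G)

/-- `δ = min {1, (p / (1 - p))^|V|} ((1 - p) / (k Σ))^|V|`, with `Σ` the maximum node degree. -/
def delta (p : ℝ) (k : ℕ) : ℝ :=
  min 1 ((p / (1 - p)) ^ Fintype.card V) *
    ((1 - p) / (k * G.maxDegree)) ^ Fintype.card V

/-- The constant `D₁`. -/
def constD₁ (δ : ℝ) : ℝ :=
  (1 + 1 / δ) * (4 * (Fintype.card G.Dart : ℝ) ^ 2 * ((Fintype.card G.Dart : ℝ) + 1)) *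
    (((matchings G).card : ℝ) - 1)

/-- The constant `D₂`. -/
def constD₂ (δ : ℝ) : ℝ :=
  (((matchings G).card : ℝ) - 1) / δ *
      (1 + (Fintype.card G.Dart : ℝ) * δ * Real.pi ^ 2 / 3 +
        (Fintype.card G.Dart : ℝ) * (((matchings G).card : ℝ) - 2) * Real.pi ^ 2 / 6) +
    (1 - δ) / δ + 2 * (Fintype.card G.Dart : ℝ) * Real.pi ^ 2 / (3 * δ)

end Scheme

end AkUCB

end

/-!
The proof combines a guarantee for a single run of the augmentation algorithm with a confidence
bound for the indices.

*One run of the algorithm.* Let `S` be the previous schedule, `w ≥ 0` the weights and `R` a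
matching of maximum weight. For any random choices, distinct augmentations touch disjoint sets of
nodes (`exchange_stateInv`); hence the output is a matching (`augment_isMatching`) whose weight
exceeds that of `S` by at least the sum of the positive gains (`weightSum_add_gain_le`).
The links of `R \ S` and of `S` form alternating paths and cycles. If the links of `R \ S` are added
in the order of decreasing weight, the link that closes a cycle is a lightest one. Every path can be
cut into pieces with at most `k` new links at the cost of a fraction `1 / (k + 1)` of its weight, and
a long cycle can be opened at its lightest link first; so the pieces keep the fraction
`(k - 1) / (k + 1)` of the weight of `R \ S` (`exists_pieces`). The algorithm generates exactly these
pieces if exactly their first nodes are seeds, with the right maximum sizes, and each of the other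
nodes picks the right link (`weightSum_augment_of_complies`). A node picks at most one link, and the
nodes choose independently, so this has probability at least `δ` (`delta_le_coinLaw`). A seed without
scheduled link is less likely to pick the right link than the factor `1 / (k Σ)` demands, because
each neighbor can be reached over two opposite links; but the node that it reaches has nothing to
pick, which makes up for it.

*The confidence bound.* For every link, `exp (s (total - N μ) - N s² / 8)` is a supermartingale by
Hoeffding's lemma, where `N` is the number of observations (`lintegral_expWeight_le`). A union bound
over the links and the values of `N` shows that the mean weights are outside the confidence intervals
in slot `t` with probability at most `2 |L| / t²` (`misestimated_le`).

*The regret.* After the initial slots, a schedule that is not near-optimal requires that one of its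
links has been observed too rarely, or that some link is misestimated, or that the previous schedule
was not near-optimal either and the augmentation algorithm has failed
(`augment_mem_nonNearOptimal`). The first event occurs at most `|L| · l` times, with
`l = 4 |L|² (|L| + 1) log t / Δ_min²`; the probabilities of the second one are summable; and the last
one has at most `1 - δ` times the probability of the previous schedule not being near-optimal.
Summing this recursion bounds the expected number of slots with a schedule that is not near-optimal
(`sum_nonNearOptimal_le`), each of which costs at most the maximum gap. Since `|L| ≤ |𝒮| - 1`, the
bound is below the claimed one.
-/

noncomputable section

set_option linter.unusedSectionVars false

namespace AkUCB

/-! ### Links, matchings and scheduled links -/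

section Basic

variable {V : Type*} [Fintype V] [DecidableEq V] {G : SimpleGraph V} [DecidableRel G.Adj]

theorem mem_linksAt {d : G.Dart} {v : V} : d ∈ linksAt G v ↔ d.fst = v ∨ d.snd = v := by
  simp [linksAt]

theorem isMatching_iff {S : Finset G.Dart} :
    IsMatching G S ↔ ∀ v, ∀ d ∈ S, ∀ d' ∈ S, d ∈ linksAt G v → d' ∈ linksAt G v → d = d' := by
  unfold IsMatching
  refine forall_congr' fun v => ?_
  rw [Finset.card_le_one]
  simp only [Finset.mem_inter]
  constructor
  · intro h d hd d' hd' h1 h2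
    exact h d ⟨hd, h1⟩ d' ⟨hd', h2⟩
  · rintro h d ⟨hd, h1⟩ d' ⟨hd', h2⟩
    exact h d hd d' hd' h1 h2

theorem IsMatching.eq_of_mem {S : Finset G.Dart} (h : IsMatching G S) {v : V} {d d' : G.Dart}
    (hd : d ∈ S) (hd' : d' ∈ S) (h1 : d ∈ linksAt G v) (h2 : d' ∈ linksAt G v) : d = d' :=
  isMatching_iff.1 h v d hd d' hd' h1 h2

theorem mem_linksAt_otherEnd (d : G.Dart) (v : V) : d ∈ linksAt G (otherEnd d v) := by
  rw [mem_linksAt]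
  unfold otherEnd
  split_ifs <;> simp

theorem otherEnd_ne (d : G.Dart) (v : V) : otherEnd d v ≠ v := by
  unfold otherEnd
  split_ifs with h1
  · intro h2
    exact d.adj.ne (h1.trans h2.symm)
  · exact h1

theorem mem_linksAt_iff {d : G.Dart} {v x : V} (h : d ∈ linksAt G v) :
    d ∈ linksAt G x ↔ x = v ∨ x = otherEnd d v := by
  rw [mem_linksAt] at *
  unfold otherEnd
  split_ifs with h1
  · constructor
    · rintro (h2 | h2)
      · exact Or.inl (h2.symm.trans h1)
      · exact Or.inr h2.symm
    · rintro (h2 | h2)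
      · exact Or.inl (h1.trans h2.symm)
      · exact Or.inr h2.symm
  · have h3 := h.resolve_left h1
    constructor
    · rintro (h2 | h2)
      · exact Or.inr h2.symm
      · exact Or.inl (h2.symm.trans h3)
    · rintro (h2 | h2)
      · exact Or.inr (h3.trans h2.symm)
      · exact Or.inl h2.symm

theorem scheduledLink_eq_some {S : Finset G.Dart} {v : V} {m : G.Dart}
    (h : scheduledLink S v = some m) : m ∈ S ∧ m ∈ linksAt G v := by
  have := List.mem_of_mem_head? (Option.mem_def.2 h)
  simpa using this

theorem scheduledLink_eq_none {S : Finset G.Dart} {v : V} (h : scheduledLink S v = none) :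
    ∀ m ∈ S, m ∉ linksAt G v := by
  unfold scheduledLink at h
  rw [List.head?_eq_none_iff, Finset.toList_eq_nil] at h
  intro m hm hv
  have : m ∈ S ∩ linksAt G v := Finset.mem_inter.2 ⟨hm, hv⟩
  simp [h] at this

theorem IsMatching.scheduledLink_eq {S : Finset G.Dart} (hS : IsMatching G S) {v : V} {m : G.Dart}
    (hm : m ∈ S) (hv : m ∈ linksAt G v) : scheduledLink S v = some m := by
  cases h : scheduledLink S v with
  | none => exact absurd hv (scheduledLink_eq_none h m hm)
  | some m' =>
    obtain ⟨h1, h2⟩ := scheduledLink_eq_some h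
    rw [hS.eq_of_mem h1 hm h2 hv]

/-! ### One exchange of requests -/

theorem mem_callers {I : V → Intent G} {n u : V} :
    u ∈ callers I n ↔ ∃ own msg l, I u = .send own msg l ∧ otherEnd l u = n := by
  unfold callers Intent.target
  rw [Finset.mem_filter]
  cases I u <;> simp

theorem exchange_halt {st : V → NodeState G} {I : V → Intent G} {v : V} {own : Record G}
    (h : I v = .halt own) : exchange st I v = .done own := by
  simp [exchange, h]

theorem exchange_send_accept {st : V → NodeState G} {I : V → Intent G} {v : V} {own msg : Record G}
    {l : G.Dart} (h : I v = .send own msg l) (ha : Accepts st I (otherEnd l v)) :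
    exchange st I v = .used := by
  simp [exchange, h, ha]

theorem exchange_send_reject {st : V → NodeState G} {I : V → Intent G} {v : V} {own msg : Record G}
    {l : G.Dart} (h : I v = .send own msg l) (ha : ¬ Accepts st I (otherEnd l v)) :
    exchange st I v = .done own := by
  simp [exchange, h, ha]

theorem exchange_idle_reject {st : V → NodeState G} {I : V → Intent G} {v : V}
    (h : I v = .idle) (ha : ¬ Accepts st I v) : exchange st I v = st v := by
  simp [exchange, h, ha]

theorem exchange_idle_accept {st : V → NodeState G} {I : V → Intent G} {u v : V}
    {own msg : Record G} {l : G.Dart} (h : I v = .idle) (ha : Accepts st I v)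
    (hu : I u = .send own msg l) (hl : otherEnd l u = v) :
    exchange st I v = .active msg l := by
  have hc : callers I v = {u} := by
    obtain ⟨u', hu'⟩ := Finset.card_eq_one.1 ha.2
    have : u ∈ callers I v := mem_callers.2 ⟨own, msg, l, hu, hl⟩
    rw [hu', Finset.mem_singleton] at this
    rw [hu', this]
  simp [exchange, h, ha, hc, hu]

theorem Accepts.exists_sender {st : V → NodeState G} {I : V → Intent G} {v : V}
    (ha : Accepts st I v) : ∃ u own msg l, I u = .send own msg l ∧ otherEnd l u = v := by
  obtain ⟨u, hu⟩ := Finset.card_eq_one.1 ha.2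
  have : u ∈ callers I v := by simp [hu]
  exact ⟨u, mem_callers.1 this⟩

theorem Accepts.sender_unique {st : V → NodeState G} {I : V → Intent G} {v u u' : V}
    {own msg own' msg' : Record G} {l l' : G.Dart}
    (ha : Accepts st I v) (hu : I u = .send own msg l) (hl : otherEnd l u = v)
    (hu' : I u' = .send own' msg' l') (hl' : otherEnd l' u' = v) : u = u' :=
  Finset.card_le_one.1 ha.2.le u (mem_callers.2 ⟨_, _, _, hu, hl⟩) u'
    (mem_callers.2 ⟨_, _, _, hu', hl'⟩)

end Basic

/-! ### Invariants of the augmentations -/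

section Invariant

variable {V : Type*} [Fintype V] [DecidableEq V] {G : SimpleGraph V} [DecidableRel G.Adj]

/-- The contribution of a link to the gain of an augmentation of the schedule `S`. -/
def signedWeight (S : Finset G.Dart) (w : G.Dart → ℝ) (e : G.Dart) : ℝ :=
  if e ∈ S then -w e else w e

/-- The links of an augmentation that are not in the schedule `S`. -/
def newLinks (S : Finset G.Dart) (l : List G.Dart) : List G.Dart :=
  l.filter fun e => e ∉ S

theorem mem_newLinks {S : Finset G.Dart} {l : List G.Dart} {e : G.Dart} :
    e ∈ newLinks S l ↔ e ∈ l ∧ e ∉ S := by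
  simp [newLinks]

/-- What holds for a record `r` at any time. The list `p` consists of the new links of the record,
possibly together with the one over which the record has just been sent. The function `own` gives,
for every node reached by now, the seed of the augmentation that reached it first. -/
structure RecordInv (coins : Coins G) (S : Finset G.Dart) (w : G.Dart → ℝ) (own : V → Option V)
    (r : Record G) (p : List G.Dart) : Prop where
  isSeed : (coins r.seed).1 = true
  disj : p.Pairwise fun e e' => ∀ x, e ∈ linksAt G x → e' ∉ linksAt G x
  notMem : ∀ e ∈ p, e ∉ S
  owned : ∀ e ∈ p, ∀ x, e ∈ linksAt G x → own x = some r.seed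
  gain : r.gain = (r.links.map (signedWeight S w)).sum
  seedFree : (∃ m ∈ S, m ∈ linksAt G r.seed) → ∀ e ∈ p, e ∉ linksAt G r.seed
  head : ∀ m ∈ S, r.links.head? = some m → m ∈ linksAt G r.seed

/-- What holds for a record `r` held by a node `v` that is a terminus or was reached over a link of
the schedule: every scheduled link at an end of a new link is in the record, and if `v` was reached
over a scheduled link, then this link is in the record and `v` is on no new link. -/
structure Holder (coins : Coins G) (S : Finset G.Dart) (w : G.Dart → ℝ) (own : V → Option V)
    (v : V) (r : Record G) : Prop where
  own_eq : own v = some r.seed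
  inv : RecordInv coins S w own r (newLinks S r.links)
  cover : ∀ e ∈ newLinks S r.links, ∀ x, e ∈ linksAt G x → ∀ m ∈ S, m ∈ linksAt G x → m ∈ r.links
  alt_coin : r.alt = true → (coins v).1 = false
  alt_free : r.alt = true → ∀ e ∈ newLinks S r.links, e ∉ linksAt G v
  alt_cover : r.alt = true → ∀ m ∈ S, m ∈ linksAt G v → m ∈ r.links
  alt_seed : r.alt = true → ∀ m ∈ S, m ∈ linksAt G v → m ∈ linksAt G r.seed → r.links = [m]

/-- What holds for a node `v` that has just received the record `r` over the link `e` outside the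
schedule. -/
structure Pending (coins : Coins G) (S : Finset G.Dart) (w : G.Dart → ℝ) (own : V → Option V)
    (v : V) (r : Record G) (e : G.Dart) : Prop where
  own_eq : own v = some r.seed
  coin : (coins v).1 = false
  alt : r.alt = false
  via_mem : e ∈ linksAt G v
  inv : RecordInv coins S w own r (newLinks S r.links ++ [e])
  cover : ∀ e' ∈ newLinks S r.links ++ [e], ∀ x, x ≠ v → e' ∈ linksAt G x →
    ∀ m ∈ S, m ∈ linksAt G x → m ∈ r.links

theorem Pending.holder {coins : Coins G} {S : Finset G.Dart} {w : G.Dart → ℝ} {own : V → Option V}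
    {v : V} {r : Record G} {e : G.Dart} (h : Pending coins S w own v r e) :
    Holder coins S w own v r where
  own_eq := h.own_eq
  inv :=
    { isSeed := h.inv.isSeed
      disj := (List.pairwise_append.1 h.inv.disj).1
      notMem := fun e' he' => h.inv.notMem e' (List.mem_append_left _ he')
      owned := fun e' he' => h.inv.owned e' (List.mem_append_left _ he')
      gain := h.inv.gain
      seedFree := fun hm e' he' => h.inv.seedFree hm e' (List.mem_append_left _ he')
      head := h.inv.head }
  cover := by
    intro e' he' x hx
    refine h.cover e' (List.mem_append_left _ he') x ?_ hx
    rintro rfl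
    exact (List.pairwise_append.1 h.inv.disj).2.2 e' he' e (by simp) _ hx h.via_mem
  alt_coin := by simp [h.alt]
  alt_free := by simp [h.alt]
  alt_cover := by simp [h.alt]
  alt_seed := by simp [h.alt]

/-- What holds for an active node. -/
def ActiveInv (coins : Coins G) (S : Finset G.Dart) (w : G.Dart → ℝ) (own : V → Option V)
    (v : V) (r : Record G) (e : G.Dart) : Prop :=
  (r.alt = true ∧ Holder coins S w own v r) ∨ Pending coins S w own v r e

theorem ActiveInv.holder {coins : Coins G} {S : Finset G.Dart} {w : G.Dart → ℝ}
    {own : V → Option V} {v : V} {r : Record G} {e : G.Dart} (h : ActiveInv coins S w own v r e) :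
    Holder coins S w own v r :=
  h.elim (fun h => h.2) fun h => h.holder

/-- Later assignments of seeds to nodes extend the earlier ones. -/
def Extends (own own' : V → Option V) : Prop :=
  ∀ x s, own x = some s → own' x = some s

theorem RecordInv.mono {coins : Coins G} {S : Finset G.Dart} {w : G.Dart → ℝ}
    {own own' : V → Option V} {r : Record G} {p : List G.Dart} (h : RecordInv coins S w own r p)
    (ho : Extends own own') : RecordInv coins S w own' r p :=
  { h with owned := fun e he x hx => ho _ _ (h.owned e he x hx) }

theorem Holder.mono {coins : Coins G} {S : Finset G.Dart} {w : G.Dart → ℝ}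
    {own own' : V → Option V} {v : V} {r : Record G} (h : Holder coins S w own v r)
    (ho : Extends own own') : Holder coins S w own' v r :=
  { h with own_eq := ho _ _ h.own_eq, inv := h.inv.mono ho }

/-- What a request `msg` that `v` sends over the link `l` guarantees to its receiver. -/
def SendInv (coins : Coins G) (S : Finset G.Dart) (w : G.Dart → ℝ) (own : V → Option V)
    (v : V) (msg : Record G) (l : G.Dart) : Prop :=
  ∀ own', Extends own own' → own (otherEnd l v) = none → own' (otherEnd l v) = own v →
    (coins (otherEnd l v)).1 = false → ActiveInv coins S w own' (otherEnd l v) msg l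

/-- The invariant of the states of the nodes between two mini-slots. -/
structure StateInv (coins : Coins G) (S : Finset G.Dart) (w : G.Dart → ℝ)
    (st : V → NodeState G) (own : V → Option V) : Prop where
  null_iff : ∀ v, st v = .null ↔ own v = none
  seed_own : ∀ v, (coins v).1 = true → own v = some v
  active : ∀ v r e, st v = .active r e → ActiveInv coins S w own v r e
  done : ∀ v r, st v = .done r → Holder coins S w own v r
  inj : ∀ v v', (∃ r, st v = .done r ∨ ∃ e, st v = .active r e) →
    (∃ r, st v' = .done r ∨ ∃ e, st v' = .active r e) → own v = own v' → v = v'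

/-- One exchange preserves the invariant if all intents are consistent with it. -/
theorem exchange_stateInv {coins : Coins G} {S : Finset G.Dart} {w : G.Dart → ℝ}
    {st : V → NodeState G} {own : V → Option V} {I : V → Intent G}
    (hnull : ∀ v, st v = .null ↔ own v = none)
    (hseed : ∀ v, (coins v).1 = true → own v = some v)
    (hidle : ∀ v, st v = .null → I v = .idle)
    (hactive : ∀ v r e, st v = .active r e → I v ≠ .idle)
    (hdone : ∀ v r, st v = .done r → Holder coins S w own v r)
    (hhalt : ∀ v o, I v = .halt o → Holder coins S w own v o)
    (hsend : ∀ v o msg l, I v = .send o msg l →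
      Holder coins S w own v o ∧ SendInv coins S w own v msg l)
    (hinj : ∀ v v', (I v ≠ .idle ∨ ∃ r, st v = .done r) → (I v' ≠ .idle ∨ ∃ r, st v' = .done r) →
      own v = own v' → v = v') :
    ∃ own', StateInv coins S w (exchange st I) own' := by
  classical
  -- a node that accepts a request belongs to the augmentation of the sender
  let own' : V → Option V := fun v =>
    if ha : Accepts st I v then own ha.exists_sender.choose else own v
  have hext : Extends own own' := by
    intro x s hx
    have : ¬ Accepts st I x := by
      intro ha
      rw [(hnull x).1 ha.1] at hx
      cases hx
    simp [own', this, hx]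
  have hown : ∀ u v o msg l, I u = .send o msg l → otherEnd l u = v → Accepts st I v →
      own' v = own u := by
    intro u v o msg l hu hl ha
    obtain ⟨o', msg', l', hu', hl'⟩ := ha.exists_sender.choose_spec
    have := ha.sender_unique hu hl hu' hl'
    simp only [own', ha, dif_pos]
    rw [← this]
  have hown_of_not : ∀ v, ¬ Accepts st I v → own' v = own v := fun v ha => by simp [own', ha]
  have hsome : ∀ u, I u ≠ .idle → own' u = own u := by
    intro u hu
    refine hown_of_not u fun ha => hu (hidle u ha.1)
  have hnone : ∀ v, Accepts st I v → own v = none := fun v ha => (hnull v).1 ha.1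
  have hcoin : ∀ v, Accepts st I v → (coins v).1 = false := by
    intro v ha
    by_contra h
    have := hseed v (by simpa using h)
    rw [hnone v ha] at this
    cases this
  -- the five ways in which the state of a node arises
  have key : ∀ v, (∃ o, exchange st I v = .done o ∧ Holder coins S w own v o ∧
        (I v ≠ .idle ∨ ∃ r, st v = .done r) ∧ ¬ Accepts st I v ∧
        ∀ o' msg l, I v = .send o' msg l → ¬ Accepts st I (otherEnd l v)) ∨
      (∃ u o msg l, I u = .send o msg l ∧ otherEnd l u = v ∧ Accepts st I v ∧
        exchange st I v = .active msg l) ∨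
      (exchange st I v = .used ∧ own v ≠ none) ∨
      (exchange st I v = .null ∧ own v = none ∧ ¬ Accepts st I v) := by
    intro v
    cases hI : I v with
    | halt o =>
      refine Or.inl ⟨o, exchange_halt hI, hhalt v o hI, Or.inl (by simp), ?_, by simp⟩
      intro ha
      rw [hidle v ha.1] at hI
      cases hI
    | send o msg l =>
      have hna : ¬ Accepts st I v := by
        intro ha
        rw [hidle v ha.1] at hI
        cases hI
      by_cases ha : Accepts st I (otherEnd l v)
      · refine Or.inr (Or.inr (Or.inl ⟨exchange_send_accept hI ha, ?_⟩))
        rw [(hsend v o msg l hI).1.own_eq]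
        simp
      · refine Or.inl ⟨o, exchange_send_reject hI ha, (hsend v o msg l hI).1, Or.inl (by simp),
          hna, ?_⟩
        intro o' msg' l' h
        cases h
        exact ha
    | idle =>
      by_cases ha : Accepts st I v
      · obtain ⟨u, o, msg, l, hu, hl⟩ := ha.exists_sender
        exact Or.inr (Or.inl ⟨u, o, msg, l, hu, hl, ha, exchange_idle_accept hI ha hu hl⟩)
      · have he := exchange_idle_reject hI ha
        cases hs : st v with
        | null =>
          exact Or.inr (Or.inr (Or.inr ⟨he.trans hs, (hnull v).1 hs, ha⟩))
        | active r e => exact absurd hI (hactive v r e hs)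
        | used =>
          refine Or.inr (Or.inr (Or.inl ⟨he.trans hs, fun h => ?_⟩))
          rw [(hnull v).2 h] at hs
          cases hs
        | done r =>
          exact Or.inl ⟨r, he.trans hs, hdone v r hs, Or.inr ⟨r, rfl⟩, ha, by simp⟩
  -- every holder of a record has a source that held or sent it before
  have src : ∀ v, (∃ r, exchange st I v = .done r ∨ ∃ e, exchange st I v = .active r e) →
      ∃ u, (I u ≠ .idle ∨ ∃ r, st u = .done r) ∧ own u = own' v ∧
        ((u = v ∧ ∀ o' msg l, I v = .send o' msg l → ¬ Accepts st I (otherEnd l v)) ∨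
          ∃ o msg l, I u = .send o msg l ∧ otherEnd l u = v ∧ Accepts st I v) := by
    intro v hv
    rcases key v with ⟨o, h1, h2, h3, h4, h5⟩ | ⟨u, o, msg, l, hu, hl, ha, h1⟩ | ⟨h1, -⟩ | ⟨h1, -, -⟩
    · exact ⟨v, h3, (hown_of_not v h4).symm, Or.inl ⟨rfl, h5⟩⟩
    · exact ⟨u, Or.inl (by simp [hu]), (hown u v o msg l hu hl ha).symm,
        Or.inr ⟨o, msg, l, hu, hl, ha⟩⟩
    · simp [h1] at hv
    · simp [h1] at hv
  refine ⟨own', ?_, ?_, ?_, ?_, ?_⟩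
  · intro v
    rcases key v with ⟨o, h1, h2, h3, h4, h5⟩ | ⟨u, o, msg, l, hu, hl, ha, h1⟩ | ⟨h1, h2⟩ |
      ⟨h1, h2, h3⟩
    · rw [h1, hown_of_not v h4, h2.own_eq]
      simp
    · rw [h1, hown u v o msg l hu hl ha, (hsend u o msg l hu).1.own_eq]
      simp
    · obtain ⟨s, hs⟩ := Option.ne_none_iff_exists'.1 h2
      rw [h1, hext v s hs]
      simp
    · rw [h1, hown_of_not v h3, h2]
      simp
  · intro v hv
    exact hext v v (hseed v hv)
  · intro v r e hv
    rcases key v with ⟨o, h1, -⟩ | ⟨u, o, msg, l, hu, hl, ha, h1⟩ | ⟨h1, -⟩ | ⟨h1, -, -⟩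
    · rw [h1] at hv; cases hv
    · rw [h1] at hv
      cases hv
      subst hl
      exact (hsend u o _ _ hu).2 own' hext (hnone _ ha) (hown u _ o _ _ hu rfl ha) (hcoin _ ha)
    · rw [h1] at hv; cases hv
    · rw [h1] at hv; cases hv
  · intro v r hv
    rcases key v with ⟨o, h1, h2, -⟩ | ⟨u, o, msg, l, hu, hl, ha, h1⟩ | ⟨h1, -⟩ | ⟨h1, -, -⟩
    · rw [h1] at hv
      cases hv
      exact h2.mono hext
    all_goals rw [h1] at hv; cases hv
  · intro v v' hv hv' hvv
    obtain ⟨u, hu, huo, hu2⟩ := src v hv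
    obtain ⟨u', hu', huo', hu2'⟩ := src v' hv'
    have huu : u = u' := hinj u u' hu hu' (by rw [huo, huo', hvv])
    subst huu
    rcases hu2 with ⟨rfl, h1⟩ | ⟨o, msg, l, h1, h2, h3⟩
    · rcases hu2' with ⟨rfl, h1'⟩ | ⟨o', msg', l', h1', h2', h3'⟩
      · rfl
      · exact absurd (h2' ▸ h3') (h1 o' msg' l' h1')
    · rcases hu2' with ⟨rfl, h1'⟩ | ⟨o', msg', l', h1', h2', h3'⟩
      · exact absurd (h2 ▸ h3) (h1' o msg l h1)
      · rw [h1] at h1'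
        cases h1'
        exact h2.symm.trans h2'

end Invariant

section Invariant

variable {V : Type*} [Fintype V] [DecidableEq V] {G : SimpleGraph V} [DecidableRel G.Adj]

theorem newLinks_append (S : Finset G.Dart) (l l' : List G.Dart) :
    newLinks S (l ++ l') = newLinks S l ++ newLinks S l' := by
  simp [newLinks]

theorem newLinks_singleton_of_mem {S : Finset G.Dart} {m : G.Dart} (h : m ∈ S) :
    newLinks S [m] = [] := by
  simp [newLinks, h]

theorem newLinks_singleton_of_notMem {S : Finset G.Dart} {m : G.Dart} (h : m ∉ S) :
    newLinks S [m] = [m] := by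
  simp [newLinks, h]

/-- The intents of the seeds in the first mini-slot are consistent with the invariant. -/
theorem seedIntent_inv {coins : Coins G} {S : Finset G.Dart} (hS : IsMatching G S)
    {w : G.Dart → ℝ} {own : V → Option V} {v : V} (hseed : (coins v).1 = true)
    (hown : own v = some v) :
    (∀ o, seedIntent coins S w v = .halt o → Holder coins S w own v o) ∧
    (∀ o msg l, seedIntent coins S w v = .send o msg l →
      Holder coins S w own v o ∧ SendInv coins S w own v msg l) := by
  set r : Record G := ⟨v, [], 0, 0, (coins v).2.1, false⟩ with hr
  have hrH : Holder coins S w own v r := by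
    refine ⟨hown, ⟨hseed, ?_, ?_, ?_, ?_, ?_, ?_⟩, ?_, ?_, ?_, ?_, ?_⟩ <;> simp [hr, newLinks]
  unfold seedIntent
  simp only [hseed, if_true]
  cases hsl : scheduledLink S v with
  | some m =>
    obtain ⟨hmS, hmv⟩ := scheduledLink_eq_some hsl
    refine ⟨by simp, ?_⟩
    intro o msg l h
    simp only [Intent.send.injEq] at h
    obtain ⟨rfl, rfl, rfl⟩ := h
    refine ⟨?_, ?_⟩
    · refine ⟨hown, ⟨hseed, ?_, ?_, ?_, ?_, ?_, ?_⟩, ?_, ?_, ?_, ?_, ?_⟩ <;>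
        simp [newLinks, hmS, signedWeight]
      rintro _ _ rfl
      exact hmv
    · intro own' hext hnone hn hcoin
      refine Or.inl ⟨rfl, ⟨hn.trans hown, ⟨hseed, ?_, ?_, ?_, ?_, ?_, ?_⟩, ?_, ?_, ?_, ?_, ?_⟩⟩ <;>
        simp [newLinks, hmS, signedWeight, hcoin]
      · rintro _ _ rfl
        exact hmv
      · intro m' hm' hm'n
        exact hS.eq_of_mem hm' hmS hm'n (mem_linksAt_otherEnd m v)
      · intro m' hm' hm'n _
        exact hS.eq_of_mem hmS hm' (mem_linksAt_otherEnd m v) hm'n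
  | none =>
    have hfree := scheduledLink_eq_none hsl
    dsimp only
    split_ifs with hne
    · refine ⟨by simp, ?_⟩
      intro o msg l h
      simp only [Intent.send.injEq] at h
      obtain ⟨rfl, rfl, rfl⟩ := h
      set d := ((coins v).2.2 ⟨linksAt G v, hne⟩).1 with hd
      have hdv : d ∈ linksAt G v := ((coins v).2.2 ⟨linksAt G v, hne⟩).2
      have hdS : d ∉ S := fun h => hfree d h hdv
      refine ⟨hrH, ?_⟩
      intro own' hext hnone hn hcoin
      refine Or.inr ⟨hn.trans hown, hcoin, rfl, mem_linksAt_otherEnd d v,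
        ⟨hseed, ?_, ?_, ?_, ?_, ?_, ?_⟩, ?_⟩ <;> simp [newLinks, hdS]
      · intro x hx
        rcases (mem_linksAt_iff hdv).1 hx with rfl | rfl
        · exact hext _ _ hown
        · exact hn.trans hown
      · intro m hm hmv
        exact absurd hmv (hfree m hm)
      · intro x hx hxd m hm hmx
        rcases (mem_linksAt_iff hdv).1 hxd with rfl | rfl
        · exact hfree m hm hmx
        · exact hx rfl
    · refine ⟨?_, by simp⟩
      intro o h
      simp only [Intent.halt.injEq] at h
      rw [← h]
      exact hrH

/-- The intents of the active nodes are consistent with the invariant. -/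
theorem extendIntent_inv {coins : Coins G} {S : Finset G.Dart} (hS : IsMatching G S)
    {w : G.Dart → ℝ} {own : V → Option V} {v : V} {r : Record G} {e : G.Dart}
    (h : ActiveInv coins S w own v r e) :
    (∀ o, extendIntent coins S w v (.active r e) = .halt o → Holder coins S w own v o) ∧
    (∀ o msg l, extendIntent coins S w v (.active r e) = .send o msg l →
      Holder coins S w own v o ∧ SendInv coins S w own v msg l) := by
  unfold extendIntent
  rcases h with ⟨halt, hH⟩ | hP
  · simp only [halt, if_true]
    split_ifs with hne
    · refine ⟨by simp, ?_⟩
      intro o msg l h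
      simp only [Intent.send.injEq] at h
      obtain ⟨rfl, rfl, rfl⟩ := h
      set d := ((coins v).2.2 ⟨linksAt G v \ r.links.toFinset, hne.1⟩).1 with hd
      have hd' : d ∈ linksAt G v \ r.links.toFinset :=
        ((coins v).2.2 ⟨linksAt G v \ r.links.toFinset, hne.1⟩).2
      obtain ⟨hdv, hdl⟩ := Finset.mem_sdiff.1 hd'
      rw [List.mem_toFinset] at hdl
      have hdS : d ∉ S := fun h => hdl (hH.alt_cover halt d h hdv)
      refine ⟨hH, ?_⟩
      intro own' hext hnone hn hcoin
      have hmono := hH.inv.mono hext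
      refine Or.inr ⟨hn.trans hH.own_eq, hcoin, rfl, mem_linksAt_otherEnd d v,
        ⟨hmono.isSeed, ?_, ?_, ?_, hmono.gain, ?_, hmono.head⟩, ?_⟩
      · refine List.pairwise_append.2 ⟨hmono.disj, by simp, ?_⟩
        intro e' he' d' hd' x hx hx'
        rw [List.mem_singleton] at hd'
        subst hd'
        rcases (mem_linksAt_iff hdv).1 hx' with rfl | rfl
        · exact hH.alt_free halt e' he' hx
        · rw [hH.inv.owned e' he' _ hx] at hnone
          cases hnone
      · intro e' he'
        rcases List.mem_append.1 he' with he' | he'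
        · exact hmono.notMem e' he'
        · rw [List.mem_singleton.1 he']
          exact hdS
      · intro e' he' x hx
        rcases List.mem_append.1 he' with he' | he'
        · exact hmono.owned e' he' x hx
        · rw [List.mem_singleton.1 he'] at hx
          rcases (mem_linksAt_iff hdv).1 hx with rfl | rfl
          · exact hext _ _ hH.own_eq
          · exact hn.trans hH.own_eq
      · intro hm e' he' hx
        rcases List.mem_append.1 he' with he' | he'
        · exact hmono.seedFree hm e' he' hx
        · rw [List.mem_singleton.1 he'] at hx
          have hs := hH.inv.isSeed
          rcases (mem_linksAt_iff hdv).1 hx with h1 | h1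
          · dsimp only at h1
            rw [h1, hH.alt_coin halt] at hs
            cases hs
          · dsimp only at h1
            rw [h1, hcoin] at hs
            cases hs
      · intro e' he' x hxn hx m hm hmx
        rcases List.mem_append.1 he' with he' | he'
        · exact hH.cover e' he' x hx m hm hmx
        · rw [List.mem_singleton.1 he'] at hx
          rcases (mem_linksAt_iff hdv).1 hx with rfl | rfl
          · exact hH.alt_cover halt m hm hmx
          · exact absurd rfl hxn
    · refine ⟨?_, by simp⟩
      intro o h
      simp only [Intent.halt.injEq] at h
      rw [← h]
      exact hH
  · simp only [hP.alt, Bool.false_eq_true, if_false]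
    have heS : e ∉ S := hP.inv.notMem e (by simp)
    have hhead : ∀ l', ∀ m ∈ S, (r.links ++ [e] ++ l').head? = some m → m ∈ linksAt G r.seed := by
      intro l' m hm hh
      cases hl : r.links with
      | nil =>
        rw [hl] at hh
        simp only [List.nil_append, List.cons_append, List.head?_cons, Option.some.injEq] at hh
        rw [hh] at heS
        exact absurd hm heS
      | cons a t =>
        refine hP.inv.head m hm ?_
        rw [hl] at hh ⊢
        simpa using hh
    cases hsl : scheduledLink S v with
    | none =>
      have hfree := scheduledLink_eq_none hsl
      refine ⟨?_, by simp⟩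
      intro o h
      simp only [Intent.halt.injEq] at h
      rw [← h]
      have hnew : newLinks S (r.links ++ [e]) = newLinks S r.links ++ [e] := by
        rw [newLinks_append, newLinks_singleton_of_notMem heS]
      refine ⟨hP.own_eq, ⟨hP.inv.isSeed, ?_, ?_, ?_, ?_, ?_, ?_⟩, ?_, by simp, by simp, by simp,
        by simp⟩
      · dsimp only; rw [hnew]; exact hP.inv.disj
      · dsimp only; rw [hnew]; exact hP.inv.notMem
      · dsimp only; rw [hnew]; exact hP.inv.owned
      · simp [hP.inv.gain, signedWeight, heS]
      · dsimp only; rw [hnew]; exact hP.inv.seedFree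
      · have := hhead []
        simpa using this
      · dsimp only
        rw [hnew]
        intro e' he' x hx m hm hmx
        refine List.mem_append_left _ (hP.cover e' he' x ?_ hx m hm hmx)
        rintro rfl
        exact hfree m hm hmx
    | some m =>
      obtain ⟨hmS, hmv⟩ := scheduledLink_eq_some hsl
      refine ⟨by simp, ?_⟩
      intro o msg l h
      simp only [Intent.send.injEq] at h
      obtain ⟨rfl, rfl, rfl⟩ := h
      have hnew : newLinks S (r.links ++ [e] ++ [m]) = newLinks S r.links ++ [e] := by
        rw [newLinks_append, newLinks_append, newLinks_singleton_of_notMem heS,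
          newLinks_singleton_of_mem hmS, List.append_nil]
      have hcover : ∀ e' ∈ newLinks S r.links ++ [e], ∀ x, e' ∈ linksAt G x →
          ∀ m' ∈ S, m' ∈ linksAt G x → m' ∈ r.links ++ [e] ++ [m] := by
        intro e' he' x hx m' hm' hmx
        by_cases hxv : x = v
        · subst hxv
          rw [hS.eq_of_mem hm' hmS hmx hmv]
          simp
        · have := hP.cover e' he' x hxv hx m' hm' hmx
          simp [this]
      have hgain : r.gain + w e - w m =
          ((r.links ++ [e] ++ [m]).map (signedWeight S w)).sum := by
        simp [hP.inv.gain, signedWeight, heS, hmS]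
        ring
      refine ⟨⟨hP.own_eq, ⟨hP.inv.isSeed, ?_, ?_, ?_, hgain, ?_, hhead [m]⟩, ?_, by simp, by simp,
        by simp, by simp⟩, ?_⟩
      · dsimp only; rw [hnew]; exact hP.inv.disj
      · dsimp only; rw [hnew]; exact hP.inv.notMem
      · dsimp only; rw [hnew]; exact hP.inv.owned
      · dsimp only; rw [hnew]; exact hP.inv.seedFree
      · rw [hnew]; exact hcover
      · intro own' hext hnone hn hcoin
        have hmono := hP.inv.mono hext
        refine Or.inl ⟨rfl, ⟨hn.trans hP.own_eq, ⟨hP.inv.isSeed, ?_, ?_, ?_, hgain, ?_, hhead [m]⟩,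
          ?_, fun _ => hcoin, ?_, ?_, ?_⟩⟩
        · dsimp only; rw [hnew]; exact hmono.disj
        · dsimp only; rw [hnew]; exact hmono.notMem
        · dsimp only; rw [hnew]; exact hmono.owned
        · dsimp only; rw [hnew]; exact hmono.seedFree
        · rw [hnew]; exact hcover
        · dsimp only
          rw [hnew]
          intro _ e' he' hx
          rw [hP.inv.owned e' he' _ hx] at hnone
          cases hnone
        · intro _ m' hm' hmx
          rw [hS.eq_of_mem hm' hmS hmx (mem_linksAt_otherEnd m v)]
          simp
        · intro _ m' hm' hmx hms
          exfalso
          have hs := hP.inv.isSeed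
          rw [hS.eq_of_mem hm' hmS hmx (mem_linksAt_otherEnd m v)] at hms
          rcases (mem_linksAt_iff hmv).1 hms with h1 | h1
          · dsimp only at h1
            rw [h1, hP.coin] at hs
            cases hs
          · dsimp only at h1
            rw [h1, hcoin] at hs
            cases hs

theorem afterInit_stateInv (coins : Coins G) {S : Finset G.Dart} (hS : IsMatching G S)
    (w : G.Dart → ℝ) : ∃ own, StateInv coins S w (afterInit coins S w) own := by
  refine exchange_stateInv (own := fun v => if (coins v).1 = true then some v else none)
    ?_ ?_ ?_ ?_ ?_ ?_ ?_ ?_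
  · intro v; split_ifs <;> simp
  · intro v hv; simp [hv]
  · intro v hv
    have : ¬ (coins v).1 = true := by
      intro h; simp [h] at hv
    simp [seedIntent, this]
  · intro v r e hv
    split_ifs at hv
  · intro v r hv
    split_ifs at hv
  · intro v o hv
    have h : (coins v).1 = true := by
      by_contra h; simp [seedIntent, h] at hv
    exact (seedIntent_inv hS h (by simp [h])).1 o hv
  · intro v o msg l hv
    have h : (coins v).1 = true := by
      by_contra h; simp [seedIntent, h] at hv
    exact (seedIntent_inv hS h (by simp [h])).2 o msg l hv
  · have hs : ∀ v, (seedIntent coins S w v ≠ .idle ∨ ∃ r : Record G,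
        (if (coins v).1 = true then NodeState.used else .null) = .done r) →
        (coins v).1 = true := by
      intro v hv
      rcases hv with hv | ⟨r, hv⟩
      · by_contra h; simp [seedIntent, h] at hv
      · split_ifs at hv
    intro v v' hv hv' h
    simpa [hs v hv, hs v' hv'] using h

theorem miniSlot_stateInv {coins : Coins G} {S : Finset G.Dart} (hS : IsMatching G S)
    {w : G.Dart → ℝ} {st : V → NodeState G} {own : V → Option V}
    (h : StateInv coins S w st own) : ∃ own', StateInv coins S w (miniSlot coins S w st) own' := by
  have hidle : ∀ v, extendIntent coins S w v (st v) ≠ .idle → ∃ r e, st v = .active r e := by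
    intro v hv
    cases hs : st v with
    | active r e => exact ⟨r, e, rfl⟩
    | _ => simp [hs, extendIntent] at hv
  refine exchange_stateInv (own := own) h.null_iff h.seed_own ?_ ?_ h.done ?_ ?_ ?_
  · intro v hv; simp [hv, extendIntent]
  · intro v r e hv
    rw [hv]
    unfold extendIntent
    dsimp only
    split_ifs
    · simp
    · simp
    · split <;> simp
  · intro v o hv
    obtain ⟨r, e, hs⟩ := hidle v (by rw [hv]; simp)
    rw [hs] at hv
    exact (extendIntent_inv hS (h.active v r e hs)).1 o hv
  · intro v o msg l hv
    obtain ⟨r, e, hs⟩ := hidle v (by rw [hv]; simp)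
    rw [hs] at hv
    exact (extendIntent_inv hS (h.active v r e hs)).2 o msg l hv
  · have hh : ∀ v, (extendIntent coins S w v (st v) ≠ .idle ∨ ∃ r, st v = .done r) →
        ∃ r, st v = .done r ∨ ∃ e, st v = .active r e := by
      intro v hv
      rcases hv with hv | ⟨r, hv⟩
      · obtain ⟨r, e, hs⟩ := hidle v hv
        exact ⟨r, Or.inr ⟨e, hs⟩⟩
      · exact ⟨r, Or.inl hv⟩
    intro v v' hv hv' hvv
    exact h.inj v v' (hh v hv) (hh v' hv') hvv

theorem afterAugmenting_stateInv (k : ℕ) (coins : Coins G) {S : Finset G.Dart}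
    (hS : IsMatching G S) (w : G.Dart → ℝ) :
    ∃ own, StateInv coins S w (afterAugmenting k coins S w) own := by
  unfold afterAugmenting
  generalize 2 * k = n
  induction n with
  | zero => exact afterInit_stateInv coins hS w
  | succ n ih =>
    obtain ⟨own, h⟩ := ih
    rw [Function.iterate_succ_apply']
    exact miniSlot_stateInv hS h

/-- What holds for a final augmentation `r` of positive gain. -/
structure FinalInv (S : Finset G.Dart) (w : G.Dart → ℝ) (own : V → Option V) (v : V)
    (r : Record G) : Prop where
  disj : (newLinks S r.links).Pairwise fun e e' => ∀ x, e ∈ linksAt G x → e' ∉ linksAt G x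
  owned : ∀ e ∈ newLinks S r.links, ∀ x, e ∈ linksAt G x → own x = own v
  gain : r.gain = (r.links.map (signedWeight S w)).sum
  cover : ∀ e ∈ newLinks S r.links, ∀ x, e ∈ linksAt G x → ∀ m ∈ S, m ∈ linksAt G x → m ∈ r.links

theorem Holder.finalInv {coins : Coins G} {S : Finset G.Dart} {w : G.Dart → ℝ}
    {own : V → Option V} {v : V} {r : Record G} (h : Holder coins S w own v r) :
    FinalInv S w own v r :=
  ⟨h.inv.disj, fun e he x hx => (h.inv.owned e he x hx).trans h.own_eq.symm, h.inv.gain, h.cover⟩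

theorem Holder.closeCycle_finalInv {coins : Coins G} {S : Finset G.Dart} (hS : IsMatching G S)
    {w : G.Dart → ℝ} {own : V → Option V} {v : V} {r : Record G}
    (h : Holder coins S w own v r) (hseeds : ∀ v, (coins v).1 = true → own v = some v)
    (hpos : 0 < (closeCycle S w v r).gain) : FinalInv S w own v (closeCycle S w v r) := by
  unfold closeCycle at hpos ⊢
  split_ifs with hadj hc
  · simp only [hadj, dif_pos, hc] at hpos
    obtain ⟨halt, ⟨m, hm, hhead⟩, -⟩ := hc
    set e : G.Dart := ⟨(v, r.seed), hadj⟩ with he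
    have hev : e ∈ linksAt G v := mem_linksAt.2 (Or.inl rfl)
    have hes : e ∈ linksAt G r.seed := mem_linksAt.2 (Or.inr rfl)
    have hex : ∀ x, e ∈ linksAt G x → x = v ∨ x = r.seed := by
      intro x hx
      rcases mem_linksAt.1 hx with hx | hx
      · exact Or.inl hx.symm
      · exact Or.inr hx.symm
    have hms := h.inv.head m hm hhead
    have heS : e ∉ S := by
      -- a closing link in `S` would be the only link of the augmentation, which thus has gain `0`
      intro heS
      have hl := h.alt_seed halt e heS hev hes
      rw [h.inv.gain, hl] at hpos
      simp [signedWeight, heS] at hpos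
    have hnew : newLinks S (r.links ++ [e]) = newLinks S r.links ++ [e] := by
      rw [newLinks_append, newLinks_singleton_of_notMem heS]
    refine ⟨?_, ?_, ?_, ?_⟩
    · dsimp only
      rw [hnew]
      refine List.pairwise_append.2 ⟨h.inv.disj, by simp, ?_⟩
      intro e' he' d hd x hx hx'
      rw [List.mem_singleton.1 hd] at hx'
      rcases hex x hx' with rfl | rfl
      · exact h.alt_free halt e' he' hx
      · exact h.inv.seedFree ⟨m, hm, hms⟩ e' he' hx
    · dsimp only
      rw [hnew]
      intro e' he' x hx
      rcases List.mem_append.1 he' with he' | he'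
      · exact h.finalInv.owned e' he' x hx
      · rw [List.mem_singleton.1 he'] at hx
        rcases hex x hx with rfl | rfl
        · rfl
        · rw [hseeds _ h.inv.isSeed, h.own_eq]
    · simp [h.inv.gain, signedWeight, heS]
    · dsimp only
      rw [hnew]
      intro e' he' x hx m' hm' hmx
      refine List.mem_append_left _ ?_
      rcases List.mem_append.1 he' with he' | he'
      · exact h.cover e' he' x hx m' hm' hmx
      · rw [List.mem_singleton.1 he'] at hx
        rcases hex x hx with rfl | rfl
        · exact h.alt_cover halt m' hm' hmx
        · rw [hS.eq_of_mem hm' hm hmx hms]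
          exact List.mem_of_mem_head? (Option.mem_def.2 hhead)
  · exact h.finalInv
  · exact h.finalInv

/-- The final augmentations of positive gain are disjoint. -/
theorem exists_finalInv (k : ℕ) (coins : Coins G) {S : Finset G.Dart} (hS : IsMatching G S)
    (w : G.Dart → ℝ) : ∃ own : V → Option V,
      (∀ v r, finalRecord k coins S w v = some r → 0 < r.gain → FinalInv S w own v r) ∧
      ∀ v v' r r', finalRecord k coins S w v = some r → finalRecord k coins S w v' = some r' →
        own v = own v' → v = v' := by
  obtain ⟨own, h⟩ := afterAugmenting_stateInv k coins hS w
  have key : ∀ v r, finalRecord k coins S w v = some r → ∃ r', r = closeCycle S w v r' ∧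
      Holder coins S w own v r' ∧ (afterAugmenting k coins S w v = .done r' ∨
        ∃ e, afterAugmenting k coins S w v = .active r' e) := by
    intro v r hr
    unfold finalRecord at hr
    cases hs : afterAugmenting k coins S w v with
    | null => simp [hs] at hr
    | used => simp [hs] at hr
    | done r' =>
      simp only [hs, Option.some.injEq] at hr
      exact ⟨r', hr.symm, h.done v r' hs, Or.inl rfl⟩
    | active r' e =>
      simp only [hs, Option.some.injEq] at hr
      exact ⟨r', hr.symm, (h.active v r' e hs).holder, Or.inr ⟨e, rfl⟩⟩
  refine ⟨own, ?_, ?_⟩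
  · intro v r hr hpos
    obtain ⟨r', rfl, hH, -⟩ := key v r hr
    exact hH.closeCycle_finalInv hS h.seed_own hpos
  · intro v v' r r' hr hr' hvv
    obtain ⟨r1, -, -, h1⟩ := key v r hr
    obtain ⟨r2, -, -, h2⟩ := key v' r' hr'
    exact h.inj v v' ⟨r1, h1⟩ ⟨r2, h2⟩ hvv

/-- The gain of the augmentation with terminus `v`, if it is positive, and otherwise `0`. -/
def gainAt (k : ℕ) (coins : Coins G) (S : Finset G.Dart) (w : G.Dart → ℝ) (v : V) : ℝ :=
  match finalRecord k coins S w v with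
  | some r => max 0 r.gain
  | none => 0

theorem gainAt_nonneg (k : ℕ) (coins : Coins G) (S : Finset G.Dart) (w : G.Dart → ℝ) (v : V) :
    0 ≤ gainAt k coins S w v := by
  unfold gainAt
  split
  · exact le_max_left _ _
  · exact le_rfl

theorem mem_switchedLinks {k : ℕ} {coins : Coins G} {S : Finset G.Dart} {w : G.Dart → ℝ} {v : V}
    {e : G.Dart} : e ∈ switchedLinks k coins S w v ↔
      ∃ r, finalRecord k coins S w v = some r ∧ 0 < r.gain ∧ e ∈ r.links := by
  unfold switchedLinks
  cases finalRecord k coins S w v with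
  | none => simp
  | some r =>
    dsimp only
    split_ifs with h
    · simp [h]
    · simp [h]

theorem mem_augment {k : ℕ} {coins : Coins G} {S : Finset G.Dart} {w : G.Dart → ℝ} {e : G.Dart} :
    e ∈ augment k coins S w ↔ (e ∈ S ∧ ∀ v, e ∉ switchedLinks k coins S w v) ∨
      (e ∉ S ∧ ∃ v, e ∈ switchedLinks k coins S w v) := by
  simp only [augment, Finset.mem_union, Finset.mem_sdiff, Finset.mem_biUnion, Finset.mem_univ,
    true_and, not_exists]
  tauto

/-- The augmentation algorithm turns matchings into matchings. -/
theorem augment_isMatching (k : ℕ) (coins : Coins G) {S : Finset G.Dart} (hS : IsMatching G S)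
    (w : G.Dart → ℝ) : IsMatching G (augment k coins S w) := by
  obtain ⟨own, h1, h2⟩ := exists_finalInv k coins hS w
  rw [isMatching_iff]
  have hcov : ∀ x d d', d ∈ linksAt G x → d' ∈ linksAt G x → d ∈ S →
      (∀ v, d ∉ switchedLinks k coins S w v) → d' ∉ S →
      (∃ v, d' ∈ switchedLinks k coins S w v) → False := by
    rintro x d d' hd hd' hdS hdn hdS' ⟨v, hv⟩
    obtain ⟨r, hr, hpos, hl⟩ := mem_switchedLinks.1 hv
    exact hdn v (mem_switchedLinks.2 ⟨r, hr, hpos,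
      (h1 v r hr hpos).cover d' (mem_newLinks.2 ⟨hl, hdS'⟩) x hd' d hdS hd⟩)
  intro x d hd d' hd' hdx hdx'
  rcases mem_augment.1 hd with ⟨ha, hb⟩ | ⟨ha, hb⟩ <;>
    rcases mem_augment.1 hd' with ⟨ha', hb'⟩ | ⟨ha', hb'⟩
  · exact hS.eq_of_mem ha ha' hdx hdx'
  · exact (hcov x d d' hdx hdx' ha hb ha' hb').elim
  · exact (hcov x d' d hdx' hdx ha' hb' ha hb).elim
  · obtain ⟨v, hv⟩ := hb
    obtain ⟨v', hv'⟩ := hb'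
    obtain ⟨r, hr, hpos, hl⟩ := mem_switchedLinks.1 hv
    obtain ⟨r', hr', hpos', hl'⟩ := mem_switchedLinks.1 hv'
    have hn := mem_newLinks.2 ⟨hl, ha⟩
    have hn' := mem_newLinks.2 ⟨hl', ha'⟩
    have hvv : v = v' := h2 v v' r r' hr hr' <|
      ((h1 v r hr hpos).owned d hn x hdx).symm.trans ((h1 v' r' hr' hpos').owned d' hn' x hdx')
    subst hvv
    rw [hr] at hr'
    cases hr'
    by_contra hne
    have : Std.Symm fun e e' : G.Dart => ∀ x, e ∈ linksAt G x → e' ∉ linksAt G x :=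
      ⟨fun e e' h x hx hx' => h x hx' hx⟩
    exact (h1 v r hr hpos).disj.forall hn hn' hne x hdx hdx'

theorem sum_biUnion_le_sum {ι κ : Type*} [DecidableEq ι] [DecidableEq κ] {f : κ → ℝ}
    (hf : ∀ i, 0 ≤ f i) (s : Finset ι) (t : ι → Finset κ) :
    ∑ i ∈ s.biUnion t, f i ≤ ∑ j ∈ s, ∑ i ∈ t j, f i := by
  induction s using Finset.induction_on with
  | empty => simp
  | insert a s ha ih =>
    rw [Finset.biUnion_insert, Finset.sum_insert ha]
    have h1 := Finset.sum_union_inter (s₁ := t a) (s₂ := s.biUnion t) (f := f)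
    have h2 : 0 ≤ ∑ i ∈ t a ∩ s.biUnion t, f i := Finset.sum_nonneg fun i _ => hf i
    linarith

/-- The augmentation algorithm increases the weight of the schedule at least by the sum of the
gains of the augmentations of positive gain. A scheduled link may be in several augmentations, which
all count it as lost, whereas the new links of the augmentations are distinct. -/
theorem weightSum_add_gain_le (k : ℕ) (coins : Coins G) {S : Finset G.Dart} (hS : IsMatching G S)
    {w : G.Dart → ℝ} (hw : ∀ i, 0 ≤ w i) :
    weightSum w S + ∑ v, gainAt k coins S w v ≤ weightSum w (augment k coins S w) := by
  obtain ⟨own, h1, h2⟩ := exists_finalInv k coins hS w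
  set A := switchedLinks k coins S w with hA
  have hgain : ∀ v, gainAt k coins S w v ≤ weightSum w (A v \ S) - weightSum w (S ∩ A v) := by
    intro v
    unfold gainAt
    cases hr : finalRecord k coins S w v with
    | none =>
      have : A v = ∅ := by simp [hA, switchedLinks, hr]
      simp [this, weightSum]
    | some r =>
      dsimp only
      by_cases hpos : 0 < r.gain
      · have hAv : A v = r.links.toFinset := by simp [hA, switchedLinks, hr, hpos]
        have hF := h1 v r hr hpos
        rw [max_eq_right hpos.le, hF.gain]
        have hsplit : ∀ l : List G.Dart, (l.map (signedWeight S w)).sum =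
            ((newLinks S l).map w).sum - ((l.filter (· ∈ S)).map w).sum := by
          intro l
          induction l with
          | nil => simp [newLinks]
          | cons a t ih =>
            by_cases ha : a ∈ S
            · simp [newLinks, signedWeight, ha] at ih ⊢; linarith
            · simp [newLinks, signedWeight, ha] at ih ⊢; linarith
        rw [hsplit]
        have e1 : ((newLinks S r.links).map w).sum = weightSum w (A v \ S) := by
          have hnd : (newLinks S r.links).Nodup := by
            refine hF.disj.imp ?_
            rintro a b hab rfl
            exact hab a.fst (mem_linksAt.2 (Or.inl rfl)) (mem_linksAt.2 (Or.inl rfl))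
          rw [← List.sum_toFinset _ hnd, weightSum]
          refine Finset.sum_congr ?_ fun _ _ => rfl
          ext e
          simp [mem_newLinks, hAv]
        have e2 : weightSum w (S ∩ A v) ≤ ((r.links.filter (· ∈ S)).map w).sum := by
          have hle : ∀ l : List G.Dart, ∑ e ∈ l.toFinset, w e ≤ (l.map w).sum := by
            intro l
            induction l with
            | nil => simp
            | cons a t ih =>
              by_cases ha : a ∈ t.toFinset
              · simp only [List.toFinset_cons, Finset.insert_eq_of_mem ha, List.map_cons,
                  List.sum_cons]
                linarith [hw a]
              · simp only [List.toFinset_cons, Finset.sum_insert ha, List.map_cons, List.sum_cons]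
                linarith
          refine le_trans (le_of_eq ?_) (hle _)
          refine Finset.sum_congr ?_ fun _ _ => rfl
          ext e
          simp [hAv, and_comm]
        linarith
      · have hAv : A v = ∅ := by simp [hA, switchedLinks, hr, hpos]
        rw [max_eq_left (not_lt.1 hpos), hAv]
        simp [weightSum]
  have hdisj : ∀ v ∈ (Finset.univ : Finset V), ∀ v' ∈ (Finset.univ : Finset V), v ≠ v' →
      Disjoint (A v \ S) (A v' \ S) := by
    intro v _ v' _ hne
    rw [Finset.disjoint_left]
    intro e he he'
    obtain ⟨he1, he2⟩ := Finset.mem_sdiff.1 he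
    obtain ⟨he1', -⟩ := Finset.mem_sdiff.1 he'
    obtain ⟨r, hr, hpos, hl⟩ := mem_switchedLinks.1 he1
    obtain ⟨r', hr', hpos', hl'⟩ := mem_switchedLinks.1 he1'
    have hx : e ∈ linksAt G e.fst := mem_linksAt.2 (Or.inl rfl)
    exact hne (h2 v v' r r' hr hr' <|
      ((h1 v r hr hpos).owned e (mem_newLinks.2 ⟨hl, he2⟩) _ hx).symm.trans
        ((h1 v' r' hr' hpos').owned e (mem_newLinks.2 ⟨hl', he2⟩) _ hx))
  have hnew : weightSum w (Finset.univ.biUnion A \ S) = ∑ v, weightSum w (A v \ S) := by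
    unfold weightSum
    rw [← Finset.sum_biUnion (fun v hv v' hv' => hdisj v hv v' hv')]
    refine Finset.sum_congr ?_ fun _ _ => rfl
    ext e
    simp
  have hold : weightSum w (S ∩ Finset.univ.biUnion A) ≤ ∑ v, weightSum w (S ∩ A v) := by
    have : S ∩ Finset.univ.biUnion A = Finset.univ.biUnion fun v => S ∩ A v := by
      ext e
      simp
    rw [this]
    unfold weightSum
    exact sum_biUnion_le_sum hw _ _
  have htot : weightSum w (augment k coins S w) =
      weightSum w S - weightSum w (S ∩ Finset.univ.biUnion A) +
        weightSum w (Finset.univ.biUnion A \ S) := by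
    unfold weightSum augment
    dsimp only
    rw [Finset.sum_union]
    · have := Finset.sum_inter_add_sum_sdiff S (Finset.univ.biUnion A) w
      rw [← hA]
      linarith
    · rw [Finset.disjoint_left]
      intro e he he'
      exact (Finset.mem_sdiff.1 he').2 (Finset.mem_sdiff.1 he).1
  have hs := Finset.sum_le_sum fun v (_ : v ∈ Finset.univ) => hgain v
  rw [Finset.sum_sub_distrib] at hs
  linarith

theorem weightSum_le_augment (k : ℕ) (coins : Coins G) {S : Finset G.Dart} (hS : IsMatching G S)
    {w : G.Dart → ℝ} (hw : ∀ i, 0 ≤ w i) :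
    weightSum w S ≤ weightSum w (augment k coins S w) :=
  le_trans (le_add_of_nonneg_right (Finset.sum_nonneg fun v _ => gainAt_nonneg k coins S w v))
    (weightSum_add_gain_le k coins hS hw)

end Invariant

/-! ### Decomposition of two matchings into alternating paths and cycles -/

section Decomposition

variable {V : Type*} [Fintype V] [DecidableEq V] {G : SimpleGraph V} [DecidableRel G.Adj]

/-- The nodes of the path consisting of `a` and its partner `σ a`. -/
def block (σ : V → V) (a : V) : List V := if σ a = a then [a] else [a, σ a]

/-- An alternating path is encoded by the list of the nodes `a` at which it enters a block
`a, σ a`, where `σ` maps every node to its partner in the first matching; links of the second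
matching join `σ a` and the next entry. This lists all nodes of the path. -/
def pathNodes (σ : V → V) (L : List V) : List V := L.flatMap (block σ)

theorem mem_block {σ : V → V} {a x : V} : x ∈ block σ a ↔ x = a ∨ x = σ a := by
  unfold block
  split_ifs with h <;> simp [h]

theorem mem_pathNodes {σ : V → V} {L : List V} {x : V} :
    x ∈ pathNodes σ L ↔ ∃ a ∈ L, x = a ∨ x = σ a := by
  simp [pathNodes, mem_block]

theorem pathNodes_append (σ : V → V) (L L' : List V) :
    pathNodes σ (L ++ L') = pathNodes σ L ++ pathNodes σ L' := by
  simp [pathNodes]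

/-- The reversal of an alternating path. -/
def flipPath (σ : V → V) (L : List V) : List V := (L.map σ).reverse

theorem pathNodes_flipPath {σ : V → V} (hσ : ∀ x, σ (σ x) = x) (L : List V) :
    (pathNodes σ (flipPath σ L)).Perm (pathNodes σ L) := by
  have h1 : (pathNodes σ (flipPath σ L)).Perm (pathNodes σ (L.map σ)) :=
    (List.reverse_perm (L.map σ)).flatMap_right _
  refine h1.trans ?_
  induction L with
  | nil => simp [pathNodes]
  | cons a t ih =>
    have hb : (block σ (σ a)).Perm (block σ a) := by
      unfold block
      rw [hσ]
      by_cases h : σ a = a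
      · simp [h]
      · rw [if_neg h, if_neg (fun h' => h h'.symm)]
        exact List.Perm.swap _ _ _
    have ih' := ih ((List.reverse_perm (t.map σ)).flatMap_right _)
    simpa [pathNodes] using hb.append ih'

/-- The link `e` joins `x` and `y`. -/
def Joins (e : G.Dart) (x y : V) : Prop := (e.fst = x ∧ e.snd = y) ∨ (e.fst = y ∧ e.snd = x)

instance (e : G.Dart) (x y : V) : Decidable (Joins e x y) :=
  inferInstanceAs (Decidable (_ ∨ _))

theorem Joins.symm {e : G.Dart} {x y : V} (h : Joins e x y) : Joins e y x := Or.symm h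

theorem Joins.mem_left {e : G.Dart} {x y : V} (h : Joins e x y) : e ∈ linksAt G x := by
  rw [mem_linksAt]
  exact h.imp (fun h => h.1) fun h => h.2

theorem Joins.mem_right {e : G.Dart} {x y : V} (h : Joins e x y) : e ∈ linksAt G y :=
  h.symm.mem_left

theorem Joins.otherEnd_eq {e : G.Dart} {x y : V} (h : Joins e x y) : otherEnd e x = y := by
  unfold otherEnd
  rcases h with ⟨h1, h2⟩ | ⟨h1, h2⟩
  · rw [if_pos h1, h2]
  · rw [if_neg, h1]
    rw [← h2]
    exact e.adj.ne

theorem joins_otherEnd {e : G.Dart} {x : V} (h : e ∈ linksAt G x) : Joins e x (otherEnd e x) := by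
  rw [mem_linksAt] at h
  unfold otherEnd
  split_ifs with h1
  · exact Or.inl ⟨h1, rfl⟩
  · exact Or.inr ⟨rfl, h.resolve_left h1⟩

/-- The weight of the link of `T` that joins `x` and `y` (if there is at most one). -/
def joinWeight (T : Finset G.Dart) (w : G.Dart → ℝ) (x y : V) : ℝ :=
  ∑ e ∈ T.filter fun e => Joins e x y, w e

theorem joinWeight_symm (T : Finset G.Dart) (w : G.Dart → ℝ) (x y : V) :
    joinWeight T w x y = joinWeight T w y x := by
  unfold joinWeight
  refine Finset.sum_congr (Finset.filter_congr fun e _ => ?_) fun _ _ => rfl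
  exact ⟨Joins.symm, Joins.symm⟩

theorem joinWeight_eq {T : Finset G.Dart} (hT : IsMatching G T) (w : G.Dart → ℝ) {x y : V}
    {e : G.Dart} (he : e ∈ T) (h : Joins e x y) : joinWeight T w x y = w e := by
  have : T.filter (fun e => Joins e x y) = {e} := by
    ext e'
    simp only [Finset.mem_filter, Finset.mem_singleton]
    constructor
    · rintro ⟨h1, h2⟩
      exact hT.eq_of_mem h1 he h2.mem_left h.mem_left
    · rintro rfl
      exact ⟨he, h⟩
  rw [joinWeight, this, Finset.sum_singleton]

/-- The sum of `f` over the pairs of consecutive entries. -/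
def pathWeight (f : V → V → ℝ) : List V → ℝ
  | [] => 0
  | [_] => 0
  | a :: b :: L => f a b + pathWeight f (b :: L)

theorem pathWeight_append (f : V → V → ℝ) {L L' : List V} {a b : V} (ha : L.getLast? = some a)
    (hb : L'.head? = some b) : pathWeight f (L ++ L') = pathWeight f L + f a b + pathWeight f L' := by
  induction L with
  | nil => simp at ha
  | cons c t ih =>
    cases t with
    | nil =>
      cases L' with
      | nil => simp at hb
      | cons d s =>
        simp only [List.getLast?_singleton, Option.some.injEq] at ha
        simp only [List.head?_cons, Option.some.injEq] at hb
        subst ha hb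
        simp [pathWeight]
    | cons d s =>
      have := ih (by simpa using ha)
      simp only [List.cons_append] at this ⊢
      simp only [pathWeight]
      rw [this]
      ring

theorem pathWeight_flipPath {σ : V → V} {f : V → V → ℝ} (hf : ∀ a b, f (σ b) (σ a) = f a b)
    (L : List V) : pathWeight f (flipPath σ L) = pathWeight f L := by
  induction L with
  | nil => rfl
  | cons a t ih =>
    cases t with
    | nil => simp [flipPath, pathWeight]
    | cons b s =>
      have h1 : flipPath σ (a :: b :: s) = flipPath σ (b :: s) ++ [σ a] := by simp [flipPath]
      rw [h1, pathWeight_append f (a := σ b) (b := σ a) (by simp [flipPath]) (by simp), ih, hf]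
      simp [pathWeight]
      ring

theorem pathWeight_nonneg {f : V → V → ℝ} (hf : ∀ a b, 0 ≤ f a b) (L : List V) :
    0 ≤ pathWeight f L := by
  induction L with
  | nil => exact le_rfl
  | cons a t ih =>
    cases t with
    | nil => exact le_rfl
    | cons b s => exact add_nonneg (hf a b) ih

theorem le_pathWeight {f : V → V → ℝ} {c : ℝ} {L : List V} (h : L.IsChain fun a b => c ≤ f a b) :
    ((L.length : ℝ) - 1) * c ≤ pathWeight f L ∨ L = [] := by
  induction L with
  | nil => exact Or.inr rfl
  | cons a t ih =>
    left
    cases t with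
    | nil => simp [pathWeight]
    | cons b s =>
      rw [List.isChain_cons_cons] at h
      have := (ih h.2).resolve_right (by simp)
      simp only [pathWeight, List.length_cons, Nat.cast_add, Nat.cast_one] at this ⊢
      nlinarith [h.1]

/-- An alternating path, or a cycle if a closing link `e` is given: `e` leads from the last node to
the first one, is not on the path and is not heavier than the links of `T` on the path. -/
structure Component (σ : V → V) (f : V → V → ℝ) (T : Finset G.Dart) (w : G.Dart → ℝ)
    (c : List V × Option G.Dart) : Prop where
  ne : c.1 ≠ []
  chain : c.1.IsChain fun a b => ∃ e ∈ T, Joins e (σ a) b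
  closing : ∀ e, c.2 = some e → e ∈ T ∧ (∃ b, c.1.getLast? = some b ∧ e.fst = σ b) ∧
    c.1.head? = some e.snd
  light : ∀ e, c.2 = some e → c.1.IsChain fun a b => w e ≤ f a b ∧ ¬ Joins e (σ a) b

/-- The weight of the links of the second matching in a component. -/
def componentWeight (f : V → V → ℝ) (w : G.Dart → ℝ) (c : List V × Option G.Dart) : ℝ :=
  pathWeight f c.1 + c.2.elim 0 w

/-- A decomposition of all nodes into alternating paths and cycles of `σ` and `T`. -/
structure Decomposition (σ : V → V) (f : V → V → ℝ) (T : Finset G.Dart) (w : G.Dart → ℝ)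
    (C : List (List V × Option G.Dart)) : Prop where
  nodup : (C.flatMap fun c => pathNodes σ c.1).Nodup
  cover : ∀ v, v ∈ C.flatMap fun c => pathNodes σ c.1
  comp : ∀ c ∈ C, Component σ f T w c
  weight : (C.map (componentWeight f w)).sum = ∑ e ∈ T, w e

theorem Component.mono {σ : V → V} {f : V → V → ℝ} {T T' : Finset G.Dart} {w : G.Dart → ℝ}
    {c : List V × Option G.Dart} (h : Component σ f T w c) (hT : T ⊆ T') :
    Component σ f T' w c where
  ne := h.ne
  chain := h.chain.imp fun _ _ ⟨e, he, hj⟩ => ⟨e, hT he, hj⟩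
  closing e he := ⟨hT (h.closing e he).1, (h.closing e he).2⟩
  light := h.light

theorem Decomposition.perm {σ : V → V} {f : V → V → ℝ} {T : Finset G.Dart} {w : G.Dart → ℝ}
    {C C' : List (List V × Option G.Dart)} (h : Decomposition σ f T w C) (hC : C.Perm C') :
    Decomposition σ f T w C' where
  nodup := (hC.flatMap_right _).nodup h.nodup
  cover v := (hC.flatMap_right _).mem_iff.1 (h.cover v)
  comp c hc := h.comp c (hC.mem_iff.2 hc)
  weight := ((hC.map _).sum_eq).symm.trans h.weight

theorem exists_trivial_decomposition {σ : V → V} (hσ : ∀ x, σ (σ x) = x) (f : V → V → ℝ)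
    (w : G.Dart → ℝ) : ∃ C, Decomposition σ f ∅ w C := by
  have key : ∀ s : Finset V, ∃ l : List V, (pathNodes σ l).Nodup ∧ ∀ v ∈ s, v ∈ pathNodes σ l := by
    intro s
    induction s using Finset.induction_on with
    | empty => exact ⟨[], by simp [pathNodes]⟩
    | insert a s ha ih =>
      obtain ⟨l, h1, h2⟩ := ih
      by_cases hal : a ∈ pathNodes σ l
      · refine ⟨l, h1, fun v hv => ?_⟩
        rcases Finset.mem_insert.1 hv with rfl | hv
        · exact hal
        · exact h2 v hv
      · have hσa : σ a ∉ pathNodes σ l := by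
          rw [mem_pathNodes] at hal ⊢
          rintro ⟨b, hb, h | h⟩
          · exact hal ⟨b, hb, Or.inr (by rw [← h, hσ])⟩
          · exact hal ⟨b, hb, Or.inl (by rw [← hσ a, h, hσ])⟩
        refine ⟨a :: l, ?_, fun v hv => ?_⟩
        · have : pathNodes σ (a :: l) = block σ a ++ pathNodes σ l := by simp [pathNodes]
          rw [this, List.nodup_append]
          refine ⟨?_, h1, ?_⟩
          · unfold block
            split_ifs with h
            · simp
            · simpa using fun h' => h h'.symm
          · rintro x hx y hy rfl
            rcases mem_block.1 hx with rfl | rfl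
            · exact hal hy
            · exact hσa hy
        · rcases Finset.mem_insert.1 hv with rfl | hv
          · exact mem_pathNodes.2 ⟨v, by simp, Or.inl rfl⟩
          · obtain ⟨b, hb, h⟩ := mem_pathNodes.1 (h2 v hv)
            exact mem_pathNodes.2 ⟨b, by simp [hb], h⟩
  obtain ⟨l, h1, h2⟩ := key Finset.univ
  have h3 : ((l.map fun a => (([a], none) : List V × Option G.Dart)).flatMap
      fun c => pathNodes σ c.1) = pathNodes σ l := by
    simp [pathNodes, List.flatMap_map]
  refine ⟨l.map fun a => ([a], none), ?_, ?_, ?_, ?_⟩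
  · rw [h3]; exact h1
  · rw [h3]; exact fun v => h2 v (Finset.mem_univ v)
  · intro c hc
    obtain ⟨a, -, rfl⟩ := List.mem_map.1 hc
    exact ⟨by simp, by simp, by simp, by simp⟩
  · rw [List.map_map]
    have : (componentWeight f w ∘ fun a => (([a], none) : List V × Option G.Dart)) = fun _ => 0 := by
      funext a
      simp [componentWeight, pathWeight]
    rw [this]
    simp

/-- A node that is on no link of `T` is an end of its component, which is not a cycle. -/
theorem Component.isEnd {σ : V → V} {f : V → V → ℝ} {T : Finset G.Dart}
    {w : G.Dart → ℝ} {c : List V × Option G.Dart} (h : Component σ f T w c) {x : V}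
    (hx : x ∈ pathNodes σ c.1) (hfree : ∀ e ∈ T, e ∉ linksAt G x) :
    c.2 = none ∧ (c.1.head? = some x ∨ ∃ b, c.1.getLast? = some b ∧ σ b = x) := by
  obtain ⟨a, ha, hxa⟩ := mem_pathNodes.1 hx
  obtain ⟨p, s, hL⟩ := List.append_of_mem ha
  have hc := h.chain
  rw [hL, List.isChain_split] at hc
  have hend : c.1.head? = some x ∨ ∃ b, c.1.getLast? = some b ∧ σ b = x := by
    rcases hxa with rfl | rfl
    · rcases List.eq_nil_or_concat p with rfl | ⟨p', b, rfl⟩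
      · left; simp [hL]
      · have := hc.1
        rw [List.concat_eq_append, List.append_assoc, List.singleton_append,
          List.isChain_append_cons_cons] at this
        obtain ⟨e, he, hj⟩ := this.2.1
        exact absurd hj.mem_right (hfree e he)
    · cases s with
      | nil => right; exact ⟨a, by simp [hL], rfl⟩
      | cons b s =>
        obtain ⟨e, he, hj⟩ := (List.isChain_cons_cons.1 hc.2).1
        exact absurd hj.mem_left (hfree e he)
  refine ⟨?_, hend⟩
  cases ho : c.2 with
  | none => rfl
  | some e =>
    exfalso
    obtain ⟨he, ⟨b, hb, hb'⟩, hh⟩ := h.closing e ho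
    rcases hend with h1 | ⟨b', h1, h2⟩
    · rw [hh] at h1
      exact hfree e he (mem_linksAt.2 (Or.inr (by simpa using h1)))
    · rw [hb] at h1
      cases h1
      exact hfree e he (mem_linksAt.2 (Or.inl (hb'.trans h2)))

theorem Component.flip {σ : V → V} (hσ : ∀ x, σ (σ x) = x) {f : V → V → ℝ} {T : Finset G.Dart}
    {w : G.Dart → ℝ} {L : List V} (h : Component σ f T w (L, none)) :
    Component σ f T w (flipPath σ L, none) where
  ne := by
    have := h.ne
    simpa [flipPath] using this
  chain := by
    have := h.chain
    simp only [flipPath, List.isChain_reverse, List.isChain_map] at this ⊢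
    refine this.imp ?_
    rintro a b ⟨e, he, hj⟩
    refine ⟨e, he, ?_⟩
    rw [hσ]
    exact hj.symm
  closing := by simp
  light := by simp

/-- Any component can be moved to the front, and an end of it to its last (or its first) place. -/
theorem Decomposition.reorient {σ : V → V} (hσ : ∀ x, σ (σ x) = x) {f : V → V → ℝ}
    (hf : ∀ a b, f (σ b) (σ a) = f a b) {T : Finset G.Dart} {w : G.Dart → ℝ} {L : List V}
    {C : List (List V × Option G.Dart)} (h : Decomposition σ f T w ((L, none) :: C)) :
    Decomposition σ f T w ((flipPath σ L, none) :: C) where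
  nodup := by
    refine (List.Perm.nodup ?_ h.nodup)
    simpa using ((pathNodes_flipPath hσ L).symm.append_right _)
  cover v := by
    refine (List.Perm.mem_iff ?_).1 (h.cover v)
    simpa using ((pathNodes_flipPath hσ L).symm.append_right _)
  comp c hc := by
    rcases List.mem_cons.1 hc with rfl | hc
    · exact (h.comp _ (by simp)).flip hσ
    · exact h.comp c (by simp [hc])
  weight := by
    rw [← h.weight]
    simp [componentWeight, pathWeight_flipPath hf]

theorem getLast?_flipPath {σ : V → V} {L : List V} {x : V} (h : L.head? = some x) :
    (flipPath σ L).getLast? = some (σ x) := by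
  simp [flipPath, List.getLast?_reverse, h]

theorem head?_flipPath {σ : V → V} {L : List V} {x : V} (h : L.getLast? = some x) :
    (flipPath σ L).head? = some (σ x) := by
  simp [flipPath, List.head?_reverse, h]

/-- Links of `T` are added one after the other, in the order of decreasing weight; thus the link
that closes a cycle is a lightest one. -/
theorem Decomposition.insert {σ : V → V} (hσ : ∀ x, σ (σ x) = x)
    {T T₀ : Finset G.Dart} (hT₀ : IsMatching G T₀) {w : G.Dart → ℝ} {e : G.Dart} (heT : e ∉ T)
    (hsub : insert e T ⊆ T₀) (hlight : ∀ d ∈ T, w e ≤ w d) {C : List (List V × Option G.Dart)}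
    (h : Decomposition σ (fun a b => joinWeight T₀ w (σ a) b) T w C) :
    ∃ C', Decomposition σ (fun a b => joinWeight T₀ w (σ a) b) (insert e T) w C' := by
  set f : V → V → ℝ := fun a b => joinWeight T₀ w (σ a) b with hf
  have hflip : ∀ a b, f (σ b) (σ a) = f a b := by
    intro a b
    simp only [hf, hσ]
    exact joinWeight_symm _ _ _ _
  have heT₀ : e ∈ T₀ := hsub (Finset.mem_insert_self e T)
  have hTT₀ : T ⊆ T₀ := (Finset.subset_insert e T).trans hsub
  have hfree : ∀ x, e ∈ linksAt G x → ∀ d ∈ T, d ∉ linksAt G x := by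
    intro x hx d hd hdx
    exact heT (hT₀.eq_of_mem heT₀ (hTT₀ hd) hx hdx ▸ hd)
  have hx := hfree e.fst (mem_linksAt.2 (Or.inl rfl))
  have hy := hfree e.snd (mem_linksAt.2 (Or.inr rfl))
  -- bring the path of the first node to the front, with this node last
  obtain ⟨L, C₁, hD, bL, hbL, hbx⟩ : ∃ L C₁, Decomposition σ f T w ((L, none) :: C₁) ∧
      ∃ b, L.getLast? = some b ∧ σ b = e.fst := by
    obtain ⟨⟨L, o⟩, hc, hxc⟩ := List.mem_flatMap.1 (h.cover e.fst)
    obtain ⟨ho, hend⟩ := (h.comp _ hc).isEnd hxc hx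
    dsimp only at ho hend
    subst ho
    have hD := h.perm (List.perm_cons_erase hc)
    rcases hend with hend | ⟨b, hb, hb'⟩
    · exact ⟨flipPath σ L, _, hD.reorient hσ hflip, σ e.fst, getLast?_flipPath hend, hσ _⟩
    · exact ⟨L, _, hD, b, hb, hb'⟩
  have hmem := hD.cover e.snd
  rw [List.flatMap_cons, List.mem_append] at hmem
  rcases hmem with hmem | hmem
  · -- the second node is the first of the same path, which becomes a cycle
    obtain ⟨-, hend⟩ := (hD.comp _ (by simp)).isEnd hmem hy
    have hhead : L.head? = some e.snd := by
      rcases hend with hend | ⟨b, hb, hb'⟩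
      · exact hend
      · dsimp only at hb
        rw [hbL] at hb
        cases hb
        exact absurd (hbx.symm.trans hb') e.adj.ne
    have hcL := hD.comp (L, none) (by simp)
    refine ⟨(L, some e) :: C₁, ?_, ?_, ?_, ?_⟩
    · simpa using hD.nodup
    · intro v; simpa using hD.cover v
    · intro c hc
      rcases List.mem_cons.1 hc with rfl | hc
      · refine ⟨hcL.ne, (hcL.mono (Finset.subset_insert e T)).chain, ?_, ?_⟩
        · rintro e' he'
          cases he'
          exact ⟨Finset.mem_insert_self e T, ⟨bL, hbL, hbx.symm⟩, hhead⟩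
        · rintro e' he'
          cases he'
          refine hcL.chain.imp ?_
          rintro a b ⟨d, hd, hj⟩
          refine ⟨?_, fun hj' => heT ?_⟩
          · simp only [hf]
            rw [joinWeight_eq hT₀ w (hTT₀ hd) hj]
            exact hlight d hd
          · rwa [hT₀.eq_of_mem heT₀ (hTT₀ hd) hj'.mem_right hj.mem_right]
      · exact (hD.comp c (by simp [hc])).mono (Finset.subset_insert e T)
    · have := hD.weight
      rw [Finset.sum_insert heT, ← this]
      simp [componentWeight]
      ring
  · -- the second node is an end of another path, and the two paths are joined
    obtain ⟨L', C₂, hD', hhead⟩ : ∃ L' C₂,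
        Decomposition σ f T w ((L', none) :: (L, none) :: C₂) ∧ L'.head? = some e.snd := by
      obtain ⟨⟨L', o⟩, hc, hyc⟩ := List.mem_flatMap.1 hmem
      obtain ⟨ho, hend⟩ := (hD.comp _ (by simp [hc])).isEnd hyc hy
      dsimp only at ho hend
      subst ho
      have hD' := hD.perm (((List.perm_cons_erase hc).cons (L, none)).trans
        (List.Perm.swap _ _ _))
      rcases hend with hend | ⟨b, hb, hb'⟩
      · exact ⟨L', _, hD', hend⟩
      · exact ⟨flipPath σ L', _, hD'.reorient hσ hflip, by rw [head?_flipPath hb, hb']⟩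
    have hcL := hD'.comp (L, none) (by simp)
    have hcL' := hD'.comp (L', none) (by simp)
    have hperm : ((L', none) :: (L, none) :: C₂ : List (List V × Option G.Dart)).Perm
        ((L, none) :: (L', none) :: C₂) := List.Perm.swap _ _ _
    have hD'' := hD'.perm hperm
    refine ⟨(L ++ L', none) :: C₂, ?_, ?_, ?_, ?_⟩
    · simpa [pathNodes_append] using hD''.nodup
    · intro v; simpa [pathNodes_append] using hD''.cover v
    · intro c hc
      rcases List.mem_cons.1 hc with rfl | hc
      · refine ⟨by simp [hcL.ne], ?_, by simp, by simp⟩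
        refine (hcL.mono (Finset.subset_insert e T)).chain.append
          (hcL'.mono (Finset.subset_insert e T)).chain ?_
        intro a ha b hb
        dsimp only at ha hb
        rw [Option.mem_def] at ha hb
        rw [hbL] at ha
        rw [hhead] at hb
        cases ha
        cases hb
        exact ⟨e, Finset.mem_insert_self e T, Or.inl ⟨hbx.symm, rfl⟩⟩
      · exact (hD''.comp c (by simp [hc])).mono (Finset.subset_insert e T)
    · have := hD''.weight
      rw [Finset.sum_insert heT, ← this]
      have hfe : f bL e.snd = w e := joinWeight_eq hT₀ w heT₀ (Or.inl ⟨hbx.symm, rfl⟩)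
      simp only [List.map_cons, List.sum_cons, componentWeight,
        pathWeight_append f hbL hhead, hfe]
      simp
      ring

theorem exists_decomposition {σ : V → V} (hσ : ∀ x, σ (σ x) = x) {T : Finset G.Dart}
    (hT : IsMatching G T) (w : G.Dart → ℝ) :
    ∃ C, Decomposition σ (fun a b => joinWeight T w (σ a) b) T w C := by
  have key : ∀ s : Finset G.Dart, s ⊆ T →
      ∃ C, Decomposition σ (fun a b => joinWeight T w (σ a) b) s w C := by
    intro s
    induction s using Finset.induction_on_min_value w with
    | empty => exact fun _ => exists_trivial_decomposition hσ _ w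
    | insert e s hes hmin ih =>
      intro hs
      obtain ⟨C, hC⟩ := ih ((Finset.subset_insert e s).trans hs)
      exact hC.insert hσ hT hes hs hmin
  exact key T le_rfl

/-! ### Cutting the components into short pieces -/

/-- There are `k + 1` ways to cut a path into pieces with at most `k` links of the second matching
such that every such link is cut in exactly one of them. In the `j`-th way the first piece has at
most `j` links. -/
theorem exists_cuts (f : V → V → ℝ) (k : ℕ) (a : V) (L : List V) :
    ∃ (P : ℕ → List V) (Q : ℕ → List (List V)),
      (∀ j ≤ k, (a :: P j) ++ (Q j).flatten = a :: L ∧ (P j).length ≤ j ∧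
        ∀ q ∈ Q j, q ≠ [] ∧ q.length ≤ k + 1) ∧
      ∑ j ∈ Finset.range (k + 1), (pathWeight f (a :: P j) + ((Q j).map (pathWeight f)).sum) =
        k * pathWeight f (a :: L) := by
  induction L generalizing a with
  | nil =>
    refine ⟨fun _ => [], fun _ => [], by simp, ?_⟩
    simp [pathWeight]
  | cons b L ih =>
    obtain ⟨P, Q, h1, h2⟩ := ih b
    refine ⟨fun j => if j = 0 then [] else b :: P (j - 1),
      fun j => if j = 0 then (b :: P k) :: Q k else Q (j - 1), ?_, ?_⟩
    · intro j hj
      rcases j with _ | j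
      · obtain ⟨h3, h4, h5⟩ := h1 k le_rfl
        refine ⟨by simpa using h3, by simp, ?_⟩
        intro q hq
        simp only [if_true, List.mem_cons] at hq
        rcases hq with rfl | hq
        · exact ⟨by simp, by simpa using h4⟩
        · exact h5 q hq
      · obtain ⟨h3, h4, h5⟩ := h1 j (by omega)
        refine ⟨by simpa using h3, by simpa using h4, ?_⟩
        simpa using h5
    · rw [Finset.sum_range_succ'] at *
      simp only [Nat.add_eq_zero_iff, one_ne_zero, and_false, if_false, Nat.add_sub_cancel,
        if_true, List.map_cons, List.sum_cons, pathWeight]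
      have h3 : ∑ j ∈ Finset.range k, (f a b + pathWeight f (b :: P j) +
          ((Q j).map (pathWeight f)).sum) = k * f a b + ∑ j ∈ Finset.range k,
            (pathWeight f (b :: P j) + ((Q j).map (pathWeight f)).sum) := by
        simp only [add_assoc, Finset.sum_add_distrib, Finset.sum_const, Finset.card_range,
          nsmul_eq_mul]
      have h4 := (Finset.sum_range_succ (fun j => pathWeight f (b :: P j) +
        ((Q j).map (pathWeight f)).sum) k).symm.trans
          ((Finset.sum_range_succ' _ k).trans h2)
      rw [h3]
      linarith

/-- Some way of cutting a path into short pieces keeps the fraction `k / (k + 1)` of its weight. -/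
theorem exists_cut (f : V → V → ℝ) (k : ℕ) {L : List V} (hL : L ≠ []) :
    ∃ Q : List (List V), Q.flatten = L ∧ (∀ q ∈ Q, q ≠ [] ∧ q.length ≤ k + 1) ∧
      k * pathWeight f L ≤ (k + 1) * (Q.map (pathWeight f)).sum := by
  cases L with
  | nil => exact absurd rfl hL
  | cons a L =>
    obtain ⟨P, Q, h1, h2⟩ := exists_cuts f k a L
    have hex : ∃ j ∈ Finset.range (k + 1), (k * pathWeight f (a :: L)) / (k + 1) ≤
        pathWeight f (a :: P j) + ((Q j).map (pathWeight f)).sum := by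
      refine Finset.exists_le_of_sum_le (by simp) ?_
      rw [h2, Finset.sum_const, Finset.card_range, nsmul_eq_mul]
      push_cast
      rw [mul_div_cancel₀ _ (by positivity)]
    obtain ⟨j, hj, hle⟩ := hex
    obtain ⟨h3, h4, h5⟩ := h1 j (by simpa [Nat.lt_succ_iff] using hj)
    refine ⟨(a :: P j) :: Q j, by simpa using h3, ?_, ?_⟩
    · intro q hq
      rcases List.mem_cons.1 hq with rfl | hq
      · refine ⟨by simp, ?_⟩
        have := Finset.mem_range.1 hj
        simp only [List.length_cons]
        omega
      · exact h5 q hq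
    · rw [div_le_iff₀ (by positivity)] at hle
      simp only [List.map_cons, List.sum_cons]
      linarith

/-- A component that one augmentation with at most `k` new links can switch. -/
def IsPiece (k : ℕ) (c : List V × Option G.Dart) : Prop :=
  c.1.length ≤ k + 1 ∧ (c.2 ≠ none → c.1.length ≤ k)

/-- Cutting a component into pieces loses at most the fraction `2 / (k + 1)` of its weight: if it is
a long cycle, the closing link is cut first. -/
theorem Component.exists_pieces {σ : V → V} {f : V → V → ℝ} {T : Finset G.Dart} {w : G.Dart → ℝ}
    (hw : ∀ e, 0 ≤ w e) (hf : ∀ a b, 0 ≤ f a b) {k : ℕ} (hk : 1 ≤ k)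
    {c : List V × Option G.Dart} (h : Component σ f T w c) :
    ∃ Q : List (List V × Option G.Dart), (Q.map Prod.fst).flatten = c.1 ∧
      (∀ q ∈ Q, Component σ f T w q ∧ IsPiece k q) ∧
      ((k : ℝ) - 1) / (k + 1) * componentWeight f w c ≤ (Q.map (componentWeight f w)).sum := by
  have hk' : (1 : ℝ) ≤ k := by exact_mod_cast hk
  by_cases hshort : c.2 ≠ none ∧ c.1.length ≤ k
  · refine ⟨[c], by simp, ?_, ?_⟩
    · intro q hq
      rw [List.mem_singleton.1 hq]
      exact ⟨h, by omega, fun _ => hshort.2⟩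
    · have h0 : 0 ≤ componentWeight f w c := by
        unfold componentWeight
        refine add_nonneg (pathWeight_nonneg hf _) ?_
        cases c.2 with
        | none => exact le_rfl
        | some e => exact hw e
      simp only [List.map_cons, List.map_nil, List.sum_cons, List.sum_nil, add_zero]
      refine mul_le_of_le_one_left h0 ?_
      rw [div_le_one (by positivity)]
      linarith
  · obtain ⟨Q, h1, h2, h3⟩ := exists_cut f k h.ne
    refine ⟨Q.map fun q => (q, none), ?_, ?_, ?_⟩
    · rw [List.map_map]
      simpa [Function.comp_def] using h1
    · intro q hq
      obtain ⟨q, hq', rfl⟩ := List.mem_map.1 hq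
      refine ⟨⟨(h2 q hq').1, ?_, by simp, by simp⟩, (h2 q hq').2, by simp⟩
      refine h.chain.infix ?_
      rw [← h1]
      obtain ⟨s, t, rfl⟩ := List.append_of_mem hq'
      exact ⟨s.flatten, t.flatten, by simp⟩
    · have e1 : ((Q.map fun q => ((q, none) : List V × Option G.Dart)).map
          (componentWeight f w)).sum = (Q.map (pathWeight f)).sum := by
        rw [List.map_map]
        congr 2
        funext q
        simp [componentWeight]
      rw [e1, div_mul_eq_mul_div, div_le_iff₀ (by positivity)]
      refine le_trans ?_ (h3.trans_eq (mul_comm _ _))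
      unfold componentWeight
      cases ho : c.2 with
      | none =>
        simp only [Option.elim_none, add_zero]
        nlinarith [pathWeight_nonneg hf c.1]
      | some e =>
        simp only [Option.elim_some]
        have hlen : k < c.1.length := by
          by_contra hc
          exact hshort ⟨by simp [ho], by omega⟩
        have hlen' : (k : ℝ) + 1 ≤ c.1.length := by exact_mod_cast hlen
        have h4 := (le_pathWeight ((h.light e ho).imp fun _ _ h => h.1)).resolve_right h.ne
        nlinarith [hw e]

theorem flatMap_pathNodes (σ : V → V) (Q : List (List V × Option G.Dart)) :
    (Q.flatMap fun c => pathNodes σ c.1) = pathNodes σ (Q.map Prod.fst).flatten := by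
  induction Q with
  | nil => rfl
  | cons c Q ih => simp [pathNodes_append, ih]

/-- The nodes can be decomposed into alternating paths and cycles with at most `k` links of a
matching `T` each, which contain at least the fraction `(k - 1) / (k + 1)` of the weight of `T`. -/
theorem exists_pieces {σ : V → V} (hσ : ∀ x, σ (σ x) = x) {T : Finset G.Dart}
    (hT : IsMatching G T) {w : G.Dart → ℝ} (hw : ∀ e, 0 ≤ w e) {k : ℕ} (hk : 1 ≤ k) :
    ∃ Q : List (List V × Option G.Dart), (Q.flatMap fun c => pathNodes σ c.1).Nodup ∧
      (∀ q ∈ Q, Component σ (fun a b => joinWeight T w (σ a) b) T w q ∧ IsPiece k q) ∧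
      ((k : ℝ) - 1) / (k + 1) * ∑ e ∈ T, w e ≤
        (Q.map (componentWeight (fun a b => joinWeight T w (σ a) b) w)).sum := by
  obtain ⟨C, hC⟩ := exists_decomposition hσ hT w
  set f : V → V → ℝ := fun a b => joinWeight T w (σ a) b with hf
  have hf0 : ∀ a b, 0 ≤ f a b := fun a b => Finset.sum_nonneg fun e _ => hw e
  have key : ∀ C : List (List V × Option G.Dart), (∀ c ∈ C, Component σ f T w c) →
      ∃ Q : List (List V × Option G.Dart),
        (Q.flatMap fun c => pathNodes σ c.1) = (C.flatMap fun c => pathNodes σ c.1) ∧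
        (∀ q ∈ Q, Component σ f T w q ∧ IsPiece k q) ∧
        ((k : ℝ) - 1) / (k + 1) * (C.map (componentWeight f w)).sum ≤
          (Q.map (componentWeight f w)).sum := by
    intro C
    induction C with
    | nil => intro _; exact ⟨[], by simp⟩
    | cons c C ih =>
      intro h
      obtain ⟨Q, h1, h2, h3⟩ := ih fun c hc => h c (by simp [hc])
      obtain ⟨Q', h1', h2', h3'⟩ := (h c (by simp)).exists_pieces hw hf0 hk
      refine ⟨Q' ++ Q, ?_, ?_, ?_⟩
      · rw [List.flatMap_append, List.flatMap_cons, h1, ← h1']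
        congr 1
        exact flatMap_pathNodes σ Q'
      · intro q hq
        rcases List.mem_append.1 hq with hq | hq
        · exact h2' q hq
        · exact h2 q hq
      · rw [List.map_append, List.sum_append, List.map_cons, List.sum_cons, mul_add]
        exact add_le_add h3' h3
  obtain ⟨Q, h1, h2, h3⟩ := key C hC.comp
  refine ⟨Q, h1 ▸ hC.nodup, h2, ?_⟩
  rw [← hC.weight]
  exact h3

end Decomposition

/-! ### Undisturbed runs of disjoint augmentations -/

section Trace

variable {V : Type*} [Fintype V] [DecidableEq V] {G : SimpleGraph V} [DecidableRel G.Adj]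

/-- If in a mini-slot exactly the `s`-th nodes of disjoint node lists send requests, each to the next
node of its list or to the first node of a list, then exactly the nodes at the places `s + 1` accept
requests. -/
theorem accepts_iff_of_disjoint {ι : Type*} {N : ι → List V}
    (hN : ∀ (a b : ι) (i j : ℕ) (v : V), (N a)[i]? = some v → (N b)[j]? = some v → a = b ∧ i = j)
    {s : ℕ} {st : V → NodeState G} {I : V → Intent G}
    (h1 : ∀ v, I v ≠ .idle → ∃ a, (N a)[s]? = some v)
    (h2 : ∀ a v v', (N a)[s]? = some v → (N a)[s + 1]? = some v' →
      ∃ own msg l, I v = .send own msg l ∧ otherEnd l v = v')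
    (h3 : ∀ a v, (N a)[s]? = some v → (N a)[s + 1]? = none → ∀ own msg l,
      I v = .send own msg l → ∃ b, (N b)[0]? = some (otherEnd l v))
    (h4 : ∀ a v, (N a)[s + 1]? = some v → st v = .null)
    (h5 : ∀ a v, (N a)[0]? = some v → st v ≠ .null) (n : V) :
    Accepts st I n ↔ ∃ a, (N a)[s + 1]? = some n := by
  have target : ∀ u own msg l, I u = .send own msg l → ∃ a, (N a)[s]? = some u ∧
      ((N a)[s + 1]? = some (otherEnd l u) ∨ ∃ b, (N b)[0]? = some (otherEnd l u)) := by
    intro u own msg l hu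
    obtain ⟨a, ha⟩ := h1 u (by simp [hu])
    refine ⟨a, ha, ?_⟩
    cases hv : (N a)[s + 1]? with
    | none => exact Or.inr (h3 a u ha hv own msg l hu)
    | some v' =>
      obtain ⟨own', msg', l', hu', hl'⟩ := h2 a u v' ha hv
      rw [hu] at hu'
      cases hu'
      exact Or.inl (by rw [hl'])
  constructor
  · intro ha
    obtain ⟨u, own, msg, l, hu, hl⟩ := ha.exists_sender
    obtain ⟨a, -, h | ⟨b, h⟩⟩ := target u own msg l hu
    · exact ⟨a, hl ▸ h⟩
    · exact absurd ha.1 (h5 b n (hl ▸ h))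
  · rintro ⟨a, ha⟩
    refine ⟨h4 a n ha, ?_⟩
    have hlen : s + 1 < (N a).length := (List.getElem?_eq_some_iff.1 ha).1
    have hv : (N a)[s]? = some (N a)[s] := List.getElem?_eq_getElem (by omega)
    obtain ⟨own, msg, l, hu, hl⟩ := h2 a _ n hv ha
    rw [Finset.card_eq_one]
    refine ⟨(N a)[s], ?_⟩
    ext u
    rw [Finset.mem_singleton, mem_callers]
    constructor
    · rintro ⟨own', msg', l', hu', hl'⟩
      obtain ⟨b, hb, h | ⟨b', h⟩⟩ := target u own' msg' l' hu'
      · rw [hl'] at h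
        obtain ⟨rfl, -⟩ := hN a b _ _ n ha h
        rw [hv] at hb
        cases hb
        rfl
      · rw [hl'] at h
        have := (hN a b' _ _ n ha h).2
        omega
    · rintro rfl
      exact ⟨own, msg, l, hu, hl⟩

/-- An active node passes on an augmentation to the next one. An entry consists of a node, the
record that it receives, and the link over which it receives it. -/
def Passes (coins : Coins G) (S : Finset G.Dart) (w : G.Dart → ℝ)
    (x y : V × Record G × G.Dart) : Prop :=
  ∃ own, extendIntent coins S w x.1 (.active x.2.1 x.2.2) = .send own y.2.1 y.2.2 ∧
    otherEnd y.2.2 x.1 = y.1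

/-- A family of augmentations, given by their seeds, by the entries of the nodes that they reach and
by the records of their termini, such that each of them proceeds in this way if it is not disturbed
by collisions. -/
structure Script {ι : Type*} (coins : Coins G) (S : Finset G.Dart) (w : G.Dart → ℝ)
    (seed : ι → V) (E : ι → List (V × Record G × G.Dart)) (F : ι → Record G) : Prop where
  ne : ∀ a, E a ≠ []
  seeds : ∀ v, (coins v).1 = true ↔ ∃ a, v = seed a
  disjoint : ∀ (a b : ι) (i j : ℕ) (v : V), (seed a :: (E a).map Prod.fst)[i]? = some v →
    (seed b :: (E b).map Prod.fst)[j]? = some v → a = b ∧ i = j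
  start : ∀ a x, (E a)[0]? = some x → ∃ own,
    seedIntent coins S w (seed a) = .send own x.2.1 x.2.2 ∧ otherEnd x.2.2 (seed a) = x.1
  chain : ∀ a, (E a).IsChain (Passes coins S w)
  last : ∀ a x, (E a).getLast? = some x →
    extendIntent coins S w x.1 (.active x.2.1 x.2.2) = .halt (F a) ∨
    ∃ msg l, extendIntent coins S w x.1 (.active x.2.1 x.2.2) = .send (F a) msg l ∧
      ∃ b, otherEnd l x.1 = seed b

/-- The states of the nodes when the `t`-th entries of the augmentations are active. -/
structure TraceState {ι : Type*} (seed : ι → V) (E : ι → List (V × Record G × G.Dart))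
    (F : ι → Record G) (t : ℕ) (st : V → NodeState G) : Prop where
  seed_used : ∀ a, st (seed a) = .used
  used : ∀ a i x, (E a)[i]? = some x → i < t → i + 1 < (E a).length → st x.1 = .used
  done : ∀ a i x, (E a)[i]? = some x → i < t → i + 1 = (E a).length → st x.1 = .done (F a)
  active : ∀ a x, (E a)[t]? = some x → st x.1 = .active x.2.1 x.2.2
  null : ∀ a i x, (E a)[i]? = some x → t < i → st x.1 = .null
  other : ∀ v, (∀ a, v ∉ seed a :: (E a).map Prod.fst) → st v = .null

theorem getElem?_succ_map {s : V} {E : List (V × Record G × G.Dart)} {i : ℕ}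
    {x : V × Record G × G.Dart} (h : E[i]? = some x) : (s :: E.map Prod.fst)[i + 1]? = some x.1 := by
  simp [h]

theorem exists_getElem?_of_succ {s : V} {E : List (V × Record G × G.Dart)} {i : ℕ} {v : V}
    (h : (s :: E.map Prod.fst)[i + 1]? = some v) : ∃ x, E[i]? = some x ∧ x.1 = v := by
  simpa using h

theorem Script.afterInit {ι : Type*} {coins : Coins G} {S : Finset G.Dart} {w : G.Dart → ℝ}
    {seed : ι → V} {E : ι → List (V × Record G × G.Dart)} {F : ι → Record G}
    (h : Script coins S w seed E F) : TraceState seed E F 0 (afterInit coins S w) := by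
  set st : V → NodeState G := fun v => if (coins v).1 = true then .used else .null with hst
  have hseed : ∀ a, (coins (seed a)).1 = true := fun a => (h.seeds _).2 ⟨a, rfl⟩
  have hentry : ∀ (a : ι) (i : ℕ) (x : V × Record G × G.Dart), (E a)[i]? = some x → ¬ (coins x.1).1 = true := by
    intro a i x hx hc
    obtain ⟨b, hb⟩ := (h.seeds _).1 hc
    have := (h.disjoint a b (i + 1) 0 x.1 (getElem?_succ_map hx) (by simp [hb])).2
    omega
  have hidle : ∀ v, ¬ (coins v).1 = true → seedIntent coins S w v = .idle := by
    intro v hv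
    simp [seedIntent, hv]
  have hacc : ∀ n, Accepts st (seedIntent coins S w) n ↔
      ∃ a, (seed a :: (E a).map Prod.fst)[0 + 1]? = some n := by
    refine accepts_iff_of_disjoint h.disjoint ?_ ?_ ?_ ?_ ?_
    · intro v hv
      obtain ⟨a, rfl⟩ := (h.seeds v).1 (by by_contra hc; exact hv (hidle v hc))
      exact ⟨a, rfl⟩
    · intro a v v' hv hv'
      obtain ⟨x, hx, rfl⟩ := exists_getElem?_of_succ hv'
      obtain ⟨own, h1, h2⟩ := h.start a x hx
      have : seed a = v := by simpa using hv
      subst this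
      exact ⟨own, _, _, h1, h2⟩
    · intro a v _ hv
      have := h.ne a
      simp at hv
      exact absurd hv this
    · intro a v hv
      obtain ⟨x, hx, rfl⟩ := exists_getElem?_of_succ hv
      simp [hst, hentry a 0 x hx]
    · intro a v hv
      have : seed a = v := by simpa using hv
      subst this
      simp [hst, hseed a]
  change TraceState seed E F 0 (exchange st (seedIntent coins S w))
  refine ⟨?_, fun _ _ _ _ h => absurd h (by omega), fun _ _ _ _ h => absurd h (by omega),
    ?_, ?_, ?_⟩
  · intro a
    obtain ⟨x, hx⟩ : ∃ x, (E a)[0]? = some x := by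
      have := h.ne a
      cases hE : E a with
      | nil => exact absurd hE this
      | cons y t => exact ⟨y, rfl⟩
    obtain ⟨own, h1, h2⟩ := h.start a x hx
    exact exchange_send_accept h1 (by rw [h2]; exact (hacc _).2 ⟨a, getElem?_succ_map hx⟩)
  · intro a x hx
    obtain ⟨own, h1, h2⟩ := h.start a x hx
    exact exchange_idle_accept (hidle _ (hentry a 0 x hx)) ((hacc _).2 ⟨a, getElem?_succ_map hx⟩)
      h1 h2
  · intro a i x hx hi
    rw [exchange_idle_reject (hidle _ (hentry a i x hx))]
    · simp [hst, hentry a i x hx]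
    · rw [hacc]
      rintro ⟨b, hb⟩
      have := (h.disjoint a b (i + 1) (0 + 1) x.1 (getElem?_succ_map hx) hb).2
      omega
  · intro v hv
    have hc : ¬ (coins v).1 = true := by
      intro hc
      obtain ⟨a, rfl⟩ := (h.seeds v).1 hc
      exact hv a (by simp)
    rw [exchange_idle_reject (hidle _ hc)]
    · simp [hst, hc]
    · rw [hacc]
      rintro ⟨b, hb⟩
      exact hv b (List.mem_of_getElem? hb)

theorem Script.miniSlot {ι : Type*} {coins : Coins G} {S : Finset G.Dart} {w : G.Dart → ℝ}
    {seed : ι → V} {E : ι → List (V × Record G × G.Dart)} {F : ι → Record G}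
    (h : Script coins S w seed E F) {t : ℕ} {st : V → NodeState G}
    (hst : TraceState seed E F t st) : TraceState seed E F (t + 1) (miniSlot coins S w st) := by
  set I : V → Intent G := fun v => extendIntent coins S w v (st v) with hI
  have hIt : ∀ a x, (E a)[t]? = some x →
      I x.1 = extendIntent coins S w x.1 (.active x.2.1 x.2.2) := by
    intro a x hx
    simp only [hI]
    rw [hst.active a x hx]
  have hnext : ∀ a x y, (E a)[t]? = some x → (E a)[t + 1]? = some y →
      ∃ own, I x.1 = .send own y.2.1 y.2.2 ∧ otherEnd y.2.2 x.1 = y.1 := by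
    intro a x y hx hy
    obtain ⟨hx1, hx2⟩ := List.getElem?_eq_some_iff.1 hx
    obtain ⟨hy1, hy2⟩ := List.getElem?_eq_some_iff.1 hy
    have := List.isChain_iff_getElem.1 (h.chain a) t hy1
    rw [hx2, hy2] at this
    rw [hIt a x hx]
    exact this
  have hlast : ∀ a x, (E a)[t]? = some x → t + 1 = (E a).length →
      I x.1 = .halt (F a) ∨ ∃ msg l, I x.1 = .send (F a) msg l ∧ ∃ b, otherEnd l x.1 = seed b := by
    intro a x hx ht
    rw [hIt a x hx]
    refine h.last a x ?_
    rw [List.getLast?_eq_getElem?, ← ht]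
    exact hx
  have hidle : ∀ v, (∀ r e, st v ≠ .active r e) → I v = .idle := by
    intro v hv
    simp only [hI]
    cases hs : st v with
    | active r e => exact absurd hs (hv r e)
    | null => rfl
    | used => rfl
    | done r => rfl
  -- every node is a seed, an entry, or not involved
  have hcases : ∀ v, (∃ a, v = seed a) ∨
      (∃ (a : ι) (i : ℕ) (x : V × Record G × G.Dart), (E a)[i]? = some x ∧ v = x.1) ∨
      ∀ a, v ∉ seed a :: (E a).map Prod.fst := by
    intro v
    by_cases hv : ∃ a, v ∈ seed a :: (E a).map Prod.fst
    · obtain ⟨a, ha⟩ := hv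
      rcases List.mem_cons.1 ha with ha | ha
      · exact Or.inl ⟨a, ha⟩
      · obtain ⟨x, hx, rfl⟩ := List.mem_map.1 ha
        obtain ⟨i, hi⟩ := List.mem_iff_getElem?.1 hx
        exact Or.inr (Or.inl ⟨a, i, x, hi, rfl⟩)
    · exact Or.inr (Or.inr (not_exists.1 hv))
  have hlen : ∀ {a : ι} {i : ℕ} {x : V × Record G × G.Dart}, (E a)[i]? = some x → i < (E a).length :=
    fun hx => (List.getElem?_eq_some_iff.1 hx).1
  have hacc : ∀ n, Accepts st I n ↔
      ∃ a, (seed a :: (E a).map Prod.fst)[t + 1 + 1]? = some n := by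
    refine accepts_iff_of_disjoint h.disjoint ?_ ?_ ?_ ?_ ?_
    · intro v hv
      rcases hcases v with ⟨a, rfl⟩ | ⟨a, i, x, hx, rfl⟩ | hv'
      · exact absurd (hidle _ (by simp [hst.seed_used a])) hv
      · rcases lt_trichotomy i t with hi | hi | hi
        · exfalso
          rcases Nat.lt_or_ge (i + 1) (E a).length with hl | hl
          · exact hv (hidle _ (by simp [hst.used a i x hx hi hl]))
          · have := hlen hx
            exact hv (hidle _ (by simp [hst.done a i x hx hi (by omega)]))
        · subst hi
          exact ⟨a, getElem?_succ_map hx⟩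
        · exact absurd (hidle _ (by simp [hst.null a i x hx hi])) hv
      · exact absurd (hidle _ (by simp [hst.other v hv'])) hv
    · intro a v v' hv hv'
      obtain ⟨x, hx, rfl⟩ := exists_getElem?_of_succ hv
      obtain ⟨y, hy, rfl⟩ := exists_getElem?_of_succ hv'
      obtain ⟨own, h1, h2⟩ := hnext a x y hx hy
      exact ⟨own, _, _, h1, h2⟩
    · intro a v hv hv' own msg l hsend
      obtain ⟨x, hx, rfl⟩ := exists_getElem?_of_succ hv
      have hlt : t + 1 = (E a).length := by
        have := hlen hx
        simp at hv'
        omega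
      rcases hlast a x hx hlt with hh | ⟨msg', l', hh, b, hb⟩
      · rw [hsend] at hh; cases hh
      · rw [hsend] at hh
        cases hh
        exact ⟨b, by simp [hb]⟩
    · intro a v hv
      obtain ⟨x, hx, rfl⟩ := exists_getElem?_of_succ hv
      exact hst.null a _ x hx (by omega)
    · intro a v hv
      have : seed a = v := by simpa using hv
      subst this
      simp [hst.seed_used a]
  have hkeep : ∀ v, (∀ r e, st v ≠ .active r e) → st v ≠ .null → exchange st I v = st v :=
    fun v h1 h2 => exchange_idle_reject (hidle v h1) fun ha => h2 ha.1
  change TraceState seed E F (t + 1) (exchange st I)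
  refine ⟨?_, ?_, ?_, ?_, ?_, ?_⟩
  · intro a
    rw [hkeep _ (by simp [hst.seed_used a]) (by simp [hst.seed_used a]), hst.seed_used a]
  · intro a i x hx hi hl
    rcases Nat.lt_succ_iff_lt_or_eq.1 hi with hi | rfl
    · have := hst.used a i x hx hi hl
      rw [hkeep _ (by simp [this]) (by simp [this]), this]
    · have hy : (E a)[i + 1]? = some (E a)[i + 1] := List.getElem?_eq_getElem hl
      obtain ⟨own, h1, h2⟩ := hnext a x _ hx hy
      exact exchange_send_accept h1 ((hacc _).2 ⟨a, h2 ▸ getElem?_succ_map hy⟩)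
  · intro a i x hx hi hl
    rcases Nat.lt_succ_iff_lt_or_eq.1 hi with hi | rfl
    · have := hst.done a i x hx hi hl
      rw [hkeep _ (by simp [this]) (by simp [this]), this]
    · rcases hlast a x hx hl with hh | ⟨msg, l, hh, b, hb⟩
      · exact exchange_halt hh
      · refine exchange_send_reject hh fun ha => ?_
        have := ha.1
        rw [hb, hst.seed_used b] at this
        cases this
  · intro a y hy
    have hlt := hlen hy
    have hx : (E a)[t]? = some (E a)[t] := List.getElem?_eq_getElem (by omega)
    obtain ⟨own, h1, h2⟩ := hnext a _ y hx hy
    have hn := hst.null a _ y hy (by omega)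
    exact exchange_idle_accept (hidle _ (by simp [hn])) ((hacc _).2 ⟨a, getElem?_succ_map hy⟩) h1 h2
  · intro a i x hx hi
    have hn := hst.null a i x hx (by omega)
    rw [exchange_idle_reject (hidle _ (by simp [hn])), hn]
    rw [hacc]
    rintro ⟨b, hb⟩
    have := (h.disjoint a b _ _ x.1 (getElem?_succ_map hx) hb).2
    omega
  · intro v hv
    have hn := hst.other v hv
    rw [exchange_idle_reject (hidle _ (by simp [hn])), hn]
    rw [hacc]
    rintro ⟨b, hb⟩
    exact hv b (List.mem_of_getElem? hb)

theorem Script.iterate {ι : Type*} {coins : Coins G} {S : Finset G.Dart} {w : G.Dart → ℝ}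
    {seed : ι → V} {E : ι → List (V × Record G × G.Dart)} {F : ι → Record G}
    (h : Script coins S w seed E F) (t : ℕ) :
    TraceState seed E F t ((AkUCB.miniSlot coins S w)^[t] (AkUCB.afterInit coins S w)) := by
  induction t with
  | zero => exact h.afterInit
  | succ t ih =>
    rw [Function.iterate_succ_apply']
    exact h.miniSlot ih

/-- The termini of undisturbed augmentations end up with the expected records. -/
theorem Script.finalRecord {ι : Type*} {coins : Coins G} {S : Finset G.Dart} {w : G.Dart → ℝ}
    {seed : ι → V} {E : ι → List (V × Record G × G.Dart)} {F : ι → Record G}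
    (h : Script coins S w seed E F) {k : ℕ} {a : ι} {x : V × Record G × G.Dart}
    (hx : (E a).getLast? = some x)
    (hk : (E a).length ≤ 2 * k ∨ ((E a).length = 2 * k + 1 ∧ x.2.1 = F a)) :
    AkUCB.finalRecord k coins S w x.1 = some (closeCycle S w x.1 (F a)) := by
  have hst := h.iterate (2 * k)
  have hx' := hx
  rw [List.getLast?_eq_getElem?] at hx'
  have hpos : 0 < (E a).length := List.length_pos_iff.2 (h.ne a)
  unfold AkUCB.finalRecord afterAugmenting
  rcases hk with hk | ⟨hk, hF⟩
  · rw [hst.done a _ x hx' (by omega) (by omega)]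
  · rw [hk, Nat.add_sub_cancel] at hx'
    rw [hst.active a x hx', hF]

end Trace

/-! ### Choices that make an augmentation follow a given alternating path -/

section Plan

variable {V : Type*} [Fintype V] [DecidableEq V] {G : SimpleGraph V} [DecidableRel G.Adj]

/-- The other end of the scheduled link at `x`, or `x` itself if there is none. -/
def partner (S : Finset G.Dart) (x : V) : V :=
  match scheduledLink S x with
  | some m => otherEnd m x
  | none => x

theorem partner_of_some {S : Finset G.Dart} {x : V} {m : G.Dart} (h : scheduledLink S x = some m) :
    partner S x = otherEnd m x := by
  simp [partner, h]

theorem partner_of_none {S : Finset G.Dart} {x : V} (h : scheduledLink S x = none) :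
    partner S x = x := by
  simp [partner, h]

theorem partner_eq_self_iff {S : Finset G.Dart} {x : V} :
    partner S x = x ↔ scheduledLink S x = none := by
  cases h : scheduledLink S x with
  | none => simp [partner_of_none h]
  | some m =>
    rw [partner_of_some h]
    simpa using otherEnd_ne m x

theorem IsMatching.scheduledLink_partner {S : Finset G.Dart} (hS : IsMatching G S) {x : V}
    {m : G.Dart} (h : scheduledLink S x = some m) : scheduledLink S (partner S x) = some m := by
  rw [partner_of_some h]
  exact hS.scheduledLink_eq (scheduledLink_eq_some h).1 (mem_linksAt_otherEnd m x)

theorem IsMatching.partner_partner {S : Finset G.Dart} (hS : IsMatching G S) (x : V) :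
    partner S (partner S x) = x := by
  cases h : scheduledLink S x with
  | none => rw [partner_of_none h, partner_of_none h]
  | some m =>
    rw [partner_of_some (hS.scheduledLink_partner h), partner_of_some h]
    exact (joins_otherEnd (scheduledLink_eq_some h).2).symm.otherEnd_eq

theorem block_of_some {S : Finset G.Dart} {a : V} {m : G.Dart} (h : scheduledLink S a = some m) :
    block (partner S) a = [a, partner S a] := by
  unfold block
  rw [if_neg]
  rw [partner_eq_self_iff, h]
  simp

theorem block_of_none {S : Finset G.Dart} {a : V} (h : scheduledLink S a = none) :
    block (partner S) a = [a] := by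
  unfold block
  rw [if_pos (partner_eq_self_iff.2 h)]

theorem pathNodes_cons (σ : V → V) (a : V) (L : List V) :
    pathNodes σ (a :: L) = block σ a ++ pathNodes σ L := by
  simp [pathNodes]

/-- The record after a new link `e` and a scheduled link `m` have been added to `r`. -/
def chainRecord (w : G.Dart → ℝ) (r : Record G) (e m : G.Dart) : Record G :=
  ⟨r.seed, r.links ++ [e] ++ [m], r.gain + w e - w m, r.size + 1, r.maxSize, true⟩

/-- The record after a last new link `e` has been added to `r`. -/
def lastRecord (w : G.Dart → ℝ) (r : Record G) (e : G.Dart) : Record G :=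
  ⟨r.seed, r.links ++ [e], r.gain + w e, r.size + 1, r.maxSize, false⟩

/-- The entries of an augmentation that continues the record `r` along a path, which is given by its
new links `e` and the nodes `a` to which they lead. -/
def script (S : Finset G.Dart) (w : G.Dart → ℝ) :
    Record G → List (G.Dart × V) → List (V × Record G × G.Dart)
  | _, [] => []
  | r, (e, a) :: P =>
    (a, { r with alt := false }, e) ::
      match scheduledLink S a with
      | some m => (partner S a, chainRecord w r e m, m) :: script S w (chainRecord w r e m) P
      | none => []

/-- The record of the terminus. -/
def finalOf (S : Finset G.Dart) (w : G.Dart → ℝ) : Record G → List (G.Dart × V) → Record G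
  | r, [] => r
  | r, (e, a) :: P =>
    match scheduledLink S a with
    | some m => finalOf S w (chainRecord w r e m) P
    | none => lastRecord w r e

/-- The random picks that the augmentation needs: a node, the set of links from which it picks, and
the link that it has to pick. The last node of a cycle has to pick the closing link `o`; the request
that it sends to the seed is in vain, but it disturbs no other augmentation. -/
def demands (S : Finset G.Dart) (o : Option G.Dart) :
    List G.Dart → V → List (G.Dart × V) → List (V × Finset G.Dart × G.Dart)
  | l, x, [] => o.toList.map fun e => (x, linksAt G x \ l.toFinset, e)
  | l, x, (e, a) :: P =>
    (x, linksAt G x \ l.toFinset, e) ::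
      match scheduledLink S a with
      | some m => demands S o (l ++ [e] ++ [m]) (partner S a) P
      | none => []

/-- The last node of a path that starts at `x`. -/
def exitNode (S : Finset G.Dart) : V → List (G.Dart × V) → V
  | x, [] => x
  | _, (_, a) :: P => exitNode S (partner S a) P

/-- The new links of the path are in `T`, and it does not end before the last entry. -/
def Linked (S T : Finset G.Dart) (o : Option G.Dart) : V → List (G.Dart × V) → Prop
  | _, [] => True
  | x, (e, a) :: P => e ∈ T ∧ Joins e x a ∧ ((P = [] ∧ o = none) ∨ scheduledLink S a ≠ none) ∧
      Linked S T o (partner S a) P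

/-- The links `l` of an augmentation that has reached `x` do not meet the rest `P` of its path. -/
structure Fresh (S : Finset G.Dart) (l : List G.Dart) (x : V) (P : List (G.Dart × V)) : Prop where
  mem : ∀ d ∈ l, d ∈ linksAt G x → d ∈ S
  notMem : ∀ d ∈ l, ∀ v ∈ pathNodes (partner S) (P.map Prod.snd), d ∉ linksAt G v
  nodup : (x :: pathNodes (partner S) (P.map Prod.snd)).Nodup

theorem Fresh.step {S : Finset G.Dart} {l : List G.Dart} {x a : V} {e m : G.Dart}
    {P : List (G.Dart × V)} (h : Fresh S l x ((e, a) :: P)) (hj : Joins e x a)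
    (hm : scheduledLink S a = some m) : Fresh S (l ++ [e] ++ [m]) (partner S a) P := by
  obtain ⟨hmS, hma⟩ := scheduledLink_eq_some hm
  have hne : partner S a ≠ a := by rw [Ne, partner_eq_self_iff, hm]; simp
  have hpn : pathNodes (partner S) (((e, a) :: P).map Prod.snd) =
      [a, partner S a] ++ pathNodes (partner S) (P.map Prod.snd) := by
    rw [List.map_cons, pathNodes_cons, block_of_some hm]
  have hnd := h.nodup
  have hnm := h.notMem
  rw [hpn] at hnd hnm
  simp only [List.cons_append, List.nil_append, List.nodup_cons, List.mem_cons, not_or] at hnd hnm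
  obtain ⟨⟨hxa, hxb, hxP⟩, ⟨hab, haP⟩, hbP, hP⟩ := hnd
  have hev : ∀ v, e ∈ linksAt G v → v = x ∨ v = a := by
    intro v hv
    have := (mem_linksAt_iff hj.mem_left).1 hv
    rwa [hj.otherEnd_eq] at this
  refine ⟨?_, ?_, ?_⟩
  · intro d hd hdx
    simp only [List.mem_append, List.mem_singleton] at hd
    rcases hd with (hd | rfl) | rfl
    · exact absurd hdx (hnm d hd _ (Or.inr (Or.inl rfl)))
    · rcases hev _ hdx with h1 | h1
      · exact absurd h1.symm hxb
      · exact absurd h1 hne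
    · exact hmS
  · intro d hd v hv hdv
    simp only [List.mem_append, List.mem_singleton] at hd
    rcases hd with (hd | rfl) | rfl
    · exact hnm d hd v (Or.inr (Or.inr hv)) hdv
    · rcases hev _ hdv with rfl | rfl
      · exact hxP hv
      · exact haP hv
    · have := (mem_linksAt_iff hma).1 hdv
      rw [← partner_of_some hm] at this
      rcases this with rfl | rfl
      · exact haP hv
      · exact hbP hv
  · exact List.nodup_cons.2 ⟨hbP, hP⟩

/-- The link that a node has to pick is available. -/
theorem mem_of_mem_demands {S T : Finset G.Dart} (hST : ∀ e ∈ T, e ∉ S) {o : Option G.Dart}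
    (P : List (G.Dart × V)) : ∀ (l : List G.Dart) (x : V), Linked S T o x P → Fresh S l x P →
    (∀ e, o = some e → e ∈ T ∧ e ∈ linksAt G (exitNode S x P)) →
    ∀ q ∈ demands S o l x P, q.2.2 ∈ q.2.1 ∧ q.2.1 ⊆ linksAt G q.1 := by
  have aux : ∀ (l : List G.Dart) (x : V), (∀ d ∈ l, d ∈ linksAt G x → d ∈ S) → ∀ e ∈ T,
      e ∈ linksAt G x → e ∈ linksAt G x \ l.toFinset ∧ linksAt G x \ l.toFinset ⊆ linksAt G x := by
    intro l x hl e he hex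
    refine ⟨Finset.mem_sdiff.2 ⟨hex, fun h => hST e he (hl e (List.mem_toFinset.1 h) hex)⟩,
      Finset.sdiff_subset⟩
  induction P with
  | nil =>
    intro l x _ hF ho q hq
    simp only [demands, List.mem_map, Option.mem_toList] at hq
    obtain ⟨e, he, rfl⟩ := hq
    exact aux l x hF.mem e (ho e he).1 (ho e he).2
  | cons p P ih =>
    obtain ⟨e, a⟩ := p
    intro l x hL hF ho q hq
    obtain ⟨heT, hj, -, hL'⟩ := hL
    simp only [demands, List.mem_cons] at hq
    rcases hq with rfl | hq
    · exact aux l x hF.mem e heT hj.mem_left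
    · cases hm : scheduledLink S a with
      | none => simp [hm] at hq
      | some m =>
        simp only [hm] at hq
        exact ih _ _ hL' (hF.step hj hm) ho q hq

theorem demands_keys_sublist (S : Finset G.Dart) (o : Option G.Dart) (P : List (G.Dart × V)) :
    ∀ (l : List G.Dart) (x : V), ((demands S o l x P).map Prod.fst).Sublist
      (x :: pathNodes (partner S) (P.map Prod.snd)) := by
  induction P with
  | nil =>
    intro l x
    cases o <;> simp [demands]
  | cons p P ih =>
    obtain ⟨e, a⟩ := p
    intro l x
    simp only [demands, List.map_cons, pathNodes_cons]
    refine List.Sublist.cons_cons _ ?_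
    cases hm : scheduledLink S a with
    | none => simp
    | some m =>
      rw [block_of_some hm]
      exact (ih _ _).cons _

/-- The node reached by the first link of a path picks no link at random. -/
theorem demands_keys_notMem {S : Finset G.Dart} {o : Option G.Dart} {l : List G.Dart} {x a : V}
    {e : G.Dart} {P : List (G.Dart × V)}
    (h : (x :: pathNodes (partner S) (((e, a) :: P).map Prod.snd)).Nodup) :
    a ∉ (demands S o l x ((e, a) :: P)).map Prod.fst := by
  simp only [List.map_cons, pathNodes_cons] at h
  simp only [demands, List.map_cons, List.mem_cons, not_or]
  cases hm : scheduledLink S a with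
  | none =>
    rw [block_of_none hm] at h
    simp only [List.cons_append, List.nil_append, List.nodup_cons, List.mem_cons, not_or] at h
    exact ⟨fun h' => h.1.1 h'.symm, by simp⟩
  | some m =>
    rw [block_of_some hm] at h
    simp only [List.cons_append, List.nil_append, List.nodup_cons, List.mem_cons, not_or] at h
    refine ⟨fun h' => h.1.1 h'.symm, fun h' => ?_⟩
    have := (demands_keys_sublist S o P _ _).subset h'
    rcases List.mem_cons.1 this with h1 | h1
    · exact h.2.1.1 h1
    · exact h.2.1.2 h1

/-- The choices `coins` comply with a demand. -/
def DemandMet (coins : Coins G) (q : V × Finset G.Dart × G.Dart) : Prop :=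
  ∀ (B : Finset G.Dart) (hB : B.Nonempty), B = q.2.1 → ((coins q.1).2.2 ⟨B, hB⟩).1 = q.2.2

theorem length_script_le (S : Finset G.Dart) (w : G.Dart → ℝ) (P : List (G.Dart × V)) :
    ∀ r : Record G, (script S w r P).length ≤ 2 * P.length := by
  induction P with
  | nil => simp [script]
  | cons p P ih =>
    intro r
    obtain ⟨e, a⟩ := p
    simp only [script, List.length_cons]
    cases hm : scheduledLink S a with
    | none => simp; omega
    | some m =>
      have := ih (chainRecord w r e m)
      simp only [List.length_cons]
      omega

theorem script_nodes {S T : Finset G.Dart} {w : G.Dart → ℝ} {o : Option G.Dart}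
    (P : List (G.Dart × V)) : ∀ (r : Record G) (x : V), Linked S T o x P →
      (script S w r P).map Prod.fst = pathNodes (partner S) (P.map Prod.snd) := by
  induction P with
  | nil => simp [script, pathNodes]
  | cons p P ih =>
    obtain ⟨e, a⟩ := p
    intro r x hL
    obtain ⟨-, -, hsched, hL'⟩ := hL
    simp only [script, List.map_cons, pathNodes_cons]
    cases hm : scheduledLink S a with
    | none =>
      have hP : P = [] := by
        rcases hsched with h | h
        · exact h.1
        · exact absurd hm h
      rw [block_of_none hm, hP]
      simp [pathNodes]
    | some m =>
      rw [block_of_some hm, List.map_cons, ih _ _ hL']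
      simp

theorem passes_of_pick {coins : Coins G} {S T : Finset G.Dart} (hST : ∀ e ∈ T, e ∉ S)
    {w : G.Dart → ℝ} {x a : V} {r : Record G} {via e : G.Dart} (halt : r.alt = true)
    (hsize : r.size < r.maxSize) (he : e ∈ T) (hj : Joins e x a)
    (hmem : ∀ d ∈ r.links, d ∈ linksAt G x → d ∈ S)
    (hD : DemandMet coins (x, linksAt G x \ r.links.toFinset, e)) :
    extendIntent coins S w x (.active r via) = .send r { r with alt := false } e := by
  have hmem : e ∈ linksAt G x \ r.links.toFinset := Finset.mem_sdiff.2
    ⟨hj.mem_left, fun h => hST e he (hmem e (List.mem_toFinset.1 h) hj.mem_left)⟩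
  have hne : (linksAt G x \ r.links.toFinset).Nonempty := ⟨e, hmem⟩
  have := hD _ hne rfl
  simp only at this
  simp [extendIntent, halt, hne, hsize, this]

theorem passes_of_scheduled {coins : Coins G} {S : Finset G.Dart} {w : G.Dart → ℝ} {a : V}
    {r : Record G} {e m : G.Dart} (hm : scheduledLink S a = some m) :
    Passes coins S w (a, { r with alt := false }, e) (partner S a, chainRecord w r e m, m) := by
  refine ⟨{ chainRecord w r e m with alt := false }, ?_, (partner_of_some hm).symm⟩
  simp [extendIntent, hm, chainRecord]

theorem extendIntent_of_unscheduled {coins : Coins G} {S : Finset G.Dart} {w : G.Dart → ℝ} {a : V}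
    {r : Record G} {e : G.Dart} (hm : scheduledLink S a = none) :
    extendIntent coins S w a (.active { r with alt := false } e) = .halt (lastRecord w r e) := by
  simp [extendIntent, hm, lastRecord]

/-- What the last entry `y` of an augmentation with terminus record `F` has to satisfy. -/
def LastOK (coins : Coins G) (S : Finset G.Dart) (w : G.Dart → ℝ) (o : Option G.Dart) (F : Record G)
    (y : V × Record G × G.Dart) : Prop :=
  extendIntent coins S w y.1 (.active y.2.1 y.2.2) = .halt F ∨
    ∃ e msg, o = some e ∧ extendIntent coins S w y.1 (.active y.2.1 y.2.2) = .send F msg e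

/-- If all demands are met, then an augmentation that has been received over a scheduled link
continues as planned. The maximum size exceeds the number of new links only for a cycle. -/
theorem script_chain {coins : Coins G} {S T : Finset G.Dart} (hST : ∀ e ∈ T, e ∉ S)
    {w : G.Dart → ℝ} {o : Option G.Dart} (P : List (G.Dart × V)) :
    ∀ (r : Record G) (x : V) (via : G.Dart), r.alt = true → Linked S T o x P →
    Fresh S r.links x P → (∀ e, o = some e → e ∈ T ∧ e ∈ linksAt G (exitNode S x P)) →
    r.size + P.length + o.toList.length = r.maxSize →
    (∀ q ∈ demands S o r.links x P, DemandMet coins q) →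
    ((x, r, via) :: script S w r P).IsChain (Passes coins S w) ∧
    ∀ y, ((x, r, via) :: script S w r P).getLast? = some y → y.1 = exitNode S x P ∧
      LastOK coins S w o (finalOf S w r P) y ∧
      (y.2.1 = finalOf S w r P ∨ ((script S w r P).length + 1 ≤ 2 * P.length ∧ o = none)) := by
  induction P with
  | nil =>
    intro r x via halt _ hF ho hsize hD
    refine ⟨by simp [script], ?_⟩
    intro y hy
    simp only [script, List.getLast?_singleton, Option.some.injEq] at hy
    subst hy
    refine ⟨rfl, ?_, Or.inl rfl⟩
    cases o with
    | none =>
      left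
      have : ¬ r.size < r.maxSize := by simp at hsize; omega
      simp [extendIntent, halt, this, finalOf]
    | some e =>
      right
      obtain ⟨heT, hex⟩ := ho e rfl
      have hlt : r.size < r.maxSize := by simp at hsize; omega
      exact ⟨e, _, rfl, passes_of_pick hST halt hlt heT (joins_otherEnd hex) hF.mem
        (hD _ (by simp [demands]))⟩
  | cons p P ih =>
    obtain ⟨e, a⟩ := p
    intro r x via halt hL hF ho hsize hD
    obtain ⟨heT, hj, hsched, hL'⟩ := hL
    have hpick := passes_of_pick (coins := coins) (via := via) (w := w) hST halt
      (by simp only [List.length_cons] at hsize; omega) heT hj hF.mem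
      (hD _ (by simp [demands]))
    have hstep : Passes coins S w (x, r, via) (a, { r with alt := false }, e) :=
      ⟨r, hpick, hj.otherEnd_eq⟩
    cases hm : scheduledLink S a with
    | none =>
      have hPo : P = [] ∧ o = none := by
        rcases hsched with h | h
        · exact h
        · exact absurd hm h
      obtain ⟨rfl, rfl⟩ := hPo
      refine ⟨by simpa [script, hm] using hstep, ?_⟩
      intro y hy
      simp only [script, hm, List.getLast?_cons_cons, List.getLast?_singleton,
        Option.some.injEq] at hy
      subst hy
      refine ⟨?_, Or.inl ?_, Or.inr ⟨by simp [script, hm], rfl⟩⟩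
      · simp [exitNode, partner_of_none hm]
      · simp only [finalOf, hm]
        exact extendIntent_of_unscheduled hm
    | some m =>
      obtain ⟨h1, h2⟩ := ih (chainRecord w r e m) (partner S a) m rfl hL' (hF.step hj hm) ho
        (by simp only [List.length_cons] at hsize; simp only [chainRecord]; omega)
        (fun q hq => hD q (by simp only [demands, hm]; exact List.mem_cons_of_mem _ hq))
      refine ⟨?_, ?_⟩
      · simp only [script, hm]
        exact List.isChain_cons_cons.2 ⟨hstep, List.isChain_cons_cons.2
          ⟨passes_of_scheduled hm, h1⟩⟩
      · intro y hy
        simp only [script, hm, List.getLast?_cons_cons] at hy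
        obtain ⟨h3, h4, h5⟩ := h2 y hy
        refine ⟨h3, ?_, ?_⟩
        · simp only [finalOf, hm]
          exact h4
        · simp only [finalOf, hm, script, List.length_cons]
          rcases h5 with h5 | ⟨h5, h6⟩
          · exact Or.inl h5
          · exact Or.inr ⟨by omega, h6⟩

theorem finalOf_seed (S : Finset G.Dart) (w : G.Dart → ℝ) (P : List (G.Dart × V)) :
    ∀ r : Record G, (finalOf S w r P).seed = r.seed ∧ (finalOf S w r P).maxSize = r.maxSize := by
  induction P with
  | nil => simp [finalOf]
  | cons p P ih =>
    intro r
    simp only [finalOf]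
    cases hm : scheduledLink S p.2 with
    | none => simp [lastRecord]
    | some m => exact ih (chainRecord w r p.1 m)

theorem finalOf_size {S T : Finset G.Dart} {w : G.Dart → ℝ} {o : Option G.Dart}
    (P : List (G.Dart × V)) : ∀ (r : Record G) (x : V), Linked S T o x P →
      (finalOf S w r P).size = r.size + P.length := by
  induction P with
  | nil => simp [finalOf]
  | cons p P ih =>
    obtain ⟨e, a⟩ := p
    intro r x hL
    obtain ⟨-, -, hsched, hL'⟩ := hL
    simp only [finalOf, List.length_cons]
    cases hm : scheduledLink S a with
    | none =>
      have hP : P = [] := by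
        rcases hsched with h | h
        · exact h.1
        · exact absurd hm h
      simp [lastRecord, hP]
    | some m =>
      simp only [ih (chainRecord w r e m) _ hL']
      simp only [chainRecord]
      omega

theorem finalOf_alt {S T : Finset G.Dart} {w : G.Dart → ℝ} {e₀ m₀ : G.Dart}
    (P : List (G.Dart × V)) : ∀ (r : Record G) (x : V), Linked S T (some e₀) x P →
      r.alt = true → r.links.head? = some m₀ →
      (finalOf S w r P).alt = true ∧ (finalOf S w r P).links.head? = some m₀ := by
  induction P with
  | nil => simp +contextual [finalOf]
  | cons p P ih =>
    obtain ⟨e, a⟩ := p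
    intro r x hL halt hhead
    obtain ⟨-, -, hsched, hL'⟩ := hL
    simp only [finalOf]
    cases hm : scheduledLink S a with
    | none => simp [hm] at hsched
    | some m => exact ih (chainRecord w r e m) _ hL' rfl (by simp [chainRecord, hhead])

/-- If the nodes at the ends of every scheduled link share its weight in the form of charges `c`,
then the gain of an augmentation is the weight of its new links minus the charges of its nodes. -/
theorem finalOf_gain {S T : Finset G.Dart} {w : G.Dart → ℝ} {o : Option G.Dart} {c : V → ℝ}
    (hc : ∀ a, scheduledLink S a = none → c a = 0) (P : List (G.Dart × V)) :
    ∀ (r : Record G) (x : V), Linked S T o x P →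
      (∀ p ∈ P, ∀ m, scheduledLink S p.2 = some m → c p.2 + c (partner S p.2) = w m) →
      (finalOf S w r P).gain = r.gain + (P.map fun p => w p.1).sum -
        ((pathNodes (partner S) (P.map Prod.snd)).map c).sum := by
  induction P with
  | nil => simp [finalOf, pathNodes]
  | cons p P ih =>
    obtain ⟨e, a⟩ := p
    intro r x hL hcP
    obtain ⟨-, -, hsched, hL'⟩ := hL
    simp only [finalOf, List.map_cons, pathNodes_cons, List.map_append, List.sum_append,
      List.sum_cons]
    cases hm : scheduledLink S a with
    | none =>
      have hP : P = [] := by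
        rcases hsched with h | h
        · exact h.1
        · exact absurd hm h
      simp [lastRecord, hP, block_of_none hm, hc a hm, pathNodes]
    | some m =>
      have h1 := hcP (e, a) (by simp) m hm
      simp only at h1
      simp only [ih (chainRecord w r e m) _ hL' fun p hp => hcP p (by simp [hp])]
      simp only [chainRecord, block_of_some hm, List.map_cons, List.map_nil, List.sum_cons,
        List.sum_nil]
      linarith

/-- The links of a path or cycle, from its entries. -/
theorem exists_linked {S T : Finset G.Dart} (hT : IsMatching G T) {w : G.Dart → ℝ}
    {o : Option G.Dart} (L : List V) : ∀ a₁ : V,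
    (a₁ :: L).IsChain (fun a b => ∃ e ∈ T, Joins e (partner S a) b ∧
      ∀ e₀, o = some e₀ → ¬ Joins e₀ (partner S a) b) →
    (pathNodes (partner S) (a₁ :: L)).Nodup →
    (∀ e, o = some e → e ∈ T ∧ ∃ b, (a₁ :: L).getLast? = some b ∧ e.fst = partner S b) →
    ∃ P : List (G.Dart × V), P.map Prod.snd = L ∧ Linked S T o (partner S a₁) P ∧
      (∀ e, o = some e → e.fst = exitNode S (partner S a₁) P) ∧
      pathWeight (fun a b => joinWeight T w (partner S a) b) (a₁ :: L) =
        (P.map fun p => w p.1).sum := by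
  induction L with
  | nil =>
    intro a₁ _ _ ho
    refine ⟨[], rfl, trivial, ?_, by simp [pathWeight]⟩
    intro e he
    obtain ⟨-, b, hb, hb'⟩ := ho e he
    simp only [List.getLast?_singleton, Option.some.injEq] at hb
    rw [hb', ← hb]
    rfl
  | cons a L ih =>
    intro a₁ hch hnd ho
    obtain ⟨⟨e, heT, hj, hoj⟩, hch'⟩ := List.isChain_cons_cons.1 hch
    have hx : partner S a₁ ∈ block (partner S) a₁ := mem_block.2 (Or.inr rfl)
    rw [pathNodes_cons, List.nodup_append] at hnd
    obtain ⟨-, hnd', hdisj⟩ := hnd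
    obtain ⟨P, h1, h2, h3, h4⟩ := ih a hch' hnd' (by simpa using ho)
    -- two links of `T` cannot meet at a node without scheduled link
    have hP : scheduledLink S a = none → P = [] := by
      intro hm
      rcases P with _ | ⟨⟨e', a'⟩, P⟩
      · rfl
      · exfalso
        obtain ⟨he'T, hj', -⟩ := h2
        rw [partner_of_none hm] at hj'
        have hee := hT.eq_of_mem heT he'T hj.mem_right hj'.mem_left
        subst hee
        have h5 : partner S a₁ = a' := by
          rw [← hj.symm.otherEnd_eq, ← hj'.otherEnd_eq]
        refine hdisj _ hx a' (mem_pathNodes.2 ⟨a', ?_, Or.inl rfl⟩) h5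
        rw [← h1]
        simp
    refine ⟨(e, a) :: P, by simp [h1], ⟨heT, hj, ?_, h2⟩, h3, ?_⟩
    · rw [or_iff_not_imp_right, not_not]
      intro hm
      refine ⟨hP hm, ?_⟩
      cases ho' : o with
      | none => rfl
      | some e₀ =>
        exfalso
        have h5 := h3 e₀ ho'
        rw [hP hm, exitNode, partner_of_none hm] at h5
        have hee := hT.eq_of_mem heT (ho e₀ ho').1 hj.mem_right (mem_linksAt.2 (Or.inl h5))
        exact hoj e₀ ho' (hee ▸ hj)
    · simp only [pathWeight, List.map_cons, List.sum_cons]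
      rw [h4, joinWeight_eq hT w heT hj]

end Plan

/-! ### Plans of several disjoint augmentations -/

section Plan

variable {V : Type*} [Fintype V] [DecidableEq V] {G : SimpleGraph V} [DecidableRel G.Adj]

/-- A planned augmentation: its seed, the new links of its path with the nodes to which they lead,
and the closing link if it is a cycle. -/
abbrev PlannedPath (G : SimpleGraph V) : Type _ := V × List (G.Dart × V) × Option G.Dart

/-- The nodes of a planned augmentation. -/
def PlannedPath.nodes (S : Finset G.Dart) (q : PlannedPath G) : List V :=
  pathNodes (partner S) (q.1 :: q.2.1.map Prod.snd)

/-- The number of new links of a planned augmentation. -/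
def PlannedPath.size (q : PlannedPath G) : ℕ := q.2.1.length + q.2.2.toList.length

/-- The weight of the new links of a planned augmentation. -/
def PlannedPath.weight (w : G.Dart → ℝ) (q : PlannedPath G) : ℝ :=
  (q.2.1.map fun p => w p.1).sum + q.2.2.elim 0 w

/-- The random picks that a planned augmentation needs. -/
def PlannedPath.demands (S : Finset G.Dart) (q : PlannedPath G) :
    List (V × Finset G.Dart × G.Dart) :=
  AkUCB.demands S q.2.2 (scheduledLink S q.1).toList (partner S q.1) q.2.1

/-- A planned augmentation with at most `k` new links, all of them in `T`, that the algorithm can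
follow. -/
structure PlannedPath.Valid (S T : Finset G.Dart) (k : ℕ) (q : PlannedPath G) : Prop where
  linked : Linked S T q.2.2 (partner S q.1) q.2.1
  nodup : (q.nodes S).Nodup
  closing : ∀ e, q.2.2 = some e → e ∈ T ∧ e.fst = exitNode S (partner S q.1) q.2.1 ∧ e.snd = q.1 ∧
    scheduledLink S q.1 ≠ none
  ne : q.2.2 = none → q.2.1 ≠ []
  size_le : q.size ≤ k

/-- The record that the seed sends, up to the flag that tells over which link it is sent. -/
def seedRecord (S : Finset G.Dart) (w : G.Dart → ℝ) (a : V) (n : ℕ) : Record G :=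
  match scheduledLink S a with
  | some m => ⟨a, [m], -w m, 0, n, true⟩
  | none => ⟨a, [], 0, 0, n, false⟩

/-- The entries of a planned augmentation. -/
def PlannedPath.entries (S : Finset G.Dart) (w : G.Dart → ℝ) (q : PlannedPath G) :
    List (V × Record G × G.Dart) :=
  match scheduledLink S q.1 with
  | some m => (partner S q.1, seedRecord S w q.1 q.size, m) ::
      script S w (seedRecord S w q.1 q.size) q.2.1
  | none => script S w (seedRecord S w q.1 q.size) q.2.1

/-- The record of the terminus of a planned augmentation. -/
def PlannedPath.final (S : Finset G.Dart) (w : G.Dart → ℝ) (q : PlannedPath G) : Record G :=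
  finalOf S w (seedRecord S w q.1 q.size) q.2.1

theorem PlannedPath.Valid.fresh {S T : Finset G.Dart} {k : ℕ} {q : PlannedPath G}
    (h : q.Valid S T k) : Fresh S (scheduledLink S q.1).toList (partner S q.1) q.2.1 := by
  have hnd := h.nodup
  rw [PlannedPath.nodes, pathNodes_cons] at hnd
  cases hm : scheduledLink S q.1 with
  | none =>
    rw [block_of_none hm] at hnd
    exact ⟨by simp, by simp, by rw [partner_of_none hm]; exact hnd⟩
  | some m =>
    obtain ⟨hmS, hma⟩ := scheduledLink_eq_some hm
    rw [block_of_some hm] at hnd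
    simp only [List.cons_append, List.nil_append, List.nodup_cons, List.mem_cons, not_or] at hnd
    refine ⟨by simp [hmS], ?_, List.nodup_cons.2 hnd.2⟩
    intro d hd v hv hdv
    simp only [Option.toList_some, List.mem_singleton] at hd
    subst hd
    rcases (mem_linksAt_iff hma).1 hdv with rfl | h1
    · exact hnd.1.2 hv
    · rw [← partner_of_some hm] at h1
      exact hnd.2.1 (h1 ▸ hv)

theorem PlannedPath.Valid.entries_nodes {S T : Finset G.Dart} {w : G.Dart → ℝ} {k : ℕ}
    {q : PlannedPath G} (h : q.Valid S T k) :
    q.1 :: (q.entries S w).map Prod.fst = q.nodes S := by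
  have h1 := script_nodes (w := w) q.2.1 (seedRecord S w q.1 q.size) _ h.linked
  unfold PlannedPath.entries PlannedPath.nodes
  rw [pathNodes_cons]
  cases hm : scheduledLink S q.1 with
  | none => simp [block_of_none hm, h1]
  | some m => simp [block_of_some hm, h1]

theorem PlannedPath.Valid.closing_mem {S T : Finset G.Dart} {k : ℕ} {q : PlannedPath G}
    (h : q.Valid S T k) : ∀ e, q.2.2 = some e →
      e ∈ T ∧ e ∈ linksAt G (exitNode S (partner S q.1) q.2.1) := fun e he =>
  ⟨(h.closing e he).1, mem_linksAt.2 (Or.inl (h.closing e he).2.1)⟩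

theorem PlannedPath.Valid.demand_mem {S T : Finset G.Dart} (hST : ∀ e ∈ T, e ∉ S) {k : ℕ}
    {q : PlannedPath G} (h : q.Valid S T k) :
    ∀ d ∈ q.demands S, d.2.2 ∈ d.2.1 ∧ d.2.1 ⊆ linksAt G d.1 :=
  mem_of_mem_demands hST _ _ _ h.linked h.fresh h.closing_mem

/-- If the seed starts and all demands are met, then the augmentation proceeds as planned. -/
theorem PlannedPath.Valid.run {coins : Coins G} {S T : Finset G.Dart} (hST : ∀ e ∈ T, e ∉ S)
    {w : G.Dart → ℝ} {k : ℕ} {q : PlannedPath G} (h : q.Valid S T k)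
    (hseed : (coins q.1).1 = true) (hsize : (coins q.1).2.1 = q.size)
    (hD : ∀ d ∈ q.demands S, DemandMet coins d) :
    q.entries S w ≠ [] ∧
    (∀ x, (q.entries S w)[0]? = some x → ∃ own,
      seedIntent coins S w q.1 = .send own x.2.1 x.2.2 ∧ otherEnd x.2.2 q.1 = x.1) ∧
    (q.entries S w).IsChain (Passes coins S w) ∧
    ∀ y, (q.entries S w).getLast? = some y → y.1 = exitNode S (partner S q.1) q.2.1 ∧
      LastOK coins S w q.2.2 (q.final S w) y ∧ ((q.entries S w).length ≤ 2 * k ∨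
        ((q.entries S w).length = 2 * k + 1 ∧ y.2.1 = q.final S w)) := by
  have hk := h.size_le
  have hF := h.fresh
  have hlen := length_script_le S w q.2.1 (seedRecord S w q.1 q.size)
  cases hm : scheduledLink S q.1 with
  | some m =>
    have hr : seedRecord S w q.1 q.size = ⟨q.1, [m], -w m, 0, q.size, true⟩ := by
      simp [seedRecord, hm]
    have hE : q.entries S w = (partner S q.1, seedRecord S w q.1 q.size, m) ::
        script S w (seedRecord S w q.1 q.size) q.2.1 := by
      simp [PlannedPath.entries, hm]
    obtain ⟨h1, h2⟩ := script_chain hST (w := w) q.2.1 (seedRecord S w q.1 q.size)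
      (partner S q.1) m (by rw [hr]) h.linked (by rw [hr]; rw [hm] at hF; exact hF) h.closing_mem
      (by rw [hr]; simp [PlannedPath.size]) (by
        rw [hr]
        intro d hd
        refine hD d ?_
        simpa [PlannedPath.demands, hm] using hd)
    rw [hE]
    refine ⟨by simp, ?_, h1, ?_⟩
    · intro x hx
      simp only [List.length_cons, Nat.zero_lt_succ, getElem?_pos, List.getElem_cons_zero,
        Option.some.injEq] at hx
      subst hx
      refine ⟨⟨q.1, [m], -w m, 0, q.size, false⟩, ?_, (partner_of_some hm).symm⟩
      rw [hr]
      simp [seedIntent, hseed, hm, hsize]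
    · intro y hy
      obtain ⟨h3, h4, h5⟩ := h2 y hy
      refine ⟨h3, h4, ?_⟩
      simp only [List.length_cons]
      unfold PlannedPath.size at hk
      rcases h5 with h5 | ⟨h5, -⟩
      · by_cases hl : (script S w (seedRecord S w q.1 q.size) q.2.1).length + 1 ≤ 2 * k
        · exact Or.inl hl
        · exact Or.inr ⟨by omega, h5⟩
      · left
        omega
  | none =>
    have hr : seedRecord S w q.1 q.size = ⟨q.1, [], 0, 0, q.size, false⟩ := by
      simp [seedRecord, hm]
    have hE : q.entries S w = script S w (seedRecord S w q.1 q.size) q.2.1 := by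
      simp [PlannedPath.entries, hm]
    have ho : q.2.2 = none := by
      by_contra hc
      obtain ⟨e, he⟩ := Option.ne_none_iff_exists'.1 hc
      exact (h.closing e he).2.2.2 hm
    have hL := h.linked
    have hclose := h.closing_mem
    rcases hq : q.2.1 with _ | ⟨⟨e, a⟩, P⟩
    · exact absurd hq (h.ne ho)
    rw [hq] at hL hF hlen hclose
    have hD' : ∀ d ∈ AkUCB.demands S q.2.2 (scheduledLink S q.1).toList (partner S q.1)
        ((e, a) :: P), DemandMet coins d := fun d hd => hD d (by
      rw [PlannedPath.demands, hq]; exact hd)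
    have hsz : P.length + 1 = q.size := by
      simp [PlannedPath.size, hq, ho]
    rw [partner_of_none hm] at hL hF hD' hclose
    obtain ⟨heT, hj, hsched, hL'⟩ := hL
    rw [hE, hq]
    set r := seedRecord S w q.1 q.size with hrdef
    have hr' : ({ r with alt := false } : Record G) = r := by rw [hr]
    have hstart : ∀ x, (script S w r ((e, a) :: P))[0]? = some x → ∃ own,
        seedIntent coins S w q.1 = .send own x.2.1 x.2.2 ∧ otherEnd x.2.2 q.1 = x.1 := by
      intro x hx
      simp only [script, List.length_cons, Nat.zero_lt_succ, getElem?_pos,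
        List.getElem_cons_zero, Option.some.injEq] at hx
      subst hx
      have hne : (linksAt G q.1).Nonempty := ⟨e, hj.mem_left⟩
      have hpick := hD' (q.1, linksAt G q.1 \ (scheduledLink S q.1).toList.toFinset, e)
        (by simp [AkUCB.demands]) (linksAt G q.1) hne (by simp [hm])
      simp only at hpick
      refine ⟨r, ?_, hj.otherEnd_eq⟩
      rw [hr']
      simp [seedIntent, hseed, hm, hne, hpick, hsize, hr]
    refine ⟨by simp [script], hstart, ?_⟩
    cases hma : scheduledLink S a with
    | none =>
      have hP : P = [] := by
        rcases hsched with h | h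
        · exact h.1
        · exact absurd hma h
      subst hP
      refine ⟨by simp [script, hma], ?_⟩
      intro y hy
      simp only [script, hma, List.getLast?_singleton, Option.some.injEq] at hy
      subst hy
      refine ⟨by simp [exitNode, partner_of_none hma], Or.inl ?_, Or.inl ?_⟩
      · simp only [PlannedPath.final, hq, finalOf, hma]
        exact extendIntent_of_unscheduled hma
      · simp only [script, hma, List.length_cons, List.length_nil]
        unfold PlannedPath.size at hk
        rw [hq] at hk
        simp at hk
        omega
    | some m =>
      obtain ⟨h1, h2⟩ := script_chain hST (w := w) P (chainRecord w r e m) (partner S a) m rfl hL'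
        (by
          have := hF.step hj hma
          rw [hm] at this
          rw [hr]
          exact this) (by simpa [exitNode] using hclose)
        (by rw [hr, ho]; simp [chainRecord, ← hsz]; omega) (by
          intro d hd
          refine hD' d ?_
          simp only [AkUCB.demands, hma]
          rw [hr] at hd
          rw [hm]
          exact List.mem_cons_of_mem _ hd)
      refine ⟨?_, ?_⟩
      · simp only [script, hma]
        exact List.isChain_cons_cons.2 ⟨passes_of_scheduled hma, h1⟩
      · intro y hy
        simp only [script, hma, List.getLast?_cons_cons] at hy
        obtain ⟨h3, h4, h5⟩ := h2 y hy
        refine ⟨h3, ?_, Or.inl ?_⟩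
        · simp only [PlannedPath.final, hq, finalOf, hma]
          exact h4
        · refine hlen.trans ?_
          unfold PlannedPath.size at hk
          rw [hq] at hk
          simp only [List.length_cons] at hk ⊢
          omega

/-- The terminus of a planned cycle adds the closing link. -/
theorem PlannedPath.Valid.closeCycle_gain {S T : Finset G.Dart} {w : G.Dart → ℝ} {k : ℕ}
    {q : PlannedPath G} (h : q.Valid S T k) :
    (closeCycle S w (exitNode S (partner S q.1) q.2.1) (q.final S w)).gain =
      (q.final S w).gain + q.2.2.elim 0 w := by
  have hsz := finalOf_size (w := w) q.2.1 (seedRecord S w q.1 q.size) _ h.linked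
  have h0 : (seedRecord S w q.1 q.size).size = 0 ∧ (seedRecord S w q.1 q.size).maxSize = q.size ∧
      (seedRecord S w q.1 q.size).seed = q.1 := by
    unfold seedRecord
    cases scheduledLink S q.1 <;> simp
  obtain ⟨hs1, hs2⟩ := finalOf_seed S w q.2.1 (seedRecord S w q.1 q.size)
  rw [h0.2.2] at hs1
  rw [h0.2.1] at hs2
  rw [h0.1, zero_add] at hsz
  change (q.final S w).seed = _ at hs1
  change (q.final S w).maxSize = _ at hs2
  change (q.final S w).size = _ at hsz
  cases ho : q.2.2 with
  | none =>
    have : ¬ (q.final S w).size < (q.final S w).maxSize := by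
      rw [hs2, hsz]
      simp [PlannedPath.size, ho]
    unfold closeCycle
    split_ifs with h1 h2
    · exact absurd h2.2.2 this
    · simp
    · simp
  | some e =>
    obtain ⟨heT, hef, hes, hsched⟩ := h.closing e ho
    obtain ⟨m, hm⟩ := Option.ne_none_iff_exists'.1 hsched
    have hlt : (q.final S w).size < (q.final S w).maxSize := by
      rw [hs2, hsz]
      simp [PlannedPath.size, ho]
    have hL := h.linked
    rw [ho] at hL
    obtain ⟨halt, hhead⟩ := finalOf_alt (w := w) (m₀ := m) q.2.1 (seedRecord S w q.1 q.size) _ hL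
      (by simp [seedRecord, hm]) (by simp [seedRecord, hm])
    have hadj : G.Adj (exitNode S (partner S q.1) q.2.1) (q.final S w).seed := by
      rw [hs1, ← hef, ← hes]
      exact e.adj
    have hed : (⟨(exitNode S (partner S q.1) q.2.1, (q.final S w).seed), hadj⟩ : G.Dart) = e := by
      ext
      · exact hef.symm
      · exact hs1.trans hes.symm
    unfold closeCycle
    rw [dif_pos hadj, if_pos ⟨halt, ⟨m, (scheduledLink_eq_some hm).1, hhead⟩, hlt⟩, hed]
    simp

/-- Half of the weight of the link of `U` at the node `x`. -/
def charge (U : Finset G.Dart) (w : G.Dart → ℝ) (x : V) : ℝ :=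
  (∑ m ∈ U ∩ linksAt G x, w m) / 2

theorem charge_nonneg {U : Finset G.Dart} {w : G.Dart → ℝ} (hw : ∀ e, 0 ≤ w e) (x : V) :
    0 ≤ charge U w x :=
  div_nonneg (Finset.sum_nonneg fun e _ => hw e) zero_le_two

theorem linksAt_filter_card (d : G.Dart) :
    (Finset.univ.filter fun x => d ∈ linksAt G x).card = 2 := by
  have : (Finset.univ.filter fun x => d ∈ linksAt G x) = {d.fst, d.snd} := by
    ext x
    simp [mem_linksAt, eq_comm]
  rw [this, Finset.card_pair d.adj.ne]

theorem sum_charge (U : Finset G.Dart) (w : G.Dart → ℝ) : ∑ x, charge U w x = weightSum w U := by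
  unfold charge weightSum
  rw [← Finset.sum_div]
  have h1 : ∀ x : V, ∑ m ∈ U ∩ linksAt G x, w m =
      ∑ m ∈ U, if m ∈ linksAt G x then w m else 0 := by
    intro x
    rw [← Finset.sum_filter, Finset.filter_mem_eq_inter]
  simp_rw [h1]
  rw [Finset.sum_comm]
  have h2 : ∀ m : G.Dart, (∑ x, if m ∈ linksAt G x then w m else 0) = 2 * w m := by
    intro m
    rw [← Finset.sum_filter, Finset.sum_const, linksAt_filter_card, nsmul_eq_mul]
    norm_num
  simp_rw [h2, ← Finset.mul_sum]
  ring

theorem charge_of_mem {S U : Finset G.Dart} (hS : IsMatching G S) (hU : U ⊆ S) (w : G.Dart → ℝ)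
    {x : V} {m : G.Dart} (hm : m ∈ U) (hx : m ∈ linksAt G x) : charge U w x = w m / 2 := by
  have : U ∩ linksAt G x = {m} := by
    ext d
    simp only [Finset.mem_inter, Finset.mem_singleton]
    constructor
    · rintro ⟨h1, h2⟩
      exact hS.eq_of_mem (hU h1) (hU hm) h2 hx
    · rintro rfl
      exact ⟨hm, hx⟩
  rw [charge, this, Finset.sum_singleton]

theorem charge_add_partner {S U : Finset G.Dart} (hS : IsMatching G S) (hU : U ⊆ S)
    (w : G.Dart → ℝ) {x : V} {m : G.Dart} (hm : m ∈ U) (hx : scheduledLink S x = some m) :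
    charge U w x + charge U w (partner S x) = w m := by
  rw [charge_of_mem hS hU w hm (scheduledLink_eq_some hx).2, charge_of_mem hS hU w hm
    (scheduledLink_eq_some (hS.scheduledLink_partner hx)).2]
  ring

theorem charge_of_unscheduled {S U : Finset G.Dart} (hU : U ⊆ S) (w : G.Dart → ℝ) {x : V}
    (hx : scheduledLink S x = none) : charge U w x = 0 := by
  have : U ∩ linksAt G x = ∅ := by
    rw [Finset.eq_empty_iff_forall_notMem]
    intro d hd
    obtain ⟨h1, h2⟩ := Finset.mem_inter.1 hd
    exact scheduledLink_eq_none hx d (hU h1) h2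
  simp [charge, this]

theorem Linked.mem {S T : Finset G.Dart} {o : Option G.Dart} (P : List (G.Dart × V)) :
    ∀ x : V, Linked S T o x P → ∀ p ∈ P, p.1 ∈ T ∧ p.1 ∈ linksAt G p.2 := by
  induction P with
  | nil => simp
  | cons p P ih =>
    obtain ⟨e, a⟩ := p
    rintro x ⟨h1, h2, -, h3⟩ p hp
    rcases List.mem_cons.1 hp with rfl | hp
    · exact ⟨h1, h2.mem_right⟩
    · exact ih _ h3 p hp

/-- The gain of a planned augmentation. -/
theorem PlannedPath.Valid.gain {S R T : Finset G.Dart} (hS : IsMatching G S) (hR : IsMatching G R)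
    (hTR : T ⊆ R) (hST : ∀ e ∈ T, e ∉ S) {w : G.Dart → ℝ} {k : ℕ} {q : PlannedPath G}
    (h : q.Valid S T k) :
    (closeCycle S w (exitNode S (partner S q.1) q.2.1) (q.final S w)).gain =
      q.weight w - ((q.nodes S).map (charge (S \ R) w)).sum := by
  have hU : S \ R ⊆ S := Finset.sdiff_subset
  -- scheduled links that meet a link of `T` are not in `R`
  have hmem : ∀ a m e, scheduledLink S a = some m → e ∈ T → e ∈ linksAt G a → m ∈ S \ R := by
    intro a m e hm he hea
    obtain ⟨h1, h2⟩ := scheduledLink_eq_some hm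
    refine Finset.mem_sdiff.2 ⟨h1, fun hmR => hST e he ?_⟩
    rwa [hR.eq_of_mem (hTR he) hmR hea h2]
  rw [h.closeCycle_gain, PlannedPath.final, finalOf_gain (c := charge (S \ R) w)
    (fun a ha => charge_of_unscheduled hU w ha) q.2.1 _ _ h.linked]
  · unfold PlannedPath.weight PlannedPath.nodes
    rw [pathNodes_cons, List.map_append, List.sum_append]
    have h0 : (seedRecord S w q.1 q.size).gain =
        -((block (partner S) q.1).map (charge (S \ R) w)).sum := by
      cases hm : scheduledLink S q.1 with
      | none => simp [seedRecord, hm, block_of_none hm, charge_of_unscheduled hU w hm]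
      | some m =>
        have hmU : m ∈ S \ R := by
          have hL := h.linked
          rcases hq : q.2.1 with _ | ⟨⟨e, a⟩, P⟩
          · cases ho : q.2.2 with
            | none => exact absurd hq (h.ne ho)
            | some e =>
              obtain ⟨h1, -, h2, -⟩ := h.closing e ho
              exact hmem q.1 m e hm h1 (mem_linksAt.2 (Or.inr h2))
          · rw [hq] at hL
            exact hmem (partner S q.1) m e (hS.scheduledLink_partner hm) hL.1 hL.2.1.mem_left
        simp [seedRecord, hm, block_of_some hm, charge_add_partner hS hU w hmU hm]
    rw [h0]
    ring
  · intro p hp m hm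
    obtain ⟨h1, h2⟩ := Linked.mem _ _ h.linked p hp
    exact charge_add_partner hS hU w (hmem _ m _ hm h1 h2) hm

/-- The random choices make all planned augmentations start, and no others, and meet their
demands. -/
structure Complies (S : Finset G.Dart) (plan : List (PlannedPath G)) (coins : Coins G) : Prop where
  seed_iff : ∀ v, (coins v).1 = true ↔ ∃ q ∈ plan, v = q.1
  size : ∀ q ∈ plan, (coins q.1).2.1 = q.size
  demand : ∀ q ∈ plan, ∀ d ∈ q.demands S, DemandMet coins d

theorem nodup_flatMap_index {α β : Type*} {l : List α} {f : α → List β} (h : (l.flatMap f).Nodup)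
    (a b : Fin l.length) (i j : ℕ) (v : β) (hi : (f l[a])[i]? = some v)
    (hj : (f l[b])[j]? = some v) : a = b ∧ i = j := by
  rw [List.nodup_flatMap] at h
  have hab : a = b := by
    by_contra hne
    have hp := List.pairwise_iff_getElem.1 h.2
    rcases lt_or_gt_of_ne (Fin.val_ne_of_ne hne) with hlt | hlt
    · exact hp a b a.2 b.2 hlt (List.mem_of_getElem? hi) (List.mem_of_getElem? hj)
    · exact hp b a b.2 a.2 hlt (List.mem_of_getElem? hj) (List.mem_of_getElem? hi)
  subst hab
  refine ⟨rfl, ?_⟩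
  obtain ⟨hi', hi⟩ := List.getElem?_eq_some_iff.1 hi
  obtain ⟨hj', hj⟩ := List.getElem?_eq_some_iff.1 hj
  exact (h.1 _ (List.getElem_mem a.2)).getElem_inj_iff.1 (hi.trans hj.symm)

/-- If the random choices comply with a plan, then the new schedule is at least as good as planned:
it exchanges the scheduled links outside `R` for the new links of the plan. -/
theorem weightSum_augment_of_complies {S R T : Finset G.Dart} (hS : IsMatching G S)
    (hR : IsMatching G R) (hTR : T ⊆ R) (hST : ∀ e ∈ T, e ∉ S) {w : G.Dart → ℝ}
    (hw : ∀ e, 0 ≤ w e) {k : ℕ} {plan : List (PlannedPath G)}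
    (hvalid : ∀ q ∈ plan, q.Valid S T k) (hnd : (plan.flatMap fun q => q.nodes S).Nodup)
    {coins : Coins G} (hc : Complies S plan coins) :
    weightSum w S - weightSum w (S \ R) + (plan.map (PlannedPath.weight w)).sum ≤
      weightSum w (augment k coins S w) := by
  have hmem : ∀ i : Fin plan.length, plan[i] ∈ plan := fun i => List.getElem_mem i.2
  have hv : ∀ i : Fin plan.length, plan[i].Valid S T k := fun i => hvalid _ (hmem i)
  have hrun := fun i : Fin plan.length => (hv i).run hST (w := w) (coins := coins)
    ((hc.seed_iff _).2 ⟨_, hmem i, rfl⟩) (hc.size _ (hmem i)) (hc.demand _ (hmem i))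
  have hscript : Script coins S w (fun i : Fin plan.length => plan[i].1)
      (fun i => plan[i].entries S w) (fun i => plan[i].final S w) := by
    refine ⟨fun i => (hrun i).1, ?_, ?_, fun i => (hrun i).2.1, fun i => (hrun i).2.2.1, ?_⟩
    · intro v
      rw [hc.seed_iff]
      constructor
      · rintro ⟨q, hq, rfl⟩
        obtain ⟨i, hi, rfl⟩ := List.mem_iff_getElem.1 hq
        exact ⟨⟨i, hi⟩, rfl⟩
      · rintro ⟨i, rfl⟩
        exact ⟨_, hmem i, rfl⟩
    · intro a b i j v hi hj
      rw [(hv a).entries_nodes] at hi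
      rw [(hv b).entries_nodes] at hj
      exact nodup_flatMap_index hnd a b i j v hi hj
    · intro i y hy
      obtain ⟨h1, h2, -⟩ := (hrun i).2.2.2 y hy
      rcases h2 with h2 | ⟨e, msg, he, h2⟩
      · exact Or.inl h2
      · refine Or.inr ⟨msg, e, h2, i, ?_⟩
        obtain ⟨-, h3, h4, -⟩ := (hv i).closing e he
        rw [h1, otherEnd, if_pos h3, h4]
  -- the termini
  have hlast : ∀ i : Fin plan.length, ∃ y, (plan[i].entries S w).getLast? = some y := by
    intro i
    cases hy : (plan[i].entries S w).getLast? with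
    | none => exact absurd (List.getLast?_eq_none_iff.1 hy) (hrun i).1
    | some y => exact ⟨y, rfl⟩
  choose y hy using hlast
  have hinj : Function.Injective fun i => (y i).1 := by
    intro a b hab
    have key : ∀ i, ∃ n : ℕ, (plan[i].nodes S)[n]? = some (y i).1 := by
      intro i
      rw [← (hv i).entries_nodes (w := w)]
      have := hy i
      rw [List.getLast?_eq_getElem?] at this
      exact ⟨_, getElem?_succ_map this⟩
    obtain ⟨n, hn⟩ := key a
    obtain ⟨n', hn'⟩ := key b
    simp only at hab
    rw [← hab] at hn'
    exact (nodup_flatMap_index hnd a b n n' _ hn hn').1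
  have hgain : ∀ i : Fin plan.length, plan[i].weight w -
      ((plan[i].nodes S).map (charge (S \ R) w)).sum ≤ gainAt k coins S w (y i).1 := by
    intro i
    obtain ⟨h1, -, h2⟩ := (hrun i).2.2.2 (y i) (hy i)
    have h3 := hscript.finalRecord (hy i) h2
    unfold gainAt
    rw [h3]
    refine le_trans (le_of_eq ?_) (le_max_right _ _)
    rw [h1]
    exact ((hv i).gain hS hR hTR hST).symm
  have hsum : ∑ i : Fin plan.length, gainAt k coins S w (y i).1 ≤ ∑ v, gainAt k coins S w v := by
    rw [← Finset.sum_image (f := gainAt k coins S w) fun a _ b _ h => hinj h]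
    exact Finset.sum_le_sum_of_subset_of_nonneg (Finset.subset_univ _)
      fun v _ _ => gainAt_nonneg k coins S w v
  have hcharge : ((plan.flatMap fun q => q.nodes S).map (charge (S \ R) w)).sum ≤
      weightSum w (S \ R) := by
    rw [← List.sum_toFinset _ hnd, ← sum_charge]
    exact Finset.sum_le_sum_of_subset_of_nonneg (Finset.subset_univ _)
      fun v _ _ => charge_nonneg hw v
  have hlist : ∀ g : PlannedPath G → ℝ, ∑ i : Fin plan.length, g plan[i] = (plan.map g).sum :=
    fun g => Fin.sum_univ_fun_getElem plan g
  have htot := (Finset.sum_le_sum fun i _ => hgain i).trans hsum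
  have hflat : ((plan.flatMap fun q => q.nodes S).map (charge (S \ R) w)).sum =
      (plan.map fun q => ((q.nodes S).map (charge (S \ R) w)).sum).sum := by
    clear * -
    induction plan with
    | nil => simp
    | cons q l ih => simp only [List.flatMap_cons, List.map_append, List.sum_append, List.map_cons,
        List.sum_cons, ih]
  rw [Finset.sum_sub_distrib, hlist (PlannedPath.weight w),
    hlist fun q => ((q.nodes S).map (charge (S \ R) w)).sum, ← hflat] at htot
  have := weightSum_add_gain_le k coins hS hw
  linarith

end Plan

/-! ### A plan that is near-optimal -/

section PlanExistence

variable {V : Type*} [Fintype V] [DecidableEq V] {G : SimpleGraph V} [DecidableRel G.Adj]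

/-- The algorithm can follow every piece of the decomposition that has weight. -/
theorem Component.exists_plannedPath {S T : Finset G.Dart} (hT : IsMatching G T)
    {w : G.Dart → ℝ} {k : ℕ} {c : List V × Option G.Dart}
    (hc : Component (partner S) (fun a b => joinWeight T w (partner S a) b) T w c)
    (hk : IsPiece k c) (hnd : (pathNodes (partner S) c.1).Nodup) :
    componentWeight (fun a b => joinWeight T w (partner S a) b) w c = 0 ∨
      ∃ q : PlannedPath G, q.Valid S T k ∧ q.nodes S = pathNodes (partner S) c.1 ∧
        q.weight w = componentWeight (fun a b => joinWeight T w (partner S a) b) w c := by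
  obtain ⟨C, o⟩ := c
  rcases C with _ | ⟨a₁, L⟩
  · exact absurd rfl hc.ne
  by_cases hact : o = none ∧ L = []
  · left
    simp [componentWeight, hact.1, hact.2, pathWeight]
  right
  have hchain : (a₁ :: L).IsChain (fun a b => ∃ e ∈ T, Joins e (partner S a) b ∧
      ∀ e₀, o = some e₀ → ¬ Joins e₀ (partner S a) b) := by
    cases o with
    | none => exact hc.chain.imp fun a b ⟨e, he, hj⟩ => ⟨e, he, hj, by simp⟩
    | some e₀ =>
      have h1 := hc.chain
      have h2 := hc.light e₀ rfl
      simp only at h1 h2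
      rw [List.isChain_iff_getElem] at h1 h2 ⊢
      intro i hi
      obtain ⟨e, he, hj⟩ := h1 i hi
      refine ⟨e, he, hj, ?_⟩
      rintro _ ⟨⟩
      exact (h2 i hi).2
  obtain ⟨P, hPL, hL, hexit, hweight⟩ := exists_linked hT (w := w) (o := o) L a₁ hchain hnd
    fun e he => ⟨(hc.closing e he).1, (hc.closing e he).2.1⟩
  have hlen : P.length = L.length := by rw [← hPL, List.length_map]
  refine ⟨(a₁, P, o), ⟨hL, ?_, ?_, ?_, ?_⟩, ?_, ?_⟩
  · simpa [PlannedPath.nodes, hPL] using hnd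
  · intro e he
    obtain ⟨heT, -, hhead⟩ := hc.closing e he
    simp only [List.head?_cons, Option.some.injEq] at hhead
    refine ⟨heT, hexit e he, hhead.symm, fun hm => ?_⟩
    simp only at he hm
    have hm' := partner_of_none hm
    have hex := hexit e he
    rcases P with _ | ⟨⟨d, a⟩, P⟩
    · rw [exitNode, hm'] at hex
      exact e.adj.ne (hex.trans hhead)
    · -- the first new link and the closing link would meet at the seed
      obtain ⟨hdT, hj, -⟩ := hL
      have hde := hT.eq_of_mem hdT heT hj.mem_left
        (by rw [hm']; exact mem_linksAt.2 (Or.inr hhead.symm))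
      obtain ⟨L', rfl⟩ : ∃ L', L = a :: L' := ⟨_, hPL.symm⟩
      obtain ⟨⟨-, -, -, h3⟩, -⟩ := List.isChain_cons_cons.1 hchain
      exact h3 e he (hde ▸ hj)
  · rintro ho rfl
    exact hact ⟨ho, by simpa using hPL.symm⟩
  · obtain ⟨h1, h2⟩ := hk
    cases o with
    | none =>
      simp [PlannedPath.size] at h1 ⊢
      omega
    | some e =>
      have := h2 (by simp)
      simp [PlannedPath.size] at this ⊢
      omega
  · simp [PlannedPath.nodes, hPL]
  · rw [PlannedPath.weight, componentWeight, hweight]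

/-- There are disjoint augmentations of at most `k` new links whose new links have at least the
fraction `(k - 1) / (k + 1)` of the weight of a given matching. -/
theorem exists_plan {S T : Finset G.Dart} (hS : IsMatching G S) (hT : IsMatching G T)
    {w : G.Dart → ℝ} (hw : ∀ e, 0 ≤ w e) {k : ℕ} (hk : 1 ≤ k) :
    ∃ plan : List (PlannedPath G), (∀ q ∈ plan, q.Valid S T k) ∧
      (plan.flatMap fun q => q.nodes S).Nodup ∧
      ((k : ℝ) - 1) / (k + 1) * weightSum w T ≤ (plan.map (PlannedPath.weight w)).sum := by
  obtain ⟨Q, hQ, hpiece, hsum⟩ := exists_pieces hS.partner_partner hT hw hk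
  suffices h : ∃ plan : List (PlannedPath G), (∀ q ∈ plan, q.Valid S T k) ∧
      (plan.flatMap fun q => q.nodes S).Sublist (Q.flatMap fun c => pathNodes (partner S) c.1) ∧
      (plan.map (PlannedPath.weight w)).sum =
        (Q.map (componentWeight (fun a b => joinWeight T w (partner S a) b) w)).sum by
    obtain ⟨plan, h1, h2, h3⟩ := h
    exact ⟨plan, h1, h2.nodup hQ, by rw [h3]; exact hsum⟩
  clear hsum
  induction Q with
  | nil => exact ⟨[], by simp, by simp, by simp⟩
  | cons c Q ih =>
    rw [List.flatMap_cons, List.nodup_append] at hQ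
    obtain ⟨plan, h1, h2, h3⟩ := ih hQ.2.1 fun q hq => hpiece q (by simp [hq])
    obtain ⟨hc, hck⟩ := hpiece c (by simp)
    rcases hc.exists_plannedPath hT hck hQ.1 with h0 | ⟨q, hq, hqn, hqw⟩
    · refine ⟨plan, h1, ?_, by simp [h0, h3]⟩
      rw [List.flatMap_cons]
      exact h2.trans (List.sublist_append_right _ _)
    · refine ⟨q :: plan, ?_, ?_, by simp [hqw, h3]⟩
      · intro q' hq'
        rcases List.mem_cons.1 hq' with rfl | h
        · exact hq
        · exact h1 _ h
      · rw [List.flatMap_cons, List.flatMap_cons, hqn]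
        exact h2.append_left _

/-- Whatever the weights, some plan makes the next schedule near-optimal. -/
theorem exists_nearOptimal_plan {S : Finset G.Dart} (hS : IsMatching G S) {w : G.Dart → ℝ}
    (hw : ∀ e, 0 ≤ w e) {k : ℕ} (hk : 1 ≤ k) :
    ∃ (T : Finset G.Dart) (plan : List (PlannedPath G)), (∀ e ∈ T, e ∉ S) ∧
      (∀ q ∈ plan, q.Valid S T k) ∧ (plan.flatMap fun q => q.nodes S).Nodup ∧
      ∀ coins, Complies S plan coins →
        ((k : ℝ) - 1) / (k + 1) * optSum w ≤ weightSum w (augment k coins S w) := by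
  obtain ⟨R, hR, hopt⟩ := Finset.exists_mem_eq_sup' (matchings_nonempty G) (weightSum w)
  have hR : IsMatching G R := by simpa [matchings] using hR
  have hTR : R \ S ⊆ R := Finset.sdiff_subset
  have hST : ∀ e ∈ R \ S, e ∉ S := fun e he => (Finset.mem_sdiff.1 he).2
  have hT : IsMatching G (R \ S) := isMatching_iff.2 fun v d hd d' hd' h h' =>
    hR.eq_of_mem (hTR hd) (hTR hd') h h'
  obtain ⟨plan, h1, h2, h3⟩ := exists_plan hS hT hw hk
  refine ⟨R \ S, plan, hST, h1, h2, fun coins hc => ?_⟩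
  refine le_trans ?_ (weightSum_augment_of_complies hS hR hTR hST hw h1 h2 hc)
  have e1 : weightSum w R = weightSum w (R ∩ S) + weightSum w (R \ S) :=
    (Finset.sum_inter_add_sum_sdiff R S w).symm
  have e2 : weightSum w S = weightSum w (S ∩ R) + weightSum w (S \ R) :=
    (Finset.sum_inter_add_sum_sdiff S R w).symm
  rw [Finset.inter_comm] at e2
  have hk' : (1 : ℝ) ≤ k := by exact_mod_cast hk
  have hα : ((k : ℝ) - 1) / (k + 1) ≤ 1 := by
    rw [div_le_one (by linarith)]
    linarith
  have hI : 0 ≤ weightSum w (R ∩ S) := Finset.sum_nonneg fun e _ => hw e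
  have := mul_le_mul_of_nonneg_right hα hI
  rw [optSum, hopt, e1, mul_add]
  linarith

end PlanExistence

/-! ### The law of the random choices -/

section CoinLaw

variable {V : Type*} [Fintype V] [DecidableEq V] {G : SimpleGraph V} [DecidableRel G.Adj]

instance : Finite (Choice G) := by
  unfold Choice
  infer_instance

instance : Nonempty (Choice G) := ⟨fun B => ⟨B.2.choose, B.2.choose_spec⟩⟩

instance : DiscreteMeasurableSpace (Choice G) := ⟨fun _ => trivial⟩

/-- A random choice function picks from `B` uniformly. -/
theorem uniformOn_choice (B : {B : Finset G.Dart // B.Nonempty}) (e : {d : G.Dart // d ∈ B.1}) :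
    uniformOn (Set.univ : Set (Choice G)) {f | f B = e} = ((B.1.card : ℕ) : ENNReal)⁻¹ := by
  classical
  have := Fintype.ofFinite (Choice G)
  let R := (j : {j // j ≠ B}) → {d : G.Dart // d ∈ j.1.1}
  let E : Choice G ≃ {d : G.Dart // d ∈ B.1} × R :=
    Equiv.piSplitAt B fun B : {B : Finset G.Dart // B.Nonempty} => {d : G.Dart // d ∈ B.1}
  have h1 : Fintype.card (Choice G) = B.1.card * Fintype.card R := by
    rw [← Nat.card_eq_fintype_card, ← Nat.card_eq_fintype_card, Nat.card_congr E, Nat.card_prod]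
    simp [R]
  have h2 : (Measure.count {f : Choice G | f B = e} : ENNReal) = Fintype.card R := by
    have : ({f : Choice G | f B = e}) = Set.range fun r : R => (E.symm (e, r) : Choice G) := by
      ext f
      constructor
      · intro hf
        refine ⟨(E f).2, ?_⟩
        have : (e, (E f).2) = E f := Prod.ext hf.symm rfl
        simp only [this]
        exact E.symm_apply_apply f
      · rintro ⟨r, rfl⟩
        change (E (E.symm (e, r))).1 = e
        rw [Equiv.apply_symm_apply]
    rw [Measure.count_apply (Set.toFinite _).measurableSet, this]
    have hinj : Function.Injective fun r : R => (E.symm (e, r) : Choice G) := fun r r' h => by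
      simpa using h
    rw [← Set.image_univ, hinj.encard_image, Set.encard_univ]
    simp
  rw [uniformOn_univ, h2, h1]
  have hR : Fintype.card R ≠ 0 := by
    have : Nonempty R := ⟨fun j => ⟨j.1.2.choose, j.1.2.choose_spec⟩⟩
    exact Fintype.card_ne_zero
  have hB : B.1.card ≠ 0 := Finset.card_ne_zero.2 B.2
  rw [div_eq_mul_inv, Nat.cast_mul, ENNReal.mul_inv (by simp) (by simp), mul_comm,
    mul_assoc, ENNReal.inv_mul_cancel (by simpa using hR) (by simp), mul_one]

theorem uniformOn_Icc_singleton {k n : ℕ} (h1 : 1 ≤ n) (hk : n ≤ k) :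
    uniformOn (Set.Icc 1 k) {n} = (k : ENNReal)⁻¹ := by
  have h2 : (Set.Icc 1 k ∩ {n} : Set ℕ) = {n} := by
    ext x
    simp only [Set.mem_inter_iff, Set.mem_Icc, Set.mem_singleton_iff]
    omega
  rw [← uniformOn_inter_self (Set.finite_Icc 1 k), h2, uniformOn, cond_apply measurableSet_Icc, h2,
    Measure.count_singleton, mul_one, Measure.count_apply measurableSet_Icc]
  simp [Set.encard_eq_coe_toFinset_card]

theorem isProbabilityMeasure_nodeCoinLaw {p : ℝ} (hp0 : 0 ≤ p) (hp1 : p ≤ 1) {k : ℕ} (hk : 1 ≤ k) :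
    IsProbabilityMeasure (nodeCoinLaw G p k) := by
  have h1 : IsProbabilityMeasure (ENNReal.ofReal p • Measure.dirac true +
      ENNReal.ofReal (1 - p) • Measure.dirac false : Measure Bool) := by
    refine ⟨?_⟩
    simp only [Measure.add_apply, Measure.smul_apply, measure_univ, smul_eq_mul, mul_one]
    rw [← ENNReal.ofReal_add hp0 (by linarith)]
    simp
  have h2 : IsProbabilityMeasure (uniformOn (Set.Icc 1 k)) :=
    isProbabilityMeasure_uniformOn (Set.finite_Icc 1 k) ⟨1, by simp [hk]⟩
  unfold nodeCoinLaw
  infer_instance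

theorem isProbabilityMeasure_coinLaw {p : ℝ} (hp0 : 0 ≤ p) (hp1 : p ≤ 1) {k : ℕ} (hk : 1 ≤ k) :
    IsProbabilityMeasure (coinLaw G p k) := by
  have := isProbabilityMeasure_nodeCoinLaw (G := G) hp0 hp1 hk
  unfold coinLaw
  infer_instance

theorem nodeCoinLaw_prod {p : ℝ} {k : ℕ} (hk : 1 ≤ k) (b : Bool) (N : Set ℕ)
    (F : Set (Choice G)) : nodeCoinLaw G p k ({b} ×ˢ (N ×ˢ F)) =
      ENNReal.ofReal (if b then p else 1 - p) *
        (uniformOn (Set.Icc 1 k) N * uniformOn Set.univ F) := by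
  have h2 : IsProbabilityMeasure (uniformOn (Set.Icc 1 k)) :=
    isProbabilityMeasure_uniformOn (Set.finite_Icc 1 k) ⟨1, by simp [hk]⟩
  unfold nodeCoinLaw
  rw [Measure.prod_prod, Measure.prod_prod]
  cases b <;> simp

theorem card_linksAt (v : V) : (linksAt G v).card = 2 * G.degree v := by
  have h1 : linksAt G v = (Finset.univ.filter fun d : G.Dart => d.fst = v) ∪
      (Finset.univ.filter fun d : G.Dart => d.snd = v) := by
    ext d
    simp [mem_linksAt]
  have h2 : (Finset.univ.filter fun d : G.Dart => d.snd = v).card =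
      (Finset.univ.filter fun d : G.Dart => d.fst = v).card := by
    refine Finset.card_bij (fun d _ => d.symm) ?_ ?_ ?_
    · simp
    · intro a _ b _ h
      exact SimpleGraph.Dart.symm_involutive.injective h
    · intro b hb
      exact ⟨b.symm, by simpa using hb, by simp⟩
  rw [h1, Finset.card_union_of_disjoint, h2, G.dart_fst_fiber_card_eq_degree, two_mul]
  rw [Finset.disjoint_left]
  intro d hd hd'
  simp only [Finset.mem_filter, Finset.mem_univ, true_and] at hd hd'
  exact d.adj.ne (hd.trans hd'.symm)

theorem card_le_of_subset_linksAt {B : Finset G.Dart} {v : V} (hB : B ⊆ linksAt G v) :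
    B.card ≤ 2 * G.maxDegree :=
  (Finset.card_le_card hB).trans (by
    rw [card_linksAt]
    exact Nat.mul_le_mul_left 2 (G.degree_le_maxDegree v))

end CoinLaw

/-! ### The probability that the random choices comply with a plan -/

section Compliance

variable {V : Type*} [Fintype V] [DecidableEq V] {G : SimpleGraph V} [DecidableRel G.Adj]

theorem PlannedPath.keys_sublist (S : Finset G.Dart) (q : PlannedPath G) :
    ((q.demands S).map Prod.fst).Sublist (q.nodes S) := by
  unfold PlannedPath.demands PlannedPath.nodes
  rw [pathNodes_cons]
  have h := demands_keys_sublist S q.2.2 q.2.1 (scheduledLink S q.1).toList (partner S q.1)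
  cases hm : scheduledLink S q.1 with
  | none => simpa [block_of_none hm, hm, partner_of_none hm] using h
  | some m =>
    rw [block_of_some hm]
    rw [hm] at h
    exact h.cons _

theorem PlannedPath.mem_nodes (S : Finset G.Dart) (q : PlannedPath G) : q.1 ∈ q.nodes S :=
  mem_pathNodes.2 ⟨q.1, by simp, Or.inl rfl⟩

theorem PlannedPath.Valid.seed_notMem {S T : Finset G.Dart} {k : ℕ} {q : PlannedPath G}
    (h : q.Valid S T k) (hm : scheduledLink S q.1 ≠ none) :
    q.1 ∉ (q.demands S).map Prod.fst := by
  obtain ⟨m, hm⟩ := Option.ne_none_iff_exists'.1 hm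
  have hnd := h.nodup
  rw [PlannedPath.nodes, pathNodes_cons, block_of_some hm] at hnd
  exact fun hq => (List.nodup_cons.1 hnd).1 ((demands_keys_sublist S _ _ _ _).subset hq)

theorem PlannedPath.Valid.one_le_size {S T : Finset G.Dart} {k : ℕ} {q : PlannedPath G}
    (h : q.Valid S T k) : 1 ≤ q.size := by
  unfold PlannedPath.size
  cases ho : q.2.2 with
  | none =>
    have := List.length_pos_iff.2 (h.ne ho)
    omega
  | some e => simp

/-- The first node that an augmentation from an unscheduled seed reaches. -/
def PlannedPath.firstReached (q : PlannedPath G) : V := (q.2.1.map Prod.snd).headD q.1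

theorem PlannedPath.Valid.firstReached {S T : Finset G.Dart} {k : ℕ} {q : PlannedPath G}
    (h : q.Valid S T k) (hm : scheduledLink S q.1 = none) :
    q.firstReached ∈ q.nodes S ∧ q.firstReached ≠ q.1 ∧
      q.firstReached ∉ (q.demands S).map Prod.fst := by
  have ho : q.2.2 = none := by
    by_contra hc
    obtain ⟨e, he⟩ := Option.ne_none_iff_exists'.1 hc
    exact (h.closing e he).2.2.2 hm
  have hnd := h.nodup
  rw [PlannedPath.nodes, pathNodes_cons, block_of_none hm] at hnd
  unfold PlannedPath.firstReached PlannedPath.nodes PlannedPath.demands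
  rcases hq : q.2.1 with _ | ⟨⟨e, a⟩, P⟩
  · exact absurd hq (h.ne ho)
  rw [hq] at hnd
  have ha : a ∈ pathNodes (partner S) (((e, a) :: P).map Prod.snd) :=
    mem_pathNodes.2 ⟨a, by simp, Or.inl rfl⟩
  refine ⟨mem_pathNodes.2 ⟨a, by simp, Or.inl rfl⟩, ?_, ?_⟩
  · rintro rfl
    exact (List.nodup_cons.1 hnd).1 ha
  · refine demands_keys_notMem ?_
    rw [partner_of_none hm]
    exact hnd

/-- Disjoint augmentations that share a node are equal. -/
theorem eq_of_mem_nodes {S : Finset G.Dart} {plan : List (PlannedPath G)}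
    (hnd : (plan.flatMap fun q => q.nodes S).Nodup) {q q' : PlannedPath G} (hq : q ∈ plan)
    (hq' : q' ∈ plan) {v : V} (hv : v ∈ q.nodes S) (hv' : v ∈ q'.nodes S) : q = q' := by
  by_contra hne
  have : Std.Symm (Function.onFun List.Disjoint fun q : PlannedPath G => q.nodes S) :=
    ⟨fun _ _ h => List.Disjoint.symm h⟩
  have h := (List.nodup_flatMap.1 hnd).2.forall hq hq' hne
  exact h hv hv'

/-- The choices of the node `v` comply with the plan. -/
def nodeEvent (S : Finset G.Dart) (plan : List (PlannedPath G)) (v : V) : Set (NodeCoin G) :=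
  {x | (x.1 = true ↔ ∃ q ∈ plan, v = q.1) ∧ (∀ q ∈ plan, q.1 = v → x.2.1 = q.size) ∧
    ∀ q ∈ plan, ∀ d ∈ q.demands S, d.1 = v →
      ∀ (B : Finset G.Dart) (hB : B.Nonempty), B = d.2.1 → (x.2.2 ⟨B, hB⟩).1 = d.2.2}

theorem pi_nodeEvent_subset (S : Finset G.Dart) (plan : List (PlannedPath G)) :
    Set.pi Set.univ (nodeEvent S plan) ⊆ {coins | Complies S plan coins} := fun _ h =>
  ⟨fun v => (h v trivial).1, fun q hq => (h q.1 trivial).2.1 q hq rfl,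
    fun q hq d hd => (h d.1 trivial).2.2 q hq d hd rfl⟩

open Classical in
/-- A lower bound for the probability that the choices of the node `v` comply with the plan. -/
def nodeBound (S : Finset G.Dart) (plan : List (PlannedPath G)) (p : ℝ) (k : ℕ) (v : V) : ℝ :=
  (if ∃ q ∈ plan, v = q.1 then p / k else 1 - p) *
    if ∃ q ∈ plan, v ∈ (q.demands S).map Prod.fst then (1 : ℝ) / (2 * G.maxDegree) else 1

theorem nodeBound_le {S T : Finset G.Dart} (hST : ∀ e ∈ T, e ∉ S) {k : ℕ} (hk : 1 ≤ k)
    {plan : List (PlannedPath G)} (hvalid : ∀ q ∈ plan, q.Valid S T k)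
    (hnd : (plan.flatMap fun q => q.nodes S).Nodup) {p : ℝ} (hp0 : 0 < p) (hp1 : p < 1)
    (hG : 1 ≤ G.maxDegree) (v : V) :
    ENNReal.ofReal (nodeBound S plan p k v) ≤ nodeCoinLaw G p k (nodeEvent S plan v) := by
  classical
  have hG' : (1 : ℝ) ≤ G.maxDegree := by exact_mod_cast hG
  have hk' : (1 : ℝ) ≤ k := by exact_mod_cast hk
  -- the pick of a link
  obtain ⟨F, hF, hFP⟩ : ∃ F : Set (Choice G), (∀ f ∈ F, ∀ q ∈ plan, ∀ d ∈ q.demands S, d.1 = v →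
      ∀ (B : Finset G.Dart) (hB : B.Nonempty), B = d.2.1 → (f ⟨B, hB⟩).1 = d.2.2) ∧
      ENNReal.ofReal (if ∃ q ∈ plan, v ∈ (q.demands S).map Prod.fst
        then 1 / (2 * G.maxDegree) else 1) ≤ uniformOn Set.univ F := by
    by_cases hdem : ∃ q ∈ plan, v ∈ (q.demands S).map Prod.fst
    · rw [if_pos hdem]
      obtain ⟨q, hq, hv⟩ := hdem
      obtain ⟨d, hd, rfl⟩ := List.mem_map.1 hv
      obtain ⟨h1, h2⟩ := (hvalid q hq).demand_mem hST d hd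
      refine ⟨{f | f ⟨d.2.1, ⟨_, h1⟩⟩ = ⟨d.2.2, h1⟩}, ?_, ?_⟩
      · intro f hf q' hq' d' hd' hdd B hB hBd
        have hqq : q' = q := eq_of_mem_nodes hnd hq' hq
          ((q'.keys_sublist S).subset (List.mem_map_of_mem hd'))
          (hdd ▸ (q.keys_sublist S).subset hv)
        subst hqq
        have hnk := (q'.keys_sublist S).nodup (hvalid q' hq').nodup
        have : d' = d := List.inj_on_of_nodup_map hnk hd' hd hdd
        subst this
        subst hBd
        exact congrArg Subtype.val hf
      · rw [uniformOn_choice, one_div, ENNReal.ofReal_inv_of_pos (by linarith)]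
        refine ENNReal.inv_le_inv.2 ?_
        rw [show (2 * (G.maxDegree : ℝ)) = ((2 * G.maxDegree : ℕ) : ℝ) by push_cast; rfl,
          ENNReal.ofReal_natCast]
        exact_mod_cast card_le_of_subset_linksAt h2
    · rw [if_neg hdem]
      refine ⟨Set.univ, ?_, by simp⟩
      intro f _ q hq d hd hdv
      exact absurd ⟨q, hq, List.mem_map.2 ⟨d, hd, hdv⟩⟩ hdem
  have hprob : IsProbabilityMeasure (uniformOn (Set.Icc 1 k)) :=
    isProbabilityMeasure_uniformOn (Set.finite_Icc 1 k) ⟨1, by simp [hk]⟩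
  unfold nodeBound
  by_cases hseed : ∃ q ∈ plan, v = q.1
  · rw [if_pos hseed]
    obtain ⟨q, hq, rfl⟩ := hseed
    refine le_trans ?_ (measure_mono (μ := nodeCoinLaw G p k)
      (s := {true} ×ˢ ({q.size} ×ˢ F)) ?_)
    · rw [nodeCoinLaw_prod hk, uniformOn_Icc_singleton (hvalid q hq).one_le_size
        (hvalid q hq).size_le, ENNReal.ofReal_mul (by positivity), ← mul_assoc]
      gcongr
      rw [ENNReal.ofReal_div_of_pos (by linarith), div_eq_mul_inv, ENNReal.ofReal_natCast]
      simp
    · rintro ⟨b, n, f⟩ ⟨hb, hn, hf⟩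
      simp only [Set.mem_singleton_iff] at hb hn
      refine ⟨iff_of_true hb ⟨q, hq, rfl⟩, ?_, hF f hf⟩
      intro q' hq' hqq
      have : q' = q := eq_of_mem_nodes hnd hq' hq (q'.mem_nodes S) (hqq ▸ q.mem_nodes S)
      rw [this]
      exact hn
  · rw [if_neg hseed]
    refine le_trans ?_ (measure_mono (μ := nodeCoinLaw G p k)
      (s := {false} ×ˢ (Set.univ ×ˢ F)) ?_)
    · rw [nodeCoinLaw_prod hk, measure_univ, one_mul, ENNReal.ofReal_mul (by linarith)]
      gcongr
      simp
    · rintro ⟨b, n, f⟩ ⟨hb, -, hf⟩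
      simp only [Set.mem_singleton_iff] at hb
      refine ⟨iff_of_false (by simp [hb]) hseed, ?_, hF f hf⟩
      rintro q hq rfl
      exact absurd ⟨q, hq, rfl⟩ hseed

/-- An unscheduled seed picks its first link with probability at least `1 / (2 Σ)` only, since each
of its neighbors is joined to it by two links; this is compensated by the node that it reaches first,
which has to comply with nothing but not being a seed. -/
theorem delta_le_prod_nodeBound {S T : Finset G.Dart} {k : ℕ} (hk : 2 ≤ k)
    {plan : List (PlannedPath G)} (hvalid : ∀ q ∈ plan, q.Valid S T k)
    (hnd : (plan.flatMap fun q => q.nodes S).Nodup) {p : ℝ} (hp0 : 0 < p) (hp1 : p < 1)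
    (hG : 1 ≤ G.maxDegree) : delta G p k ≤ ∏ v, nodeBound S plan p k v := by
  classical
  have hG' : (1 : ℝ) ≤ G.maxDegree := by exact_mod_cast hG
  have hk' : (2 : ℝ) ≤ k := by exact_mod_cast hk
  set D : ℝ := (G.maxDegree : ℝ)
  set a : ℝ := min 1 (p / (1 - p)) * ((1 - p) / (k * D)) with ha
  have hq0 : 0 < 1 - p := by linarith
  have hkD : 0 < (k : ℝ) * D := by positivity
  have ha0 : 0 ≤ a := by positivity
  have ha1 : a ≤ (1 - p) / (k * D) := by
    refine mul_le_of_le_one_left (by positivity) (min_le_left _ _)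
  have ha2 : a ≤ p / (k * D) := by
    calc a ≤ p / (1 - p) * ((1 - p) / (k * D)) :=
          mul_le_mul_of_nonneg_right (min_le_right _ _) (by positivity)
      _ = p / (k * D) := by field_simp
  have hδ : delta G p k ≤ a ^ Fintype.card V := by
    unfold delta
    rw [ha, mul_pow]
    refine mul_le_mul_of_nonneg_right ?_ (by positivity)
    rcases le_total 1 (p / (1 - p)) with h | h
    · rw [min_eq_left h, one_pow]
      exact min_le_left _ _
    · rw [min_eq_right h]
      exact min_le_right _ _
  set pu := plan.filter fun q => scheduledLink S q.1 = none with hpu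
  have hpu' : ∀ q, q ∈ pu ↔ q ∈ plan ∧ scheduledLink S q.1 = none := by
    intro q
    rw [hpu, List.mem_filter]
    simp
  set U : Finset V := (pu.map Prod.fst).toFinset with hU
  set W : Finset V := (pu.map PlannedPath.firstReached).toFinset with hW
  have hplan : plan.Nodup := by
    have h1 := List.nodup_flatMap.1 hnd
    refine h1.2.imp_of_mem fun {q q'} hq _ hd => ?_
    rintro rfl
    exact hd (q.mem_nodes S) (q.mem_nodes S)
  have hcard : U.card ≤ W.card := by
    have : W.card = pu.length := by
      rw [hW, List.toFinset_card_of_nodup, List.length_map]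
      refine List.Nodup.map_on ?_ (hplan.filter _)
      intro q hq q' hq' h
      obtain ⟨h1, h2⟩ := (hpu' q).1 hq
      obtain ⟨h1', h2'⟩ := (hpu' q').1 hq'
      exact eq_of_mem_nodes hnd h1 h1' ((hvalid q h1).firstReached h2).1
        (h ▸ ((hvalid q' h1').firstReached h2').1)
    rw [this, hU]
    exact (List.toFinset_card_le _).trans (by simp)
  have hprod : a ^ Fintype.card V ≤
      ∏ v : V, (a * ((if v ∈ U then 1 / 2 else 1) * if v ∈ W then 2 else 1)) := by
    rw [Finset.prod_mul_distrib, Finset.prod_const, Finset.prod_mul_distrib,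
      Finset.prod_ite_mem, Finset.prod_ite_mem, Finset.univ_inter, Finset.univ_inter,
      Finset.prod_const, Finset.prod_const, Finset.card_univ]
    refine le_mul_of_one_le_right (by positivity) ?_
    rw [one_div, inv_pow]
    have : (2 : ℝ) ^ U.card ≤ 2 ^ W.card := pow_le_pow_right₀ one_le_two hcard
    rw [← div_eq_inv_mul, one_le_div (by positivity)]
    exact this
  refine hδ.trans (hprod.trans (Finset.prod_le_prod (fun v _ => by positivity) fun v _ => ?_))
  unfold nodeBound
  have hdem0 : ∀ (P : Prop) [Decidable P], 1 / (2 * D) ≤ if P then 1 / (2 * D) else 1 := by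
    intro P _
    split_ifs
    · exact le_rfl
    · rw [div_le_one (by positivity)]
      linarith
  by_cases hvU : v ∈ U
  · obtain ⟨q, hq, rfl⟩ : ∃ q ∈ pu, q.1 = v := by simpa [hU] using hvU
    obtain ⟨h1, h2⟩ := (hpu' q).1 hq
    have hvW : q.1 ∉ W := by
      intro hv
      obtain ⟨q', hq', hqq⟩ : ∃ q' ∈ pu, q'.firstReached = q.1 := by simpa [hW] using hv
      obtain ⟨h1', h2'⟩ := (hpu' q').1 hq'
      obtain ⟨h3, h4, -⟩ := (hvalid q' h1').firstReached h2'
      have : q' = q := eq_of_mem_nodes hnd h1' h1 (hqq ▸ h3) (q.mem_nodes S)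
      rw [this] at h4 hqq
      exact h4 hqq
    rw [if_pos hvU, if_neg hvW, if_pos ⟨q, h1, rfl⟩]
    refine le_trans ?_ (mul_le_mul_of_nonneg_left (hdem0 _) (by positivity))
    calc a * (1 / 2 * 1) ≤ p / (k * D) * (1 / 2 * 1) := by gcongr
      _ = p / k * (1 / (2 * D)) := by field_simp
  rw [if_neg hvU, one_mul]
  by_cases hvW : v ∈ W
  · obtain ⟨q, hq, rfl⟩ : ∃ q ∈ pu, q.firstReached = v := by simpa [hW] using hvW
    obtain ⟨h1, h2⟩ := (hpu' q).1 hq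
    obtain ⟨h3, h4, h5⟩ := (hvalid q h1).firstReached h2
    rw [if_pos hvW, if_neg, if_neg]
    · calc a * 2 ≤ (1 - p) / (k * D) * 2 := by gcongr
        _ = (1 - p) * (2 / (k * D)) := by ring
        _ ≤ (1 - p) * 1 := by
          gcongr
          rw [div_le_one hkD]
          nlinarith
    · rintro ⟨q', h1', h⟩
      have : q = q' := eq_of_mem_nodes hnd h1 h1' h3 ((q'.keys_sublist S).subset h)
      exact h5 (this ▸ h)
    · rintro ⟨q', h1', h⟩
      have : q = q' := eq_of_mem_nodes hnd h1 h1' h3 (h ▸ q'.mem_nodes S)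
      exact h4 (this ▸ h)
  rw [if_neg hvW, mul_one]
  by_cases hs : ∃ q ∈ plan, v = q.1
  · obtain ⟨q, hq, rfl⟩ := hs
    have hm : scheduledLink S q.1 ≠ none := by
      intro hm
      refine hvU ?_
      rw [hU, List.mem_toFinset]
      exact List.mem_map_of_mem ((hpu' q).2 ⟨hq, hm⟩)
    rw [if_pos ⟨q, hq, rfl⟩, if_neg, mul_one]
    · refine ha2.trans ?_
      gcongr
      nlinarith
    · rintro ⟨q', hq', h⟩
      have : q = q' := eq_of_mem_nodes hnd hq hq' (q.mem_nodes S)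
        ((q'.keys_sublist S).subset h)
      exact (hvalid q hq).seed_notMem hm (this ▸ h)
  · rw [if_neg hs]
    refine le_trans ?_ (mul_le_mul_of_nonneg_left (hdem0 _) hq0.le)
    refine ha1.trans ?_
    rw [mul_one_div]
    gcongr

theorem delta_le_coinLaw_complies {S T : Finset G.Dart} (hST : ∀ e ∈ T, e ∉ S) {k : ℕ}
    (hk : 2 ≤ k) {plan : List (PlannedPath G)} (hvalid : ∀ q ∈ plan, q.Valid S T k)
    (hnd : (plan.flatMap fun q => q.nodes S).Nodup) {p : ℝ} (hp0 : 0 < p) (hp1 : p < 1)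
    (hG : 1 ≤ G.maxDegree) :
    ENNReal.ofReal (delta G p k) ≤ coinLaw G p k {coins | Complies S plan coins} := by
  have := isProbabilityMeasure_nodeCoinLaw (G := G) hp0.le hp1.le (by omega : 1 ≤ k)
  refine le_trans ?_ (measure_mono (pi_nodeEvent_subset S plan))
  rw [coinLaw, Measure.pi_pi]
  refine (ENNReal.ofReal_le_ofReal
    (delta_le_prod_nodeBound hk hvalid hnd hp0 hp1 hG)).trans ?_
  rw [ENNReal.ofReal_prod_of_nonneg]
  · exact Finset.prod_le_prod' fun v _ =>
      nodeBound_le hST (by omega) hvalid hnd hp0 hp1 hG v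
  · intro v _
    unfold nodeBound
    have : 0 < 1 - p := by linarith
    positivity

/-- Whatever the previous schedule and the weights, the augmentation algorithm attains the fraction
`(k - 1) / (k + 1)` of the optimum with probability at least `δ`. -/
theorem delta_le_coinLaw {S : Finset G.Dart} (hS : IsMatching G S) {w : G.Dart → ℝ}
    (hw : ∀ e, 0 ≤ w e) {k : ℕ} (hk : 2 ≤ k) {p : ℝ} (hp0 : 0 < p) (hp1 : p < 1)
    (hG : 1 ≤ G.maxDegree) : ENNReal.ofReal (delta G p k) ≤ coinLaw G p k
      {coins | ((k : ℝ) - 1) / (k + 1) * optSum w ≤ weightSum w (augment k coins S w)} := by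
  obtain ⟨T, plan, hST, h1, h2, h3⟩ := exists_nearOptimal_plan hS hw (by omega : 1 ≤ k)
  exact (delta_le_coinLaw_complies hST hk h1 h2 hp0 hp1 hG).trans (measure_mono h3)

end Compliance

/-! ### Measurability of the scheme -/

section Measurability

variable {V : Type*} [Fintype V] [DecidableEq V] {G : SimpleGraph V} [DecidableRel G.Adj]

/-- A record with another gain. -/
def Record.setGain (r : Record G) (g : ℝ) : Record G := { r with gain := g }

/-- A state whose record, if any, has another gain. -/
def NodeState.setGain (g : ℝ) : NodeState G → NodeState G
  | .null => .null
  | .active r via => .active (r.setGain g) via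
  | .used => .used
  | .done r => .done (r.setGain g)

/-- An intent whose records, if any, have another gain. The record that is kept and the record that
is sent always have the same gain. -/
def Intent.setGain (g : ℝ) : Intent G → Intent G
  | .idle => .idle
  | .halt own => .halt (own.setGain g)
  | .send own msg l => .send (own.setGain g) (msg.setGain g) l

theorem Intent.target_setGain (u : V) (a : Intent G) (g : ℝ) :
    (a.setGain g).target u = a.target u := by
  cases a <;> rfl

theorem NodeState.setGain_eq_null {s : NodeState G} {g : ℝ} : s.setGain g = .null ↔ s = .null := by
  cases s <;> simp [NodeState.setGain]

/-- The course of an exchange does not depend on the gains. -/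
theorem exists_exchange_setGain {A : Type*} [MeasurableSpace A] (st : V → NodeState G)
    (I : V → Intent G) {g g' : V → A → ℝ} (hg : ∀ v, Measurable (g v))
    (hg' : ∀ v, Measurable (g' v)) : ∃ f : V → A → ℝ, (∀ v, Measurable (f v)) ∧ ∀ a v,
      exchange (fun v => (st v).setGain (g v a)) (fun v => (I v).setGain (g' v a)) v =
        (exchange st I v).setGain (f v a) := by
  classical
  have hcall : ∀ a n, callers (fun v => (I v).setGain (g' v a)) n = callers I n := by
    intro a n
    simp only [callers, Intent.target_setGain]
  have hacc : ∀ a n, Accepts (fun v => (st v).setGain (g v a))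
      (fun v => (I v).setGain (g' v a)) n ↔ Accepts st I n := by
    intro a n
    simp only [Accepts, hcall, NodeState.setGain_eq_null]
  suffices h : ∀ v, ∃ f : A → ℝ, Measurable f ∧ ∀ a,
      exchange (fun v => (st v).setGain (g v a)) (fun v => (I v).setGain (g' v a)) v =
        (exchange st I v).setGain (f a) by
    choose f h1 h2 using h
    exact ⟨f, h1, fun a v => h2 v a⟩
  intro v
  unfold exchange
  simp only [hacc, hcall]
  cases hI : I v with
  | halt own => exact ⟨g' v, hg' v, fun a => rfl⟩
  | send own msg l =>
    refine ⟨g' v, hg' v, fun a => ?_⟩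
    simp only [Intent.setGain]
    split_ifs <;> rfl
  | idle =>
    simp only [Intent.setGain]
    by_cases h : Accepts st I v
    · simp only [if_pos h]
      cases hc : (callers I v).toList with
      | nil => exact ⟨g v, hg v, fun a => rfl⟩
      | cons u l =>
        simp only
        cases hu : I u with
        | send own msg l => exact ⟨g' u, hg' u, fun a => rfl⟩
        | halt own => exact ⟨g v, hg v, fun a => rfl⟩
        | idle => exact ⟨g v, hg v, fun a => rfl⟩
    · simp only [if_neg h]
      exact ⟨g v, hg v, fun a => rfl⟩

theorem exists_seedIntent_setGain (coins : Coins G) (S : Finset G.Dart) (v : V) :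
    ∃ (I : Intent G) (f : (G.Dart → ℝ) → ℝ), Measurable f ∧
      ∀ w, seedIntent coins S w v = I.setGain (f w) := by
  unfold seedIntent
  by_cases h : (coins v).1 = true
  · simp only [if_pos h]
    cases hm : scheduledLink S v with
    | some m =>
      exact ⟨.send ⟨v, [m], 0, 0, (coins v).2.1, false⟩ ⟨v, [m], 0, 0, (coins v).2.1, true⟩ m,
        fun w => -w m, (measurable_pi_apply m).neg, fun w => rfl⟩
    | none =>
      by_cases hne : (linksAt G v).Nonempty
      · simp only [dif_pos hne]
        exact ⟨.send ⟨v, [], 0, 0, (coins v).2.1, false⟩ ⟨v, [], 0, 0, (coins v).2.1, false⟩ _,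
          fun _ => 0, measurable_const, fun w => rfl⟩
      · simp only [dif_neg hne]
        exact ⟨.halt ⟨v, [], 0, 0, (coins v).2.1, false⟩, fun _ => 0, measurable_const,
          fun w => rfl⟩
  · simp only [if_neg h]
    exact ⟨.idle, fun _ => 0, measurable_const, fun w => rfl⟩

theorem exists_extendIntent_setGain (coins : Coins G) (S : Finset G.Dart) (v : V)
    (s : NodeState G) {g : (G.Dart → ℝ) → ℝ} (hg : Measurable g) :
    ∃ (I : Intent G) (f : (G.Dart → ℝ) → ℝ), Measurable f ∧
      ∀ w, extendIntent coins S w v (s.setGain (g w)) = I.setGain (f w) := by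
  cases s with
  | null => exact ⟨.idle, fun _ => 0, measurable_const, fun w => rfl⟩
  | used => exact ⟨.idle, fun _ => 0, measurable_const, fun w => rfl⟩
  | done r => exact ⟨.idle, fun _ => 0, measurable_const, fun w => rfl⟩
  | active r e =>
    simp only [NodeState.setGain, extendIntent, Record.setGain]
    by_cases halt : r.alt = true
    · simp only [if_pos halt]
      by_cases h : (linksAt G v \ r.links.toFinset).Nonempty ∧ r.size < r.maxSize
      · simp only [dif_pos h]
        exact ⟨.send r { r with alt := false }
          ((coins v).2.2 ⟨linksAt G v \ r.links.toFinset, h.1⟩).1, g, hg, fun w => rfl⟩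
      · simp only [dif_neg h]
        exact ⟨.halt r, g, hg, fun w => rfl⟩
    · simp only [if_neg halt]
      cases hm : scheduledLink S v with
      | some m =>
        exact ⟨.send ⟨r.seed, r.links ++ [e] ++ [m], 0, r.size + 1, r.maxSize, r.alt⟩
          ⟨r.seed, r.links ++ [e] ++ [m], 0, r.size + 1, r.maxSize, true⟩ m,
          fun w => g w + w e - w m,
          (hg.add (measurable_pi_apply e)).sub (measurable_pi_apply m), fun w => rfl⟩
      | none =>
        exact ⟨.halt ⟨r.seed, r.links ++ [e], 0, r.size + 1, r.maxSize, r.alt⟩,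
          fun w => g w + w e, hg.add (measurable_pi_apply e), fun w => rfl⟩

/-- For given random choices, the course of the algorithm does not depend on the weights, and the
gains are measurable functions of the weights. -/
theorem exists_afterAugmenting_setGain (k : ℕ) (coins : Coins G) (S : Finset G.Dart) :
    ∃ (st : V → NodeState G) (g : V → (G.Dart → ℝ) → ℝ), (∀ v, Measurable (g v)) ∧
      ∀ w, afterAugmenting k coins S w = fun v => (st v).setGain (g v w) := by
  unfold afterAugmenting
  induction 2 * k with
  | zero =>
    choose I f hf hI using fun v => exists_seedIntent_setGain coins S v
    obtain ⟨f', hf', h⟩ := exists_exchange_setGain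
      (fun v => if (coins v).1 = true then NodeState.used else NodeState.null) I
      (fun _ => measurable_const (a := (0 : ℝ))) hf
    refine ⟨exchange (fun v => if (coins v).1 = true then NodeState.used else NodeState.null) I,
      f', hf', fun w => funext fun v => ?_⟩
    rw [← h w v, Function.iterate_zero, id, afterInit]
    congr 1
    · funext v
      split_ifs <;> rfl
    · funext v
      exact hI v w
  | succ n ih =>
    obtain ⟨st, g, hg, hst⟩ := ih
    choose I f hf hI using fun v => exists_extendIntent_setGain coins S v (st v) (hg v)
    obtain ⟨f', hf', h⟩ := exists_exchange_setGain st I hg hf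
    refine ⟨exchange st I, f', hf', fun w => funext fun v => ?_⟩
    rw [← h w v, Function.iterate_succ_apply', hst w, miniSlot]
    simp only [hI]

theorem exists_closeCycle_setGain (S : Finset G.Dart) (v : V) (r : Record G)
    {g : (G.Dart → ℝ) → ℝ} (hg : Measurable g) : ∃ (r' : Record G) (f : (G.Dart → ℝ) → ℝ),
      Measurable f ∧ ∀ w, closeCycle S w v (r.setGain (g w)) = r'.setGain (f w) := by
  classical
  by_cases h : G.Adj v r.seed
  · by_cases h' : r.alt = true ∧ (∃ m ∈ S, r.links.head? = some m) ∧ r.size < r.maxSize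
    · refine ⟨{ r with links := r.links ++ [⟨(v, r.seed), h⟩] },
        fun w => g w + w ⟨(v, r.seed), h⟩, hg.add (measurable_pi_apply _), fun w => ?_⟩
      exact (dif_pos h).trans (if_pos h')
    · refine ⟨r, g, hg, fun w => ?_⟩
      exact (dif_pos h).trans (if_neg h')
  · refine ⟨r, g, hg, fun w => ?_⟩
    exact dif_neg h

instance : MeasurableSpace (Finset G.Dart) := ⊤

instance : DiscreteMeasurableSpace (Finset G.Dart) := ⟨fun _ => trivial⟩

theorem measurable_switchedLinks (k : ℕ) (coins : Coins G) (S : Finset G.Dart) (v : V) :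
    Measurable fun w => switchedLinks k coins S w v := by
  classical
  obtain ⟨st, g, hg, hst⟩ := exists_afterAugmenting_setGain k coins S
  have key : ∀ r : Record G, Measurable fun w => if 0 < (closeCycle S w v (r.setGain (g v w))).gain
      then (closeCycle S w v (r.setGain (g v w))).links.toFinset else ∅ := by
    intro r
    obtain ⟨r', f, hf, h⟩ := exists_closeCycle_setGain S v r (hg v)
    simp only [h]
    change Measurable fun w => if 0 < f w then r'.links.toFinset else ∅
    exact Measurable.ite (measurableSet_lt measurable_const hf) measurable_const measurable_const
  unfold switchedLinks finalRecord
  simp only [hst]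
  cases st v with
  | null => exact measurable_const
  | used => exact measurable_const
  | active r via => exact key r
  | done r => exact key r

theorem measurable_augment_weight (k : ℕ) (coins : Coins G) (S : Finset G.Dart) :
    Measurable fun w => augment k coins S w := by
  have h1 : Measurable fun w => switchedLinks k coins S w :=
    measurable_pi_iff.2 (measurable_switchedLinks k coins S)
  have h2 : Measurable fun A : V → Finset G.Dart =>
      (S \ Finset.univ.biUnion A) ∪ (Finset.univ.biUnion A \ S) := measurable_of_finite _
  exact h2.comp h1

theorem measurable_augment (k : ℕ) :
    Measurable fun z : (Coins G × Finset G.Dart) × (G.Dart → ℝ) => augment k z.1.1 z.1.2 z.2 :=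
  measurable_from_prod_countable_right fun z => measurable_augment_weight k z.1 z.2

instance : MeasurableSpace (History G) :=
  MeasurableSpace.comap (fun h => (h.sched, h.plays, h.total)) inferInstance

theorem measurable_history : Measurable fun h : History G => (h.sched, h.plays, h.total) :=
  comap_measurable _

theorem measurable_sched : Measurable (History.sched : History G → _) :=
  measurable_history.fst

theorem measurable_plays (i : G.Dart) : Measurable fun h : History G => h.plays i :=
  (measurable_pi_apply i).comp measurable_history.snd.fst

theorem measurable_total (i : G.Dart) : Measurable fun h : History G => h.total i :=
  (measurable_pi_apply i).comp measurable_history.snd.snd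

theorem measurable_history_mk {A : Type*} [MeasurableSpace A] {S : A → Finset G.Dart}
    {n : A → G.Dart → ℕ} {s : A → G.Dart → ℝ} (hS : Measurable S) (hn : ∀ i, Measurable (n · i))
    (hs : ∀ i, Measurable (s · i)) : Measurable fun a => (⟨S a, n a, s a⟩ : History G) :=
  measurable_comap_iff.2
    (hS.prodMk ((measurable_pi_iff.2 hn).prodMk (measurable_pi_iff.2 hs)))

theorem measurable_ucbIndex (q : G.Dart → ℝ) (t : ℕ) : Measurable (ucbIndex (G := G) q t) := by
  refine measurable_pi_iff.2 fun i => ?_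
  unfold ucbIndex
  have h1 : Measurable fun h : History G => (h.plays i : ℝ) :=
    measurable_from_nat.comp (measurable_plays i)
  exact (((measurable_total i).div h1).const_mul _).add (measurable_const.div h1).sqrt

/-- The schedule of slot `t + 1`, given the history and the random choices of this slot. -/
def nextSched (k : ℕ) (q : G.Dart → ℝ) (first : Fin (Fintype.card G.Dart) → Finset G.Dart) (t : ℕ)
    (h : History G) (c : Coins G) : Finset G.Dart :=
  if ht : t < Fintype.card G.Dart then first ⟨t, ht⟩
  else augment k c h.sched (ucbIndex q (t + 1) h)

/-- The history after a slot with schedule `S` and rates `x`. -/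
def History.record (h : History G) (S : Finset G.Dart) (x : G.Dart → ℝ) : History G :=
  ⟨S, fun i => h.plays i + if i ∈ S then 1 else 0, fun i => h.total i + if i ∈ S then x i else 0⟩

theorem run_succ (k : ℕ) (q : G.Dart → ℝ) (first : Fin (Fintype.card G.Dart) → Finset G.Dart)
    (x : ℕ → G.Dart → ℝ) (c : ℕ → Coins G) (t : ℕ) : run k q first x c (t + 1) =
      (run k q first x c t).record (nextSched k q first t (run k q first x c t) (c (t + 1)))
        (x (t + 1)) := rfl

theorem measurable_nextSched (k : ℕ) (q : G.Dart → ℝ)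
    (first : Fin (Fintype.card G.Dart) → Finset G.Dart) (t : ℕ) :
    Measurable fun z : History G × Coins G => nextSched k q first t z.1 z.2 := by
  unfold nextSched
  by_cases ht : t < Fintype.card G.Dart
  · simp only [dif_pos ht]
    exact measurable_const
  · simp only [dif_neg ht]
    have h1 : Measurable fun z : History G × Coins G => ((z.2, z.1.sched), ucbIndex q (t + 1) z.1) :=
      (measurable_snd.prodMk (measurable_sched.comp measurable_fst)).prodMk
        ((measurable_ucbIndex q (t + 1)).comp measurable_fst)
    have h2 := (measurable_augment (G := G) k).comp h1
    exact h2

theorem measurable_record : Measurable fun z : (History G × Finset G.Dart) × (G.Dart → ℝ) =>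
    z.1.1.record z.1.2 z.2 := by
  have hS : Measurable fun z : (History G × Finset G.Dart) × (G.Dart → ℝ) => z.1.2 :=
    measurable_fst.snd
  have hi : ∀ i : G.Dart, MeasurableSet
      {z : (History G × Finset G.Dart) × (G.Dart → ℝ) | i ∈ z.1.2} := fun i =>
    hS (MeasurableSet.of_discrete (s := {S : Finset G.Dart | i ∈ S}))
  refine measurable_history_mk hS (fun i => ?_) fun i => ?_
  · exact ((measurable_plays i).comp measurable_fst.fst).add
      (Measurable.ite (hi i) measurable_const measurable_const)
  · exact ((measurable_total i).comp measurable_fst.fst).add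
      (Measurable.ite (hi i) ((measurable_pi_apply i).comp measurable_snd) measurable_const)

theorem measurable_run {A : Type*} [MeasurableSpace A] (k : ℕ) (q : G.Dart → ℝ)
    (first : Fin (Fintype.card G.Dart) → Finset G.Dart) {x : A → ℕ → G.Dart → ℝ}
    {c : A → ℕ → Coins G} (hx : ∀ t, Measurable (x · t)) (hc : ∀ t, Measurable (c · t)) (t : ℕ) :
    Measurable fun a => run k q first (x a) (c a) t := by
  induction t with
  | zero => exact measurable_const
  | succ t ih =>
    simp only [run_succ]
    exact measurable_record.comp
      ((ih.prodMk ((measurable_nextSched k q first t).comp (ih.prodMk (hc (t + 1))))).prodMk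
        (hx (t + 1)))

theorem run_congr (k : ℕ) (q : G.Dart → ℝ) (first : Fin (Fintype.card G.Dart) → Finset G.Dart)
    {x x' : ℕ → G.Dart → ℝ} {c c' : ℕ → Coins G} {t : ℕ} (hx : ∀ s ≤ t, x s = x' s)
    (hc : ∀ s ≤ t, c s = c' s) : run k q first x c t = run k q first x' c' t := by
  induction t with
  | zero => rfl
  | succ t ih =>
    rw [run_succ, run_succ, ih (fun s hs => hx s (by omega)) (fun s hs => hc s (by omega)),
      hx _ le_rfl, hc _ le_rfl]

/-- The history is independent of the rates and the random choices of the next slot. -/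
theorem indepFun_run {Ω : Type*} [MeasurableSpace Ω] {P : Measure Ω} [IsProbabilityMeasure P]
    (k : ℕ) (q : G.Dart → ℝ) (first : Fin (Fintype.card G.Dart) → Finset G.Dart)
    {X : ℕ → Ω → G.Dart → ℝ} {c : ℕ → Ω → Coins G} (hX : ∀ t, Measurable (X t))
    (hc : ∀ t, Measurable (c t)) (hindep : iIndepFun (fun t ω => (X t ω, c t ω)) P) (t : ℕ) :
    IndepFun (fun ω => run k q first (fun s => X s ω) (fun s => c s ω) t)
      (fun ω => (X (t + 1) ω, c (t + 1) ω)) P := by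
  classical
  have h := hindep.indepFun_finset (Finset.range (t + 1)) {t + 1} (by simp)
    fun s => (hX s).prodMk (hc s)
  let ext : (Finset.range (t + 1) → (G.Dart → ℝ) × Coins G) → ℕ → (G.Dart → ℝ) × Coins G :=
    fun z s => z (if hs : s ∈ Finset.range (t + 1) then ⟨s, hs⟩ else ⟨0, by simp⟩)
  have hext : ∀ s, Measurable fun z => ext z s := fun s => measurable_pi_apply _
  have h1 := h.comp (measurable_run k q first (x := fun z s => (ext z s).1)
    (c := fun z s => (ext z s).2) (fun s => (hext s).fst) (fun s => (hext s).snd) t)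
    (measurable_pi_apply (⟨t + 1, by simp⟩ : ({t + 1} : Finset ℕ)))
  refine (h1.congr ?_ ?_)
  · refine Filter.Eventually.of_forall fun ω => ?_
    simp only [Function.comp_apply]
    refine run_congr k q first (fun s hs => ?_) fun s hs => ?_
    all_goals
      have : s ∈ Finset.range (t + 1) := Finset.mem_range.2 (by omega)
      simp only [ext, dif_pos this]
  · exact Filter.Eventually.of_forall fun ω => rfl

end Measurability

/-! ### Concentration of the observed rates -/

section Concentration

variable {V : Type*} [Fintype V] [DecidableEq V] {G : SimpleGraph V} [DecidableRel G.Adj]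
variable {Ω : Type*} [MeasurableSpace Ω]

/-- In every slot, the rates have the laws `D` and the random choices of the nodes have the law
`coinLaw`, all of them independent; the slots are independent. -/
structure IsDriving (P : Measure Ω) (D : G.Dart → Measure ℝ) (p : ℝ) (k : ℕ)
    (X : ℕ → Ω → G.Dart → ℝ) (c : ℕ → Ω → Coins G) : Prop where
  rates : ∀ t, Measurable (X t)
  coins : ∀ t, Measurable (c t)
  law : ∀ t, P.map (fun ω => (X t ω, c t ω)) = (Measure.pi D).prod (coinLaw G p k)
  indep : iIndepFun (fun t ω => (X t ω, c t ω)) P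

/-- The history after slot `t`. -/
def hist (k : ℕ) (q : G.Dart → ℝ) (first : Fin (Fintype.card G.Dart) → Finset G.Dart)
    (X : ℕ → Ω → G.Dart → ℝ) (c : ℕ → Ω → Coins G) (t : ℕ) (ω : Ω) : History G :=
  run k q first (fun s => X s ω) (fun s => c s ω) t

variable {P : Measure Ω} [IsProbabilityMeasure P] {D : G.Dart → Measure ℝ}
  [∀ i, IsProbabilityMeasure (D i)] {p : ℝ} {k : ℕ} {X : ℕ → Ω → G.Dart → ℝ}
  {c : ℕ → Ω → Coins G} {q : G.Dart → ℝ} {first : Fin (Fintype.card G.Dart) → Finset G.Dart}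

theorem hist_succ (t : ℕ) (ω : Ω) : hist k q first X c (t + 1) ω =
    (hist k q first X c t ω).record (nextSched k q first t (hist k q first X c t ω) (c (t + 1) ω))
      (X (t + 1) ω) := rfl

theorem IsDriving.measurable_hist (h : IsDriving P D p k X c) (t : ℕ) :
    Measurable (hist k q first X c t) :=
  measurable_run (x := fun ω s => X s ω) (c := fun ω s => c s ω) k q first h.rates h.coins t

/-- In the expectation of a function of the history and of the rates and random choices of the next
slot, the latter can be integrated out first. -/
theorem IsDriving.lintegral_next (h : IsDriving P D p k X c) (t : ℕ)
    {F : History G → (G.Dart → ℝ) → Coins G → ENNReal}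
    (hF : Measurable fun z : History G × ((G.Dart → ℝ) × Coins G) => F z.1 z.2.1 z.2.2)
    [IsProbabilityMeasure (coinLaw G p k)] :
    ∫⁻ ω, F (hist k q first X c t ω) (X (t + 1) ω) (c (t + 1) ω) ∂P =
      ∫⁻ ω, ∫⁻ a, ∫⁻ x, F (hist k q first X c t ω) x a ∂(Measure.pi D) ∂(coinLaw G p k) ∂P := by
  have hH := h.measurable_hist (q := q) (first := first) t
  have hZ : Measurable fun ω => (X (t + 1) ω, c (t + 1) ω) :=
    (h.rates _).prodMk (h.coins _)
  have hind := indepFun_run k q first h.rates h.coins h.indep t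
  have hmap := (indepFun_iff_map_prod_eq_prod_map_map hH.aemeasurable hZ.aemeasurable).1 hind
  rw [h.law] at hmap
  have h1 : ∫⁻ ω, F (hist k q first X c t ω) (X (t + 1) ω) (c (t + 1) ω) ∂P =
      ∫⁻ z, F z.1 z.2.1 z.2.2
        ∂(P.map fun ω => (hist k q first X c t ω, (X (t + 1) ω, c (t + 1) ω))) :=
    (lintegral_map hF (hH.prodMk hZ)).symm
  rw [h1, hmap, lintegral_prod _ hF.aemeasurable, lintegral_map hF.lintegral_prod_right' hH]
  refine lintegral_congr fun ω => ?_
  exact lintegral_prod_symm' _ (hF.comp (measurable_const.prodMk measurable_id))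

/-- The exponential weight whose expectation is controlled by Hoeffding's lemma. -/
def expWeight (m s : ℝ) (i : G.Dart) (h : History G) : ℝ :=
  Real.exp (s * (h.total i - h.plays i * m) - h.plays i * (s ^ 2 / 8))

theorem measurable_expWeight (m s : ℝ) (i : G.Dart) : Measurable (expWeight m s i) := by
  have h1 : Measurable fun h : History G => (h.plays i : ℝ) :=
    measurable_from_nat.comp (measurable_plays i)
  exact ((((measurable_total i).sub (h1.mul_const m)).const_mul s).sub
    (h1.mul_const (s ^ 2 / 8))).exp

theorem expWeight_record (m s : ℝ) (i : G.Dart) (h : History G) (S : Finset G.Dart)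
    (x : G.Dart → ℝ) : expWeight m s i (h.record S x) =
      expWeight m s i h * if i ∈ S then Real.exp (s * (x i - m) - s ^ 2 / 8) else 1 := by
  unfold expWeight History.record
  by_cases hi : i ∈ S
  · simp only [if_pos hi]
    rw [← Real.exp_add]
    congr 1
    push_cast
    ring
  · simp [hi]

theorem lintegral_exp_le_one {ν : Measure ℝ} [IsProbabilityMeasure ν]
    (hν : ∀ᵐ x ∂ν, x ∈ Set.Icc (0 : ℝ) 1) (s : ℝ) :
    ∫⁻ x, ENNReal.ofReal (Real.exp (s * (x - ∫ y, y ∂ν) - s ^ 2 / 8)) ∂ν ≤ 1 := by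
  have h := hasSubgaussianMGF_of_mem_Icc (X := fun x : ℝ => x) (μ := ν) aemeasurable_id hν
  have h1 := h.mgf_le s
  have h2 := h.integrable_exp_mul s
  have h3 : ∀ x : ℝ, Real.exp (s * (x - ∫ y, y ∂ν) - s ^ 2 / 8) =
      Real.exp (s * (x - ∫ y, y ∂ν)) * Real.exp (-(s ^ 2 / 8)) := fun x => by
    rw [← Real.exp_add, sub_eq_add_neg]
  simp_rw [h3]
  rw [← ofReal_integral_eq_lintegral_ofReal (h2.mul_const _)
    (Filter.Eventually.of_forall fun x => by positivity), integral_mul_const]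
  refine ENNReal.ofReal_le_one.2 ?_
  calc _ ≤ Real.exp ((((‖(1 : ℝ) - 0‖₊ / 2) ^ 2 : NNReal) : ℝ) * s ^ 2 / 2) *
        Real.exp (-(s ^ 2 / 8)) := by
        gcongr
        exact h1
    _ = 1 := by
      rw [← Real.exp_add, Real.exp_eq_one_iff]
      simp
      ring

theorem IsDriving.lintegral_expWeight_le (h : IsDriving P D p k X c)
    [IsProbabilityMeasure (coinLaw G p k)] (i : G.Dart)
    (hD : ∀ᵐ x ∂(D i), x ∈ Set.Icc (0 : ℝ) 1) (s : ℝ) (t : ℕ) :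
    ∫⁻ ω, ENNReal.ofReal (expWeight (∫ y, y ∂(D i)) s i (hist k q first X c t ω)) ∂P ≤ 1 := by
  induction t with
  | zero =>
    have : ∀ ω, expWeight (∫ y, y ∂(D i)) s i (hist k q first X c 0 ω) = 1 := fun ω => by
      simp [expWeight, hist, AkUCB.run]
    simp [this]
  | succ t ih =>
    have hm : Measurable fun z : History G × ((G.Dart → ℝ) × Coins G) =>
        ENNReal.ofReal (expWeight (∫ y, y ∂(D i)) s i
          (z.1.record (nextSched k q first t z.1 z.2.2) z.2.1)) := by
      have h1 : Measurable fun z : History G × ((G.Dart → ℝ) × Coins G) =>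
          ((z.1, nextSched k q first t z.1 z.2.2), z.2.1) :=
        (measurable_fst.prodMk ((measurable_nextSched k q first t).comp
          (measurable_fst.prodMk measurable_snd.snd))).prodMk measurable_snd.fst
      have h2 := (measurable_expWeight (∫ y, y ∂(D i)) s i).comp
        ((measurable_record (G := G)).comp h1)
      exact h2.ennreal_ofReal
    refine (h.lintegral_next (q := q) (first := first) t
      (F := fun H x a => ENNReal.ofReal (expWeight (∫ y, y ∂(D i)) s i
        (H.record (nextSched k q first t H a) x))) hm).le.trans
      ((lintegral_mono fun ω => ?_).trans ih)
    refine le_trans (lintegral_mono (g := fun _ => ENNReal.ofReal (expWeight (∫ y, y ∂(D i)) s i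
      (hist k q first X c t ω))) fun a => ?_) (by simp)
    simp only [expWeight_record]
    have h0 : 0 ≤ expWeight (∫ y, y ∂(D i)) s i (hist k q first X c t ω) :=
      (Real.exp_pos _).le
    by_cases hi : i ∈ nextSched k q first t (hist k q first X c t ω) a
    · simp only [if_pos hi, ENNReal.ofReal_mul h0]
      have hmeas : Measurable fun y : ℝ =>
          ENNReal.ofReal (Real.exp (s * (y - ∫ y, y ∂(D i)) - s ^ 2 / 8)) := by fun_prop
      have hmeas' : Measurable fun x : G.Dart → ℝ =>
          ENNReal.ofReal (Real.exp (s * (x i - ∫ y, y ∂(D i)) - s ^ 2 / 8)) := by fun_prop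
      rw [lintegral_const_mul _ hmeas']
      refine mul_le_of_le_one_right' ?_
      have := (measurePreserving_eval D i).lintegral_comp hmeas
      exact le_of_eq_of_le this (lintegral_exp_le_one hD s)
    · simp [hi]

/-- The mean of `n` observed rates is off by more than `√(a / n)` with small probability. -/
theorem IsDriving.measure_deviation_le (h : IsDriving P D p k X c)
    [IsProbabilityMeasure (coinLaw G p k)] (i : G.Dart)
    (hD : ∀ᵐ x ∂(D i), x ∈ Set.Icc (0 : ℝ) 1) (t : ℕ) {n : ℕ} (hn : 1 ≤ n) {a : ℝ} (ha : 0 ≤ a) :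
    P {ω | (hist k q first X c t ω).plays i = n ∧
      Real.sqrt (a * n) < |(hist k q first X c t ω).total i - n * ∫ y, y ∂(D i)|} ≤
      2 * ENNReal.ofReal (Real.exp (-(2 * a))) := by
  have hn' : (0 : ℝ) < n := by exact_mod_cast hn
  have key : ∀ s : ℝ, ENNReal.ofReal (Real.exp (2 * a)) *
      P {ω | ENNReal.ofReal (Real.exp (2 * a)) ≤ ENNReal.ofReal (expWeight (∫ y, y ∂(D i)) s i
        (hist k q first X c t ω))} ≤ 1 := fun s =>
    (mul_meas_ge_le_lintegral (((measurable_expWeight (∫ y, y ∂(D i)) s i).comp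
      (h.measurable_hist t)).ennreal_ofReal) _).trans (h.lintegral_expWeight_le i hD s t)
  have key' : ∀ s : ℝ, P {ω | Real.exp (2 * a) ≤ expWeight (∫ y, y ∂(D i)) s i
        (hist k q first X c t ω)} ≤ ENNReal.ofReal (Real.exp (-(2 * a))) := by
    intro s
    rw [Real.exp_neg, ENNReal.ofReal_inv_of_pos (Real.exp_pos _)]
    refine ENNReal.le_inv_iff_mul_le.2 (le_trans ?_ (key s))
    rw [mul_comm]
    gcongr with ω
    exact ENNReal.ofReal_le_ofReal
  have hsq : Real.sqrt (a / n) * Real.sqrt (a * n) = a := by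
    rw [← Real.sqrt_mul (by positivity), show a / n * (a * n) = a * a by field_simp,
      Real.sqrt_mul_self ha]
  have hsq2 : Real.sqrt (a / n) ^ 2 = a / n := Real.sq_sqrt (by positivity)
  have hs0 := Real.sqrt_nonneg (a / n)
  refine (measure_mono ?_).trans ((measure_union_le _ _).trans
    (le_of_le_of_eq (add_le_add (key' (4 * Real.sqrt (a / n))) (key' (-(4 * Real.sqrt (a / n)))))
      (two_mul _).symm))
  rintro ω ⟨h1, h2⟩
  have hcalc : (n : ℝ) * ((4 * Real.sqrt (a / n)) ^ 2 / 8) = 2 * a := by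
    rw [mul_pow, hsq2]
    field_simp
    ring
  rcases lt_abs.1 h2 with h3 | h3
  · left
    change _ ≤ Real.exp _
    rw [Real.exp_le_exp, h1, hcalc]
    nlinarith [mul_le_mul_of_nonneg_left h3.le hs0]
  · right
    change _ ≤ Real.exp _
    rw [Real.exp_le_exp, h1, neg_sq, hcalc]
    nlinarith [mul_le_mul_of_nonneg_left h3.le hs0]

end Concentration

/-! ### Mean weights and their estimates -/

section Estimates

variable {V : Type*} [Fintype V] [DecidableEq V] {G : SimpleGraph V} [DecidableRel G.Adj]

theorem queueFactor_mem_Icc {q : G.Dart → ℝ} (hq : ∀ i, 0 ≤ q i) (i : G.Dart) :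
    queueFactor q i ∈ Set.Icc (0 : ℝ) 1 := by
  have h : q i ≤ ⨆ j, q j := le_ciSup (Set.finite_range q).bddAbove i
  unfold queueFactor
  split_ifs with h0
  · simp
  · exact ⟨div_nonneg (hq i) ((hq i).trans h), div_le_one_of_le₀ h ((hq i).trans h)⟩

theorem meanWeight_nonneg {q : G.Dart → ℝ} (hq : ∀ i, 0 ≤ q i) {D : G.Dart → Measure ℝ}
    (hD : ∀ i, ∀ᵐ x ∂(D i), x ∈ Set.Icc (0 : ℝ) 1) (i : G.Dart) : 0 ≤ meanWeight q D i := by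
  refine mul_nonneg (queueFactor_mem_Icc hq i).1 (integral_nonneg_of_ae ?_)
  filter_upwards [hD i] with x hx using hx.1

/-- In slot `t`, the mean observed rate of some link is outside the confidence interval. -/
def Misestimated (D : G.Dart → Measure ℝ) (t : ℕ) (h : History G) : Prop :=
  ∃ i, 1 ≤ h.plays i ∧ Real.sqrt (((Fintype.card G.Dart : ℝ) + 1) * Real.log t * h.plays i) <
    |h.total i - h.plays i * ∫ y, y ∂(D i)|

/-- Without misestimation, the index of a link is between its mean weight and its mean weight plus
twice the confidence radius. -/
theorem ucbIndex_mem_Icc {q : G.Dart → ℝ} (hq : ∀ i, 0 ≤ q i) {D : G.Dart → Measure ℝ} {t : ℕ}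
    {h : History G} (hE : ¬ Misestimated D t h) {i : G.Dart} (hi : 1 ≤ h.plays i) :
    ucbIndex q t h i ∈ Set.Icc (meanWeight q D i) (meanWeight q D i +
      2 * Real.sqrt (((Fintype.card G.Dart : ℝ) + 1) * Real.log t / h.plays i)) := by
  obtain ⟨hκ0, hκ1⟩ := queueFactor_mem_Icc hq i
  have hN : (0 : ℝ) < h.plays i := by exact_mod_cast hi
  set a : ℝ := ((Fintype.card G.Dart : ℝ) + 1) * Real.log t with ha
  set m := ∫ y, y ∂(D i) with hm
  have ha0 : 0 ≤ a := mul_nonneg (by positivity) (Real.log_natCast_nonneg t)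
  have h1 : |h.total i - h.plays i * m| ≤ Real.sqrt (a * h.plays i) := by
    by_contra hc
    exact hE ⟨i, hi, not_le.1 hc⟩
  have h2 : |h.total i / h.plays i - m| ≤ Real.sqrt (a / h.plays i) := by
    have : h.total i / h.plays i - m = (h.total i - h.plays i * m) / h.plays i := by
      field_simp
    rw [this, abs_div, abs_of_pos hN, div_le_iff₀ hN]
    refine h1.trans (le_of_eq ?_)
    rw [← Real.sqrt_sq hN.le, ← Real.sqrt_mul (by positivity), Real.sqrt_sq hN.le]
    congr 1
    field_simp
  have h3 : |queueFactor q i * (h.total i / h.plays i) - queueFactor q i * m| ≤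
      Real.sqrt (a / h.plays i) := by
    rw [← mul_sub, abs_mul, abs_of_nonneg hκ0]
    exact (mul_le_of_le_one_left (abs_nonneg _) hκ1).trans h2
  obtain ⟨h4, h5⟩ := abs_le.1 h3
  unfold ucbIndex meanWeight
  constructor <;> linarith

theorem optSum_mono {w w' : G.Dart → ℝ} (h : ∀ i, w i ≤ w' i) : optSum w ≤ optSum w' :=
  Finset.sup'_mono_fun fun _ _ => Finset.sum_le_sum fun i _ => h i

theorem IsMatching.card_lt {S : Finset G.Dart} (hS : IsMatching G S)
    (hG : 1 ≤ Fintype.card G.Dart) : S.card < Fintype.card G.Dart := by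
  rcases S.eq_empty_or_nonempty with rfl | ⟨i, hi⟩
  · rw [Finset.card_empty]
    omega
  · rw [← Finset.card_univ]
    refine Finset.card_lt_card (Finset.ssubset_univ_iff.2 fun hu => ?_)
    have h1 : i.symm ∈ S := by rw [hu]; exact Finset.mem_univ _
    exact i.symm_ne (hS.eq_of_mem h1 hi (v := i.fst) (mem_linksAt.2 (Or.inr rfl))
      (mem_linksAt.2 (Or.inl rfl)))

theorem mem_nonNearOptimal {α : ℝ} {w : G.Dart → ℝ} {S : Finset G.Dart} :
    S ∈ nonNearOptimal α w ↔ IsMatching G S ∧ weightSum w S < α * optSum w := by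
  simp [nonNearOptimal, matchings]

theorem gapMin_pos {α : ℝ} {w : G.Dart → ℝ} (h : (nonNearOptimal α w).Nonempty) :
    0 < gapMin α w h := by
  unfold gapMin
  rw [sub_pos, Finset.sup'_lt_iff]
  exact fun S hS => (mem_nonNearOptimal.1 hS).2

/-- If the links of a schedule `S` have been observed often enough and `S` is as good as `α r*_w`
according to the indices, then it is near-optimal. -/
theorem notMem_nonNearOptimal {q : G.Dart → ℝ} (hq : ∀ i, 0 ≤ q i) {D : G.Dart → Measure ℝ}
    {t n : ℕ} (ht : t ≤ n) (ht1 : 1 ≤ t) {α : ℝ}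
    (hgap : (nonNearOptimal α (meanWeight q D)).Nonempty) (hG : 1 ≤ Fintype.card G.Dart)
    {h : History G} (hE : ¬ Misestimated D t h) (hplays : ∀ i, 1 ≤ h.plays i)
    {S : Finset G.Dart} (hS : ∀ i ∈ S, 4 * (Fintype.card G.Dart : ℝ) ^ 2 *
      ((Fintype.card G.Dart : ℝ) + 1) * Real.log n / gapMin α (meanWeight q D) hgap ^ 2 ≤ h.plays i)
    (hle : α * optSum (meanWeight q D) ≤ weightSum (ucbIndex q t h) S) :
    S ∉ nonNearOptimal α (meanWeight q D) := by
  intro hSB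
  obtain ⟨hmatch, -⟩ := mem_nonNearOptimal.1 hSB
  set w := meanWeight q D with hw
  set Δ := gapMin α w hgap with hΔ
  have hΔ0 : 0 < Δ := gapMin_pos hgap
  have hL1 : (1 : ℝ) ≤ Fintype.card G.Dart := by exact_mod_cast hG
  set L : ℝ := (Fintype.card G.Dart : ℝ) with hL
  have hlog : Real.log t ≤ Real.log n :=
    Real.log_le_log (by exact_mod_cast ht1) (by exact_mod_cast ht)
  have hrad : ∀ i ∈ S, ucbIndex q t h i ≤ w i + Δ / L := by
    intro i hi
    have h1 := (ucbIndex_mem_Icc hq hE (hplays i)).2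
    have hN : (0 : ℝ) < h.plays i := by exact_mod_cast hplays i
    have h2 : Real.sqrt ((L + 1) * Real.log t / h.plays i) ≤ Δ / (2 * L) := by
      refine Real.sqrt_le_iff.2 ⟨by positivity, ?_⟩
      rw [div_le_iff₀ hN]
      have h3 := hS i hi
      rw [div_le_iff₀ (by positivity)] at h3
      rw [div_pow, div_mul_eq_mul_div, le_div_iff₀ (by positivity)]
      have h4 : (L + 1) * Real.log t * (2 * L) ^ 2 ≤ (L + 1) * Real.log n * (2 * L) ^ 2 := by
        gcongr
      nlinarith
    have h5 : 2 * (Δ / (2 * L)) = Δ / L := by field_simp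
    linarith
  have h1 : weightSum (ucbIndex q t h) S ≤ weightSum w S + S.card * (Δ / L) := by
    unfold weightSum
    refine (Finset.sum_le_sum hrad).trans (le_of_eq ?_)
    rw [Finset.sum_add_distrib, Finset.sum_const, nsmul_eq_mul]
  have h2 : (S.card : ℝ) * (Δ / L) < Δ := by
    have : (S.card : ℝ) < L := by
      rw [hL]
      exact_mod_cast hmatch.card_lt hG
    rw [mul_div_assoc', div_lt_iff₀ (by linarith), mul_comm]
    exact mul_lt_mul_of_pos_left this hΔ0
  have h3 : weightSum w S ≤ (nonNearOptimal α w).sup' hgap (weightSum w) :=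
    Finset.le_sup' (weightSum w) hSB
  have h4 : Δ = α * optSum w - (nonNearOptimal α w).sup' hgap (weightSum w) := rfl
  linarith

/-- If a later schedule is not near-optimal, then one of its links has been observed too rarely, or
some link is misestimated, or the previous schedule was not near-optimal either and the augmentation
algorithm has failed to attain the fraction `α` of the optimum. -/
theorem augment_mem_nonNearOptimal {q : G.Dart → ℝ} (hq : ∀ i, 0 ≤ q i) {D : G.Dart → Measure ℝ}
    (hw : ∀ i, 0 ≤ meanWeight q D i) {t n k : ℕ} (ht : t ≤ n) (ht1 : 1 ≤ t) {α : ℝ} (hα : 0 ≤ α)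
    (hgap : (nonNearOptimal α (meanWeight q D)).Nonempty) (hG : 1 ≤ Fintype.card G.Dart)
    {h : History G} (hmatch : IsMatching G h.sched) (hplays : ∀ i, 1 ≤ h.plays i) {coins : Coins G}
    (hB : augment k coins h.sched (ucbIndex q t h) ∈ nonNearOptimal α (meanWeight q D)) :
    (∃ i ∈ augment k coins h.sched (ucbIndex q t h), (h.plays i : ℝ) <
      4 * (Fintype.card G.Dart : ℝ) ^ 2 * ((Fintype.card G.Dart : ℝ) + 1) * Real.log n /
        gapMin α (meanWeight q D) hgap ^ 2) ∨ Misestimated D t h ∨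
    (h.sched ∈ nonNearOptimal α (meanWeight q D) ∧ (∀ i, 0 ≤ ucbIndex q t h i) ∧
      ¬ α * optSum (ucbIndex q t h) ≤ weightSum (ucbIndex q t h)
        (augment k coins h.sched (ucbIndex q t h))) := by
  by_contra hc
  simp only [not_or, not_and, not_exists, not_lt, not_not] at hc
  obtain ⟨h1, h2, h3⟩ := hc
  have hle : ∀ i, meanWeight q D i ≤ ucbIndex q t h i := fun i =>
    (ucbIndex_mem_Icc hq h2 (hplays i)).1
  have hpos : ∀ i, 0 ≤ ucbIndex q t h i := fun i => (hw i).trans (hle i)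
  refine notMem_nonNearOptimal hq ht ht1 hgap hG h2 hplays h1 ?_ hB
  by_cases hS : h.sched ∈ nonNearOptimal α (meanWeight q D)
  · exact (mul_le_mul_of_nonneg_left (optSum_mono hle) hα).trans (h3 hS hpos)
  · have h4 : α * optSum (meanWeight q D) ≤ weightSum (meanWeight q D) h.sched := by
      by_contra h5
      exact hS (mem_nonNearOptimal.2 ⟨hmatch, not_le.1 h5⟩)
    exact h4.trans ((Finset.sum_le_sum fun i _ => hle i).trans
      (weightSum_le_augment k coins hmatch hpos))

end Estimates

/-! ### The expected number of slots with a schedule that is not near-optimal -/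

section Regret

variable {V : Type*} [Fintype V] [DecidableEq V] {G : SimpleGraph V} [DecidableRel G.Adj]
variable {Ω : Type*} [MeasurableSpace Ω] {P : Measure Ω} [IsProbabilityMeasure P]
  {D : G.Dart → Measure ℝ} [∀ i, IsProbabilityMeasure (D i)] {p : ℝ} {k : ℕ}
  {X : ℕ → Ω → G.Dart → ℝ} {c : ℕ → Ω → Coins G} {q : G.Dart → ℝ}
  {first : Fin (Fintype.card G.Dart) → Finset G.Dart}

theorem hist_isMatching (hfirst : ∀ j, IsMatching G (first j)) (t : ℕ) (ω : Ω) :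
    IsMatching G (hist k q first X c t ω).sched := by
  induction t with
  | zero => exact isMatching_iff.2 fun v d hd => absurd hd (Finset.notMem_empty d)
  | succ t ih =>
    rw [hist_succ]
    change IsMatching G (nextSched _ _ _ _ _ _)
    unfold nextSched
    split_ifs with ht
    · exact hfirst _
    · exact augment_isMatching k _ ih _

theorem hist_succ_of_le {t : ℕ} (ht : Fintype.card G.Dart ≤ t) (ω : Ω) :
    (hist k q first X c (t + 1) ω).sched = augment k (c (t + 1) ω) (hist k q first X c t ω).sched
      (ucbIndex q (t + 1) (hist k q first X c t ω)) :=
  dif_neg (not_lt.2 ht)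

theorem plays_hist_succ (t : ℕ) (ω : Ω) (i : G.Dart) : (hist k q first X c (t + 1) ω).plays i =
    (hist k q first X c t ω).plays i +
      if i ∈ (hist k q first X c (t + 1) ω).sched then 1 else 0 := rfl

theorem plays_hist_le (t : ℕ) (ω : Ω) (i : G.Dart) : (hist k q first X c t ω).plays i ≤ t := by
  induction t with
  | zero => exact le_rfl
  | succ t ih =>
    rw [plays_hist_succ]
    split_ifs <;> omega

theorem plays_hist_mono (ω : Ω) (i : G.Dart) :
    Monotone fun t => (hist k q first X c t ω).plays i :=
  monotone_nat_of_le_succ fun t => by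
    rw [plays_hist_succ]
    omega

/-- Every link has been observed in the initial slots. -/
theorem one_le_plays_hist {link : Fin (Fintype.card G.Dart) ≃ G.Dart}
    (hfirst : ∀ j, link j ∈ first j) {t : ℕ} (ht : Fintype.card G.Dart ≤ t) (ω : Ω) (i : G.Dart) :
    1 ≤ (hist k q first X c t ω).plays i := by
  set j := link.symm i with hj
  have h1 : i ∈ (hist k q first X c (j + 1) ω).sched := by
    change i ∈ nextSched _ _ _ _ _ _
    unfold nextSched
    rw [dif_pos j.2]
    have := hfirst j
    rwa [hj, Equiv.apply_symm_apply] at this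
  have h2 : 1 ≤ (hist k q first X c (j + 1) ω).plays i := by
    rw [plays_hist_succ, if_pos h1]
    omega
  exact h2.trans (plays_hist_mono ω i (le_trans (Nat.succ_le_of_lt j.2) ht))

/-- Misestimation has small probability. -/
theorem IsDriving.misestimated_le (h : IsDriving P D p k X c)
    [IsProbabilityMeasure (coinLaw G p k)] (hD : ∀ i, ∀ᵐ x ∂(D i), x ∈ Set.Icc (0 : ℝ) 1)
    (hG : 1 ≤ Fintype.card G.Dart) (t : ℕ) :
    P.real {ω | Misestimated D (t + 1) (hist k q first X c t ω)} ≤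
      2 * Fintype.card G.Dart * (1 / ((t : ℝ) + 1) ^ 2) := by
  set L : ℝ := (Fintype.card G.Dart : ℝ) with hL
  have hL1 : (1 : ℝ) ≤ L := by rw [hL]; exact_mod_cast hG
  set a : ℝ := (L + 1) * Real.log ((t + 1 : ℕ) : ℝ) with ha
  have hlog : 0 ≤ Real.log ((t + 1 : ℕ) : ℝ) := Real.log_natCast_nonneg _
  have ha0 : 0 ≤ a := mul_nonneg (by linarith) hlog
  have hsub : {ω | Misestimated D (t + 1) (hist k q first X c t ω)} ⊆
      ⋃ i ∈ (Finset.univ : Finset G.Dart), ⋃ n ∈ Finset.Icc 1 t,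
        {ω | (hist k q first X c t ω).plays i = n ∧
          Real.sqrt (a * n) < |(hist k q first X c t ω).total i - n * ∫ y, y ∂(D i)|} := by
    rintro ω ⟨i, hi, hi'⟩
    simp only [Set.mem_iUnion]
    exact ⟨i, Finset.mem_univ i, _, Finset.mem_Icc.2 ⟨hi, plays_hist_le t ω i⟩, rfl, hi'⟩
  have hsingle : ∀ i, ∀ n ∈ Finset.Icc 1 t, P.real {ω | (hist k q first X c t ω).plays i = n ∧
      Real.sqrt (a * n) < |(hist k q first X c t ω).total i - n * ∫ y, y ∂(D i)|} ≤
      2 * Real.exp (-(2 * a)) := by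
    intro i n hn
    have := h.measure_deviation_le (q := q) (first := first) i (hD i) t (Finset.mem_Icc.1 hn).1 ha0
    refine (ENNReal.toReal_mono (by finiteness) this).trans (le_of_eq ?_)
    rw [ENNReal.toReal_mul, ENNReal.toReal_ofReal (Real.exp_pos _).le]
    simp
  have hexp : Real.exp (-(2 * a)) ≤ 1 / ((t : ℝ) + 1) ^ 3 := by
    have h1 : Real.exp (-(2 * a)) ≤ Real.exp (-(3 * Real.log ((t + 1 : ℕ) : ℝ))) := by
      refine Real.exp_le_exp.2 ?_
      rw [ha]
      nlinarith
    refine h1.trans (le_of_eq ?_)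
    rw [Real.exp_neg, show (3 : ℝ) * Real.log ((t + 1 : ℕ) : ℝ) =
      ((3 : ℕ) : ℝ) * Real.log ((t + 1 : ℕ) : ℝ) by norm_num, Real.exp_nat_mul,
      Real.exp_log (by positivity), one_div]
    push_cast
    rfl
  calc P.real {ω | Misestimated D (t + 1) (hist k q first X c t ω)}
      ≤ ∑ i : G.Dart, ∑ n ∈ Finset.Icc 1 t, 2 * Real.exp (-(2 * a)) := by
        refine (measureReal_mono hsub (measure_ne_top P _)).trans ((measureReal_biUnion_finset_le _ _).trans
          (Finset.sum_le_sum fun i _ => (measureReal_biUnion_finset_le _ _).trans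
          (Finset.sum_le_sum fun n hn => hsingle i n hn)))
    _ = L * (t * (2 * Real.exp (-(2 * a)))) := by
        simp [hL]
    _ ≤ L * ((t + 1) * (2 * (1 / ((t : ℝ) + 1) ^ 3))) := by
        gcongr
        linarith
    _ = 2 * L * (1 / ((t : ℝ) + 1) ^ 2) := by
        field_simp

theorem measurable_weightSum :
    Measurable fun z : Finset G.Dart × (G.Dart → ℝ) => weightSum z.2 z.1 :=
  measurable_from_prod_countable_right fun S =>
    Finset.measurable_sum S fun i _ => measurable_pi_apply i

theorem measurable_optSum : Measurable (optSum (G := G)) := by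
  have h : Measurable ((matchings G).sup' (matchings_nonempty G)
      fun S (w : G.Dart → ℝ) => weightSum w S) :=
    Finset.measurable_sup' _ fun S _ => Finset.measurable_sum S fun i _ => measurable_pi_apply i
  have h' : (matchings G).sup' (matchings_nonempty G)
      (fun S (w : G.Dart → ℝ) => weightSum w S) = optSum := by
    funext w
    rw [Finset.sup'_apply]
    rfl
  exact h' ▸ h

theorem delta_le_one (hk : 2 ≤ k) (hp0 : 0 < p) (hp1 : p < 1) (hG : 1 ≤ G.maxDegree) :
    delta G p k ≤ 1 := by
  have := isProbabilityMeasure_coinLaw (G := G) hp0.le hp1.le (by omega : 1 ≤ k)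
  have h1 := delta_le_coinLaw (S := (∅ : Finset G.Dart)) (w := fun _ => 0)
    (isMatching_iff.2 fun v d hd => absurd hd (Finset.notMem_empty d)) (fun _ => le_rfl)
    hk hp0 hp1 hG
  exact ENNReal.ofReal_le_one.1 (h1.trans prob_le_one)

/-- Given that the previous schedule is not near-optimal, the augmentation algorithm fails with
probability at most `1 - δ`. -/
theorem IsDriving.failure_le (h : IsDriving P D p k X c) (hfirst : ∀ j, IsMatching G (first j))
    (hk : 2 ≤ k) (hp0 : 0 < p) (hp1 : p < 1) (hG : 1 ≤ G.maxDegree)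
    (B : Finset (Finset G.Dart)) (t : ℕ) :
    P.real {ω | (hist k q first X c t ω).sched ∈ B ∧
        (∀ i, 0 ≤ ucbIndex q (t + 1) (hist k q first X c t ω) i) ∧
        ¬ ((k : ℝ) - 1) / (k + 1) * optSum (ucbIndex q (t + 1) (hist k q first X c t ω)) ≤
          weightSum (ucbIndex q (t + 1) (hist k q first X c t ω))
            (augment k (c (t + 1) ω) (hist k q first X c t ω).sched
              (ucbIndex q (t + 1) (hist k q first X c t ω)))} ≤
      (1 - delta G p k) * P.real {ω | (hist k q first X c t ω).sched ∈ B} := by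
  have := isProbabilityMeasure_coinLaw (G := G) hp0.le hp1.le (by omega : 1 ≤ k)
  set α : ℝ := ((k : ℝ) - 1) / (k + 1)
  let fail : Set (History G × Coins G) := {z | (z.1.sched ∈ B ∧ ∀ i, 0 ≤ ucbIndex q (t + 1) z.1 i) ∧
    ¬ α * optSum (ucbIndex q (t + 1) z.1) ≤ weightSum (ucbIndex q (t + 1) z.1)
      (augment k z.2 z.1.sched (ucbIndex q (t + 1) z.1))}
  have hucb : Measurable fun z : History G × Coins G => ucbIndex q (t + 1) z.1 :=
    (measurable_ucbIndex q (t + 1)).comp measurable_fst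
  have hB : MeasurableSet {H : History G | H.sched ∈ B} :=
    measurable_sched (MeasurableSet.of_discrete (s := {S : Finset G.Dart | S ∈ B}))
  have hnext : Measurable fun z : History G × Coins G =>
      augment k z.2 z.1.sched (ucbIndex q (t + 1) z.1) := by
    have h1 : Measurable fun z : History G × Coins G => ((z.2, z.1.sched), ucbIndex q (t + 1) z.1) :=
      (measurable_snd.prodMk (measurable_sched.comp measurable_fst)).prodMk hucb
    have h2 := (measurable_augment (G := G) k).comp h1
    exact h2
  have hfail : MeasurableSet fail := by
    refine MeasurableSet.inter (MeasurableSet.inter (measurable_fst hB) ?_) ?_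
    · have h1 : {z : History G × Coins G | ∀ i, 0 ≤ ucbIndex q (t + 1) z.1 i} =
          ⋂ i, {z : History G × Coins G | 0 ≤ ucbIndex q (t + 1) z.1 i} := by
        ext
        simp
      change MeasurableSet {z : History G × Coins G | ∀ i, 0 ≤ ucbIndex q (t + 1) z.1 i}
      rw [h1]
      exact MeasurableSet.iInter fun i =>
        measurableSet_le measurable_const ((measurable_pi_apply i).comp hucb)
    · refine MeasurableSet.compl (measurableSet_le ((measurable_optSum.comp hucb).const_mul α) ?_)
      have h2 := (measurable_weightSum (G := G)).comp (hnext.prodMk hucb)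
      exact h2
  have hF : Measurable fun z : History G × ((G.Dart → ℝ) × Coins G) =>
      fail.indicator (fun _ => (1 : ENNReal)) (z.1, z.2.2) :=
    (measurable_const.indicator hfail).comp (measurable_fst.prodMk measurable_snd.snd)
  have hδ1 : ENNReal.ofReal (1 - delta G p k) =
      1 - ENNReal.ofReal (delta G p k) := by
    have hδ0 : 0 ≤ delta G p k := by
      have : 0 < 1 - p := by linarith
      unfold delta
      positivity
    rw [ENNReal.ofReal_sub _ hδ0, ENNReal.ofReal_one]
  have key : P {ω | (hist k q first X c t ω, c (t + 1) ω) ∈ fail} ≤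
      ENNReal.ofReal (1 - delta G p k) * P {ω | (hist k q first X c t ω).sched ∈ B} := by
    have hH := h.measurable_hist (q := q) (first := first) t
    have h1 : P {ω | (hist k q first X c t ω, c (t + 1) ω) ∈ fail} =
        ∫⁻ ω, fail.indicator (fun _ => (1 : ENNReal)) (hist k q first X c t ω, c (t + 1) ω) ∂P :=
      (lintegral_indicator_one (hfail.preimage (hH.prodMk (h.coins (t + 1))))).symm
    have h0 : P {ω | (hist k q first X c t ω).sched ∈ B} =
        ∫⁻ ω, (hist k q first X c t ⁻¹' {H | H.sched ∈ B}).indicator 1 ω ∂P :=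
      (lintegral_indicator_one (hH hB)).symm
    rw [h1, h.lintegral_next (q := q) (first := first) t
      (F := fun H _ a => fail.indicator (fun _ => (1 : ENNReal)) (H, a)) hF, h0,
      ← lintegral_const_mul _ (measurable_one.indicator (hH hB))]
    refine lintegral_mono fun ω => ?_
    set H := hist k q first X c t ω with hHdef
    simp only [lintegral_const, measure_univ, mul_one]
    have h2 : ∫⁻ a, fail.indicator (fun _ => (1 : ENNReal)) (H, a) ∂(coinLaw G p k) =
        coinLaw G p k {a | (H, a) ∈ fail} :=
      lintegral_indicator_one (measurable_prodMk_left hfail)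
    rw [h2]
    by_cases hHB : H.sched ∈ B ∧ ∀ i, 0 ≤ ucbIndex q (t + 1) H i
    · have h3 : (hist k q first X c t ⁻¹' {H | H.sched ∈ B}).indicator (1 : Ω → ENNReal) ω = 1 :=
        Set.indicator_of_mem (s := hist k q first X c t ⁻¹' {H | H.sched ∈ B}) hHB.1 _
      rw [h3, mul_one, hδ1]
      have hgood := delta_le_coinLaw (S := H.sched) (hist_isMatching hfirst t ω) hHB.2 hk hp0 hp1 hG
      set good : Set (Coins G) := {a | α * optSum (ucbIndex q (t + 1) H) ≤
        weightSum (ucbIndex q (t + 1) H) (augment k a H.sched (ucbIndex q (t + 1) H))} with hgd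
      have h4 : {a | (H, a) ∈ fail} = goodᶜ := by
        ext a
        exact ⟨fun h => h.2, fun h => ⟨hHB, h⟩⟩
      rw [h4, prob_compl_eq_one_sub]
      · exact tsub_le_tsub_left hgood 1
      · exact MeasurableSet.of_compl (h4 ▸ measurable_prodMk_left hfail)
    · have h4 : {a | (H, a) ∈ fail} = ∅ := by
        ext a
        exact iff_of_false (fun h => hHB h.1) (Set.notMem_empty a)
      rw [h4, measure_empty]
      exact zero_le
  have hset : {ω | (hist k q first X c t ω, c (t + 1) ω) ∈ fail} = {ω |
      (hist k q first X c t ω).sched ∈ B ∧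
        (∀ i, 0 ≤ ucbIndex q (t + 1) (hist k q first X c t ω) i) ∧
        ¬ α * optSum (ucbIndex q (t + 1) (hist k q first X c t ω)) ≤
          weightSum (ucbIndex q (t + 1) (hist k q first X c t ω))
            (augment k (c (t + 1) ω) (hist k q first X c t ω).sched
              (ucbIndex q (t + 1) (hist k q first X c t ω)))} := by
    ext ω
    exact and_assoc
  rw [← hset]
  have hδ2 := delta_le_one hk hp0 hp1 hG
  refine (ENNReal.toReal_mono (by finiteness) key).trans (le_of_eq ?_)
  rw [ENNReal.toReal_mul, ENNReal.toReal_ofReal (by linarith)]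
  rfl

/-- After the initial slots, a link is scheduled at most `l` times while it has been observed fewer
than `l` times. -/
theorem sum_rarely_observed_le {link : Fin (Fintype.card G.Dart) ≃ G.Dart}
    (hfirst : ∀ j, link j ∈ first j) {l : ℝ} (hl : 0 ≤ l) (i : G.Dart) (ω : Ω) (n : ℕ) :
    ∑ s ∈ Finset.range n, Set.indicator {ω | Fintype.card G.Dart ≤ s ∧
      i ∈ (hist k q first X c (s + 1) ω).sched ∧ ((hist k q first X c s ω).plays i : ℝ) < l}
      (1 : Ω → ℝ) ω ≤ l := by
  classical
  set C : ℕ → ℝ := fun n => ∑ s ∈ Finset.range n, Set.indicator {ω | Fintype.card G.Dart ≤ s ∧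
      i ∈ (hist k q first X c (s + 1) ω).sched ∧ ((hist k q first X c s ω).plays i : ℝ) < l}
      (1 : Ω → ℝ) ω with hC
  suffices h : ∀ n, C n ≤ l ∧ (n ≤ Fintype.card G.Dart → C n = 0) ∧
      (Fintype.card G.Dart ≤ n → C n + 1 ≤ (hist k q first X c n ω).plays i) from (h n).1
  intro n
  induction n with
  | zero =>
    refine ⟨by simpa [hC] using hl, fun _ => by simp [hC], fun h0 => ?_⟩
    have := one_le_plays_hist (k := k) (q := q) (X := X) (c := c) hfirst h0 ω i
    simp only [hC, Finset.range_zero, Finset.sum_empty, zero_add]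
    exact_mod_cast this
  | succ n ih =>
    obtain ⟨h1, h2, h3⟩ := ih
    have hstep : C (n + 1) = C n + Set.indicator {ω | Fintype.card G.Dart ≤ n ∧
      i ∈ (hist k q first X c (n + 1) ω).sched ∧ ((hist k q first X c n ω).plays i : ℝ) < l}
      (1 : Ω → ℝ) ω := Finset.sum_range_succ _ n
    rw [hstep, Set.indicator_apply]
    split_ifs with hmem
    · obtain ⟨h4, h5, h6⟩ := hmem
      have h7 := h3 h4
      simp only [Pi.one_apply]
      refine ⟨by linarith, fun h => by omega, fun _ => ?_⟩
      rw [plays_hist_succ, if_pos h5]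
      push_cast
      linarith
    · rw [add_zero]
      refine ⟨h1, fun h => h2 (by omega), fun h => ?_⟩
      rcases Nat.lt_or_ge n (Fintype.card G.Dart) with h4 | h4
      · rw [h2 h4.le, zero_add]
        exact_mod_cast one_le_plays_hist (k := k) (q := q) (X := X) (c := c) hfirst h ω i
      · refine (h3 h4).trans ?_
        exact_mod_cast plays_hist_mono ω i (Nat.le_succ n)

theorem IsDriving.sum_rarely_observed_le (h : IsDriving P D p k X c)
    {link : Fin (Fintype.card G.Dart) ≃ G.Dart} (hfirst : ∀ j, link j ∈ first j) {l : ℝ}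
    (hl : 0 ≤ l) (n : ℕ) :
    ∑ s ∈ Finset.range n, P.real {ω | Fintype.card G.Dart ≤ s ∧
      ∃ i ∈ (hist k q first X c (s + 1) ω).sched, ((hist k q first X c s ω).plays i : ℝ) < l} ≤
      Fintype.card G.Dart * l := by
  set A : ℕ → G.Dart → Set Ω := fun s i => {ω | Fintype.card G.Dart ≤ s ∧
      i ∈ (hist k q first X c (s + 1) ω).sched ∧ ((hist k q first X c s ω).plays i : ℝ) < l}
  have hA : ∀ s i, MeasurableSet (A s i) := by
    intro s i
    have h1 : Measurable fun ω => ((hist k q first X c s ω).plays i : ℝ) :=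
      measurable_from_nat.comp ((measurable_plays i).comp (h.measurable_hist s))
    have h2 : MeasurableSet {ω | i ∈ (hist k q first X c (s + 1) ω).sched} :=
      (measurable_sched.comp (h.measurable_hist (s + 1)))
        (MeasurableSet.of_discrete (s := {S : Finset G.Dart | i ∈ S}))
    exact (MeasurableSet.const _).inter (h2.inter (measurableSet_lt h1 measurable_const))
  have hint : ∀ s i, Integrable ((A s i).indicator (1 : Ω → ℝ)) P := fun s i =>
    (integrable_const (1 : ℝ)).indicator (hA s i)
  calc _ ≤ ∑ s ∈ Finset.range n, ∑ i : G.Dart, P.real (A s i) := by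
        refine Finset.sum_le_sum fun s _ => ?_
        refine (measureReal_mono (s₂ := ⋃ i ∈ (Finset.univ : Finset G.Dart), A s i) ?_
          (measure_ne_top P _)).trans
          (measureReal_biUnion_finset_le _ _)
        rintro ω ⟨h1, i, h2, h3⟩
        simp only [Set.mem_iUnion]
        exact ⟨i, Finset.mem_univ i, h1, h2, h3⟩
    _ = ∑ i : G.Dart, ∫ ω, ∑ s ∈ Finset.range n, (A s i).indicator (1 : Ω → ℝ) ω ∂P := by
        rw [Finset.sum_comm]
        refine Finset.sum_congr rfl fun i _ => ?_
        rw [integral_finsetSum _ fun s _ => hint s i]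
        exact Finset.sum_congr rfl fun s _ => (integral_indicator_one (hA s i)).symm
    _ ≤ ∑ i : G.Dart, l := by
        refine Finset.sum_le_sum fun i _ => ?_
        refine (integral_mono (integrable_finsetSum _ fun s _ => hint s i)
          (integrable_const l) fun ω => ?_).trans (by simp)
        exact AkUCB.sum_rarely_observed_le hfirst hl i ω n
    _ = Fintype.card G.Dart * l := by simp

end Regret

/-! ### The regret -/

section Regret

variable {V : Type*} [Fintype V] [DecidableEq V] {G : SimpleGraph V} [DecidableRel G.Adj]
variable {Ω : Type*} [MeasurableSpace Ω] {P : Measure Ω} [IsProbabilityMeasure P]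
  {D : G.Dart → Measure ℝ} [∀ i, IsProbabilityMeasure (D i)] {p : ℝ} {k : ℕ}
  {X : ℕ → Ω → G.Dart → ℝ} {c : ℕ → Ω → Coins G} {q : G.Dart → ℝ}
  {first : Fin (Fintype.card G.Dart) → Finset G.Dart}

theorem one_le_maxDegree (hG : 1 ≤ Fintype.card G.Dart) : 1 ≤ G.maxDegree := by
  obtain ⟨d⟩ := Fintype.card_pos_iff.1 hG
  exact ((G.degree_pos_iff_exists_adj d.fst).2 ⟨d.snd, d.adj⟩).trans_le
    (G.degree_le_maxDegree d.fst)

theorem delta_pos {k : ℕ} (hk : 1 ≤ k) (hp0 : 0 < p) (hp1 : p < 1) (hG : 1 ≤ G.maxDegree) :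
    0 < delta G p k := by
  have h1 : 0 < 1 - p := by linarith
  have h2 : (0 : ℝ) < k := by exact_mod_cast hk
  have h3 : (0 : ℝ) < G.maxDegree := by exact_mod_cast hG
  unfold delta
  positivity

/-- Besides the empty matching, every single link is a matching. -/
theorem card_dart_lt_card_matchings : Fintype.card G.Dart < (matchings G).card := by
  have h1 : (insert ∅ (Finset.univ.image fun i : G.Dart => {i}) : Finset (Finset G.Dart)).card =
      Fintype.card G.Dart + 1 := by
    rw [Finset.card_insert_of_notMem (by simp),
      Finset.card_image_of_injective _ Finset.singleton_injective, Finset.card_univ]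
  rw [Nat.lt_iff_add_one_le, ← h1]
  refine Finset.card_le_card fun S hS => ?_
  simp only [matchings, Finset.mem_filter, Finset.mem_univ, true_and]
  rcases Finset.mem_insert.1 hS with rfl | hS
  · exact isMatching_iff.2 fun v d hd => absurd hd (Finset.notMem_empty d)
  · obtain ⟨i, -, rfl⟩ := Finset.mem_image.1 hS
    refine isMatching_iff.2 fun v d hd d' hd' _ _ => ?_
    rw [Finset.mem_singleton.1 hd, Finset.mem_singleton.1 hd']

/-- In the step from one slot to the next, the probability of a schedule that is not near-optimal
shrinks by the factor `1 - δ`, up to the probabilities of two exceptional events. -/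
theorem IsDriving.measure_nonNearOptimal_succ_le (h : IsDriving P D p k X c)
    {link : Fin (Fintype.card G.Dart) ≃ G.Dart}
    (hfirst : ∀ j, IsMatching G (first j) ∧ link j ∈ first j)
    (hD : ∀ i, ∀ᵐ x ∂(D i), x ∈ Set.Icc (0 : ℝ) 1) (hq : ∀ i, 0 ≤ q i) (hk : 2 ≤ k)
    (hp0 : 0 < p) (hp1 : p < 1) (hG : 1 ≤ Fintype.card G.Dart)
    (hgap : (nonNearOptimal (((k : ℝ) - 1) / (k + 1)) (meanWeight q D)).Nonempty) {n s : ℕ}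
    (hs : Fintype.card G.Dart ≤ s) (hsn : s < n) :
    P.real {ω | (hist k q first X c (s + 1) ω).sched ∈
        nonNearOptimal (((k : ℝ) - 1) / (k + 1)) (meanWeight q D)} ≤
      (1 - delta G p k) * P.real {ω | (hist k q first X c s ω).sched ∈
        nonNearOptimal (((k : ℝ) - 1) / (k + 1)) (meanWeight q D)} +
      P.real {ω | Fintype.card G.Dart ≤ s ∧ ∃ i ∈ (hist k q first X c (s + 1) ω).sched,
        ((hist k q first X c s ω).plays i : ℝ) < 4 * (Fintype.card G.Dart : ℝ) ^ 2 *
          ((Fintype.card G.Dart : ℝ) + 1) * Real.log n /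
            gapMin (((k : ℝ) - 1) / (k + 1)) (meanWeight q D) hgap ^ 2} +
      2 * Fintype.card G.Dart * (1 / ((s : ℝ) + 1) ^ 2) := by
  have := isProbabilityMeasure_coinLaw (G := G) hp0.le hp1.le (by omega : 1 ≤ k)
  have hα : 0 ≤ ((k : ℝ) - 1) / (k + 1) := by
    have : (2 : ℝ) ≤ k := by exact_mod_cast hk
    exact div_nonneg (by linarith) (by linarith)
  have h1 := h.failure_le (q := q) (fun j => (hfirst j).1) hk hp0 hp1 (one_le_maxDegree hG)
    (nonNearOptimal (((k : ℝ) - 1) / (k + 1)) (meanWeight q D)) s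
  have h2 := h.misestimated_le (q := q) (first := first) hD hG s
  refine le_trans (measureReal_mono (fun ω hω => ?_) (measure_ne_top P _))
    ((measureReal_union_le _ _).trans (add_le_add ((measureReal_union_le _ _).trans
      (add_le_add h1 le_rfl)) h2))
  have h3 := hω
  rw [Set.mem_ofPred_eq, hist_succ_of_le hs] at h3
  rcases augment_mem_nonNearOptimal hq (meanWeight_nonneg hq hD) (Nat.succ_le_of_lt hsn)
    (Nat.succ_le_succ (Nat.zero_le s)) hα hgap hG (hist_isMatching (fun j => (hfirst j).1) s ω)
    (fun i => one_le_plays_hist (fun j => (hfirst j).2) hs ω i) h3 with h4 | h4 | h4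
  · refine Or.inl (Or.inr ⟨hs, ?_⟩)
    rw [hist_succ_of_le hs]
    exact h4
  · exact Or.inr h4
  · exact Or.inl (Or.inl h4)

theorem sum_one_div_sq_le (n : ℕ) :
    ∑ s ∈ Finset.range n, 1 / ((s : ℝ) + 1) ^ 2 ≤ Real.pi ^ 2 / 6 := by
  have h := hasSum_zeta_two
  have h1 : HasSum (fun s : ℕ => 1 / ((s : ℝ) + 1) ^ 2) (Real.pi ^ 2 / 6) := by
    have := (hasSum_nat_add_iff' (f := fun n : ℕ => 1 / (n : ℝ) ^ 2) 1).2 h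
    simpa using this
  exact sum_le_hasSum _ (fun s _ => by positivity) h1

/-- A bound for the sum of a sequence that shrinks by the factor `1 - δ` in each step, up to an
error. -/
theorem sum_le_of_contraction {b e : ℕ → ℝ} {δ : ℝ} {n : ℕ}
    (h : ∀ s < n, b (s + 1) ≤ (1 - δ) * b s + e s) :
    δ * ∑ s ∈ Finset.range n, b (s + 1) + (1 - δ) * b n ≤
      (1 - δ) * b 0 + ∑ s ∈ Finset.range n, e s := by
  induction n with
  | zero => simp
  | succ n ih =>
    have h1 := ih fun s hs => h s (by omega)
    have h2 := h n (Nat.lt_succ_self n)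
    rw [Finset.sum_range_succ, Finset.sum_range_succ]
    linarith

/-- The expected number of slots with a schedule that is not near-optimal. -/
theorem IsDriving.sum_nonNearOptimal_le (h : IsDriving P D p k X c)
    {link : Fin (Fintype.card G.Dart) ≃ G.Dart}
    (hfirst : ∀ j, IsMatching G (first j) ∧ link j ∈ first j)
    (hD : ∀ i, ∀ᵐ x ∂(D i), x ∈ Set.Icc (0 : ℝ) 1) (hq : ∀ i, 0 ≤ q i) (hk : 2 ≤ k)
    (hp0 : 0 < p) (hp1 : p < 1) (hG : 1 ≤ Fintype.card G.Dart)
    (hgap : (nonNearOptimal (((k : ℝ) - 1) / (k + 1)) (meanWeight q D)).Nonempty) (n : ℕ) :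
    delta G p k * ∑ s ∈ Finset.range n, P.real {ω | (hist k q first X c (s + 1) ω).sched ∈
        nonNearOptimal (((k : ℝ) - 1) / (k + 1)) (meanWeight q D)} ≤
      1 - delta G p k + Fintype.card G.Dart + Fintype.card G.Dart *
        (4 * (Fintype.card G.Dart : ℝ) ^ 2 * ((Fintype.card G.Dart : ℝ) + 1) * Real.log n /
          gapMin (((k : ℝ) - 1) / (k + 1)) (meanWeight q D) hgap ^ 2) +
        Fintype.card G.Dart * Real.pi ^ 2 / 3 := by
  have := isProbabilityMeasure_coinLaw (G := G) hp0.le hp1.le (by omega : 1 ≤ k)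
  set B := nonNearOptimal (((k : ℝ) - 1) / (k + 1)) (meanWeight q D) with hB
  set l : ℝ := 4 * (Fintype.card G.Dart : ℝ) ^ 2 * ((Fintype.card G.Dart : ℝ) + 1) * Real.log n /
    gapMin (((k : ℝ) - 1) / (k + 1)) (meanWeight q D) hgap ^ 2 with hl
  have hl0 : 0 ≤ l :=
    div_nonneg (mul_nonneg (by positivity) (Real.log_natCast_nonneg n)) (by positivity)
  have hδ1 := delta_le_one (G := G) hk hp0 hp1 (one_le_maxDegree hG)
  set b : ℕ → ℝ := fun s => P.real {ω | (hist k q first X c s ω).sched ∈ B} with hb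
  set u : ℕ → ℝ := fun s => P.real {ω | Fintype.card G.Dart ≤ s ∧
    ∃ i ∈ (hist k q first X c (s + 1) ω).sched, ((hist k q first X c s ω).plays i : ℝ) < l} with hu
  have hb0 : ∀ s, 0 ≤ b s := fun s => measureReal_nonneg
  have hu0 : ∀ s, 0 ≤ u s := fun s => measureReal_nonneg
  have hstep : ∀ s < n, b (s + 1) ≤ (1 - delta G p k) * b s +
      ((if s < Fintype.card G.Dart then 1 else 0) + u s +
        2 * Fintype.card G.Dart * (1 / ((s : ℝ) + 1) ^ 2)) := by
    intro s hs
    split_ifs with hsL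
    · have h1 : b (s + 1) ≤ 1 := measureReal_le_one
      have h2 : 0 ≤ (1 - delta G p k) * b s := mul_nonneg (by linarith) (hb0 s)
      have h3 := hu0 s
      have h4 : (0 : ℝ) ≤ 2 * Fintype.card G.Dart * (1 / ((s : ℝ) + 1) ^ 2) := by positivity
      linarith
    · have := h.measure_nonNearOptimal_succ_le hfirst hD hq hk hp0 hp1 hG hgap (not_lt.1 hsL) hs
      simp only [hb, hu]
      linarith
  have h1 := sum_le_of_contraction hstep
  rw [Finset.sum_add_distrib, Finset.sum_add_distrib, ← Finset.mul_sum] at h1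
  have h2 : ∑ s ∈ Finset.range n, (if s < Fintype.card G.Dart then (1 : ℝ) else 0) ≤
      Fintype.card G.Dart := by
    rw [← Finset.sum_filter, Finset.sum_const, nsmul_eq_mul, mul_one]
    have : ((Finset.range n).filter fun s => s < Fintype.card G.Dart).card ≤
        (Finset.range (Fintype.card G.Dart)).card := Finset.card_le_card fun s hs => by
      simpa using (Finset.mem_filter.1 hs).2
    rw [Finset.card_range] at this
    exact_mod_cast this
  have h3 : ∑ s ∈ Finset.range n, u s ≤ Fintype.card G.Dart * l :=
    h.sum_rarely_observed_le (fun j => (hfirst j).2) hl0 n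
  have h4 : 2 * (Fintype.card G.Dart : ℝ) * ∑ s ∈ Finset.range n, 1 / ((s : ℝ) + 1) ^ 2 ≤
      2 * (Fintype.card G.Dart : ℝ) * (Real.pi ^ 2 / 6) :=
    mul_le_mul_of_nonneg_left (sum_one_div_sq_le n) (by positivity)
  have h5 : (1 - delta G p k) * b 0 ≤ 1 - delta G p k :=
    mul_le_of_le_one_right (by linarith) measureReal_le_one
  have h6 : 0 ≤ (1 - delta G p k) * b n := mul_nonneg (by linarith) (hb0 n)
  change delta G p k * ∑ s ∈ Finset.range n, b (s + 1) ≤ _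
  linarith

/-- A schedule that is not near-optimal costs at most the maximum gap, the others cost nothing. -/
theorem IsDriving.alphaRegret_le (h : IsDriving P D p k X c)
    (hfirst : ∀ j, IsMatching G (first j)) {α : ℝ} {w : G.Dart → ℝ}
    (hgap : (nonNearOptimal α w).Nonempty) (t : ℕ) :
    alphaRegret P α w (fun τ ω => (hist k q first X c τ ω).sched) t ≤
      gapMax α w hgap * ∑ s ∈ Finset.range t,
        P.real {ω | (hist k q first X c (s + 1) ω).sched ∈ nonNearOptimal α w} := by
  have hsched : ∀ s, Measurable fun ω => (hist k q first X c s ω).sched := fun s =>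
    measurable_sched.comp (h.measurable_hist s)
  have hint : ∀ s, Integrable (fun ω => weightSum w (hist k q first X c s ω).sched) P := by
    intro s
    have h1 : Measurable fun S : Finset G.Dart => weightSum w S := measurable_of_finite _
    obtain ⟨C, hC⟩ := (Set.finite_range fun S : Finset G.Dart => ‖weightSum w S‖).bddAbove
    exact Integrable.of_bound (h1.comp (hsched s)).aestronglyMeasurable C
      (Filter.Eventually.of_forall fun ω => hC ⟨_, rfl⟩)
  have hmeas : ∀ s, MeasurableSet {ω | (hist k q first X c s ω).sched ∈ nonNearOptimal α w} :=
    fun s => hsched s (MeasurableSet.of_discrete (s := {S | S ∈ nonNearOptimal α w}))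
  have hslot : ∀ s, α * optSum w - gapMax α w hgap *
      P.real {ω | (hist k q first X c s ω).sched ∈ nonNearOptimal α w} ≤
      ∫ ω, weightSum w (hist k q first X c s ω).sched ∂P := by
    intro s
    set A := {ω | (hist k q first X c s ω).sched ∈ nonNearOptimal α w} with hA
    have h1 : Integrable (A.indicator (1 : Ω → ℝ)) P :=
      (integrable_const (1 : ℝ)).indicator (hmeas s)
    have h2 : α * optSum w - gapMax α w hgap * P.real A =
        ∫ ω, (α * optSum w - gapMax α w hgap * A.indicator (1 : Ω → ℝ) ω) ∂P := by
      rw [integral_sub (integrable_const _) (h1.const_mul _),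
        integral_const_mul (gapMax α w hgap), integral_indicator_one (hmeas s), integral_const,
        probReal_univ, one_smul]
    rw [h2]
    refine integral_mono ((integrable_const _).sub (h1.const_mul _)) (hint s) fun ω => ?_
    by_cases hω : ω ∈ A
    · simp only [Set.indicator_of_mem hω, Pi.one_apply, mul_one]
      have h3 : (nonNearOptimal α w).inf' hgap (weightSum w) ≤
          weightSum w (hist k q first X c s ω).sched := Finset.inf'_le (weightSum w) hω
      unfold gapMax
      linarith
    · simp only [Set.indicator_of_notMem hω, mul_zero, sub_zero]
      by_contra hc
      exact hω (mem_nonNearOptimal.2 ⟨hist_isMatching hfirst s ω, not_le.1 hc⟩)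
  have hshift : ∀ f : ℕ → ℝ, ∑ τ ∈ Finset.Icc 1 t, f τ = ∑ s ∈ Finset.range t, f (s + 1) := by
    intro f
    rw [Finset.range_eq_Ico, Finset.sum_Ico_add' f 0 t 1]
    rfl
  unfold alphaRegret
  rw [integral_finsetSum _ fun τ _ => hint τ, hshift]
  have h4 := Finset.sum_le_sum fun s (_ : s ∈ Finset.range t) => hslot (s + 1)
  rw [Finset.sum_sub_distrib, ← Finset.mul_sum _ _ (gapMax α w hgap), Finset.sum_const,
    Finset.card_range, nsmul_eq_mul] at h4
  linarith

theorem gapMax_pos {α : ℝ} {w : G.Dart → ℝ} (h : (nonNearOptimal α w).Nonempty) :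
    0 < gapMax α w h := by
  obtain ⟨S, hS⟩ := h
  have h1 := Finset.inf'_le (weightSum w) hS
  have h2 := (mem_nonNearOptimal.1 hS).2
  unfold gapMax
  linarith

/-- If some matching is not near-optimal for nonnegative weights, then `α` is not `0` and there is a
link. -/
theorem of_nonNearOptimal_nonempty {k : ℕ} (hk : 1 ≤ k) {w : G.Dart → ℝ} (hw : ∀ i, 0 ≤ w i)
    (h : (nonNearOptimal (((k : ℝ) - 1) / (k + 1)) w).Nonempty) :
    2 ≤ k ∧ 1 ≤ Fintype.card G.Dart := by
  obtain ⟨S, hS⟩ := h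
  have h1 := (mem_nonNearOptimal.1 hS).2
  have h2 : 0 ≤ weightSum w S := Finset.sum_nonneg fun i _ => hw i
  constructor
  · by_contra hc
    have : k = 1 := by omega
    subst this
    simp at h1
    linarith
  · by_contra hc
    have hempty : IsEmpty G.Dart := Fintype.card_eq_zero_iff.1 (by omega)
    obtain ⟨R, -, hR⟩ := Finset.exists_mem_eq_sup' (matchings_nonempty G) (weightSum w)
    have h3 : optSum w = 0 := by
      rw [optSum, hR, Finset.eq_empty_of_isEmpty R]
      exact Finset.sum_empty
    rw [h3, mul_zero] at h1
    linarith

/-- The comparison of the bound for the number of slots with the constants `D₁` and `D₂`. -/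
theorem le_constD {δ N r : ℝ} (hL : (1 : ℝ) ≤ Fintype.card G.Dart)
    (hM : (Fintype.card G.Dart : ℝ) + 1 ≤ (matchings G).card) (hδ : 0 < δ)
    (hr : 0 ≤ r) (h : δ * N ≤ 1 - δ + Fintype.card G.Dart + Fintype.card G.Dart *
      (4 * (Fintype.card G.Dart : ℝ) ^ 2 * ((Fintype.card G.Dart : ℝ) + 1) * r) +
      Fintype.card G.Dart * Real.pi ^ 2 / 3) :
    N ≤ constD₁ G δ * r + constD₂ G δ := by
  unfold constD₁ constD₂
  set L : ℝ := (Fintype.card G.Dart : ℝ)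
  set M : ℝ := ((matchings G).card : ℝ)
  have h1 : N ≤ (1 - δ + L + L * (4 * L ^ 2 * (L + 1) * r) + L * Real.pi ^ 2 / 3) / δ := by
    rw [le_div_iff₀ hδ, mul_comm]
    exact h
  have hM1 : 0 ≤ M - 1 := by linarith
  have hM2 : 0 ≤ M - 2 := by linarith
  have hK : 0 ≤ 4 * L ^ 2 * (L + 1) * r := by positivity
  have h2 : L * (4 * L ^ 2 * (L + 1) * r) / δ ≤
      (1 + 1 / δ) * (4 * L ^ 2 * (L + 1)) * (M - 1) * r := by
    calc L * (4 * L ^ 2 * (L + 1) * r) / δ ≤ (M - 1) * (4 * L ^ 2 * (L + 1) * r) / δ := by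
          gcongr
          linarith
      _ = 1 / δ * ((4 * L ^ 2 * (L + 1)) * (M - 1) * r) := by ring
      _ ≤ (1 + 1 / δ) * ((4 * L ^ 2 * (L + 1)) * (M - 1) * r) := by
          gcongr
          linarith
      _ = _ := by ring
  have h3 : L / δ ≤ (M - 1) / δ *
      (1 + L * δ * Real.pi ^ 2 / 3 + L * (M - 2) * Real.pi ^ 2 / 6) := by
    calc L / δ ≤ (M - 1) / δ * 1 := by
          rw [mul_one]
          gcongr
          linarith
      _ ≤ _ := by
          gcongr
          have e1 : 0 ≤ L * δ * Real.pi ^ 2 / 3 := by positivity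
          have e2 : 0 ≤ L * (M - 2) * Real.pi ^ 2 / 6 := by positivity
          linarith
  have h4 : L * Real.pi ^ 2 / 3 / δ ≤ 2 * L * Real.pi ^ 2 / (3 * δ) := by
    rw [div_div]
    gcongr
    nlinarith [sq_nonneg Real.pi]
  refine h1.trans ?_
  rw [add_div, add_div, add_div]
  linarith

end Regret

end AkUCB

end

theorem proposition1 {V : Type*} [Fintype V] [DecidableEq V]
    (G : SimpleGraph V) [DecidableRel G.Adj]
    (k : ℕ) (hk : 1 ≤ k) (p : ℝ) (hp0 : 0 < p) (hp1 : p < 1)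
    (q : G.Dart → ℝ) (hq : ∀ i, 0 ≤ q i)
    (D : G.Dart → MeasureTheory.Measure ℝ) [∀ i, MeasureTheory.IsProbabilityMeasure (D i)]
    (hD : ∀ i, ∀ᵐ x ∂(D i), x ∈ Set.Icc (0 : ℝ) 1)
    (link : Fin (Fintype.card G.Dart) ≃ G.Dart)
    (first : Fin (Fintype.card G.Dart) → Finset G.Dart)
    (hfirst : ∀ j, AkUCB.IsMatching G (first j) ∧ link j ∈ first j)
    {Ω : Type*} [MeasurableSpace Ω] (P : MeasureTheory.Measure Ω)
    [MeasureTheory.IsProbabilityMeasure P]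
    (X : ℕ → Ω → G.Dart → ℝ) (c : ℕ → Ω → AkUCB.Coins G)
    (hX : ∀ t, Measurable (X t)) (hc : ∀ t, Measurable (c t))
    (hlaw : ∀ t, P.map (fun ω => (X t ω, c t ω)) =
      (MeasureTheory.Measure.pi D).prod (AkUCB.coinLaw G p k))
    (hindep : ProbabilityTheory.iIndepFun (fun t ω => (X t ω, c t ω)) P)
    (α : ℝ) (hα : α = ((k : ℝ) - 1) / (k + 1))
    (w : G.Dart → ℝ) (hw : w = AkUCB.meanWeight q D)
    (hgap : (AkUCB.nonNearOptimal α w).Nonempty)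
    (T : ℕ) :
    ∀ t ∈ Finset.Icc 1 T,
      AkUCB.alphaRegret P α w
          (fun τ ω => (AkUCB.run k q first (fun s => X s ω) (fun s => c s ω) τ).sched) t ≤
        AkUCB.gapMax α w hgap *
          (AkUCB.constD₁ G (AkUCB.delta G p k) * (Real.log t / AkUCB.gapMin α w hgap ^ 2) +
            AkUCB.constD₂ G (AkUCB.delta G p k)) := by
  intro t _
  subst hα hw
  have hw0 := AkUCB.meanWeight_nonneg hq hD
  obtain ⟨hk2, hG⟩ := AkUCB.of_nonNearOptimal_nonempty hk hw0 hgap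
  have hdrive : AkUCB.IsDriving P D p k X c := ⟨hX, hc, hlaw, hindep⟩
  have hreg := hdrive.alphaRegret_le (q := q) (fun j => (hfirst j).1) hgap t
  have hsum := hdrive.sum_nonNearOptimal_le hfirst hD hq hk2 hp0 hp1 hG hgap t
  have hδ := AkUCB.delta_pos (G := G) hk hp0 hp1 (AkUCB.one_le_maxDegree hG)
  refine hreg.trans (mul_le_mul_of_nonneg_left ?_ (AkUCB.gapMax_pos hgap).le)
  have hΔ := AkUCB.gapMin_pos hgap
  have hlog : 0 ≤ Real.log t := Real.log_natCast_nonneg t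
  have hM : (Fintype.card G.Dart : ℝ) + 1 ≤ (AkUCB.matchings G).card := by
    exact_mod_cast AkUCB.card_dart_lt_card_matchings (G := G)
  have hL : (1 : ℝ) ≤ Fintype.card G.Dart := by exact_mod_cast hG
  exact AkUCB.le_constD hL hM hδ (div_nonneg hlog (sq_nonneg _)) (by
    convert hsum using 3
    ring)
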